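/- Let $b\ge 2$ and $\lambda\ge 0$. Let $\mathbb T^b$ be the infinite rooted $b$-ary tree, let $T$ be its complete subtree of depth $m\ge 0$ at the root, with $n=(b^{m+1}-1)/(b-1)$ vertices, and let the boundary $\partial T$ be the set of vertices of level $m+1$. A boundary condition is a configuration $\tau\in\{0,1\}^{\mathbb T^b}$ (only its values on $\partial T$ matter). The hard-core Gibbs distribution $\mu=\mu_T^\tau$ with activity $\lambda$ gives to $\sigma\in\{0,1\}^T$ a probability proportional to $\lambda^{N(\sigma)}$, where $N(\sigma)$ is the number of $x\in T$ with $\sigma_x=1$ (occupied vertices) and $0^0=1$, if no two adjacent vertices of $T\cup\partial T$ are both occupied in the configuration equal to $\sigma$ on $T$ and to $\tau$ on $\partial T$, and probability $0$ otherwise. Let $\Omega=\{\sigma:\mu(\sigma)>0\}$. The (heat-bath) Glauber dynamics flips the spin at each $x\in T$ at rate $c_x(\sigma)$, the conditional probability under the Gibbs distribution that $x$ has the flipped spin given that all other spins are as in $\sigma$. Writing $\sigma^x$ for $\sigma$ flipped at $x$, set $$\mathcal D(f)=\tfrac12\sum_{x\in T}\mu\bigl(c_x\,[f(\sigma^x)-f(\sigma)]^2\bigr),\qquad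 \mathrm{Var}(f)=\mu(f^2)-\mu(f)^2,\qquad \mathrm{Ent}(f)=\mu(f\log f)-\mu(f)\log\mu(f),$$ and define the spectral gap and the logarithmic Sobolev constant by $$c_{\rm gap}(\mu)=\inf_f\frac{\mathcal D(f)}{\mathrm{Var}(f)},\qquad c_{\rm sob}(\mu)=\inf_{f\ge 0}\frac{\mathcal D(\sqrt f)}{\mathrm{Ent}(f)},$$ the infima being over functions $f:\Omega\to\mathbb R$ that are not constant (with $\inf\emptyset=+\infty$, which is relevant only if $|\Omega|=1$). The even (respectively odd) boundary condition is the configuration $\tau$ in which exactly the vertices of even (respectively odd) level are occupied. Put $\lambda_0=b^b/(b-1)^{b+1}$. **Theorem.** Both $c_{\rm gap}(\mu)$ and $c_{\rm sob}(\mu)$ are $\Omega(1)$ in the following two situations: (i) $\tau$ is arbitrary and $\lambda\le\max\{\frac1{\sqrt b-1},\lambda_0\}$: there is a constant $c=c(b,\lambda)>0$ such that $c_{\rm gap}(\mu_T^\tau)\ge c$ and $c_{\rm sob}(\mu_T^\tau)\ge c$ for every depth $m\ge0$ and every boundary condition $\tau$; (ii) $\tau$ is even or odd and $\lambda\ge0$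 is arbitrary: there is a constant $c=c(b,\lambda)>0$ such that $c_{\rm gap}(\mu_T^\tau)\ge c$ and $c_{\rm sob}(\mu_T^\tau)\ge c$ for every depth $m\ge0$ when $\tau$ is the even or the odd boundary condition. -/

import Mathlib

noncomputable section

namespace HardCore

/-- The infinite rooted `b`-ary tree.  A vertex is the word of child labels read along the path from
the root, so the root is `[]`, the level of `v` is `v.length`, and the children of `v` are the words
`v ++ [i]` with `i : Fin b`. -/
def tree (b : ℕ) : SimpleGraph (List (Fin b)) :=
  SimpleGraph.fromRel fun u v => ∃ i : Fin b, v = u ++ [i]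

/-- The complete subtree of depth `m` at the root.  Its neighbours outside it, the boundary, are
the vertices of level `m + 1`. -/
def completeSubtree (b m : ℕ) : Finset (List (Fin b)) :=
  (List.finite_length_le (Fin b) m).toFinset

/-- The even configuration on the infinite tree: exactly the even levels are occupied. -/
def evenBoundary (b : ℕ) : List (Fin b) → Bool := fun v => decide (Even v.length)

/-- The odd configuration on the infinite tree: exactly the odd levels are occupied. -/
def oddBoundary (b : ℕ) : List (Fin b) → Bool := fun v => decide (Odd v.length)

section Model

variable {V : Type*} [DecidableEq V]

/-- The configuration that is `ζ` on `A` and `η` outside `A`. -/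
def patch (A : Finset V) (η : V → Bool) (ζ : A → Bool) : V → Bool :=
  fun x => if h : x ∈ A then ζ ⟨x, h⟩ else η x

open Classical in
/-- The unnormalised hard-core weight in the region `A` of a configuration `σ` (`true` means
occupied): `lam` to the number of occupied sites of `A` if no edge meeting `A` has both of its
endpoints occupied, and `0` otherwise. -/
def weight (G : SimpleGraph V) (lam : ℝ) (A : Finset V) (σ : V → Bool) : ℝ :=
  if ∀ x ∈ A, ∀ y, G.Adj x y → ¬(σ x = true ∧ σ y = true) then
    lam ^ (A.filter fun x => σ x = true).card
  else 0

/-- The partition function of the region `A` with boundary condition `η`. -/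
def partitionFn (G : SimpleGraph V) (lam : ℝ) (A : Finset V) (η : V → Bool) : ℝ :=
  ∑ ζ : A → Bool, weight G lam A (patch A η ζ)

/-- The hard-core Gibbs distribution on `A` with boundary condition `η`. -/
def gibbs (G : SimpleGraph V) (lam : ℝ) (A : Finset V) (η : V → Bool) (ζ : A → Bool) : ℝ :=
  weight G lam A (patch A η ζ) / partitionFn G lam A η

/-- The expectation of `f` under the Gibbs distribution. -/
def expect (G : SimpleGraph V) (lam : ℝ) (A : Finset V) (η : V → Bool)
    (f : (A → Bool) → ℝ) : ℝ :=
  ∑ ζ : A → Bool, gibbs G lam A η ζ * f ζ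

/-- The variance of `f` under the Gibbs distribution. -/
def variance (G : SimpleGraph V) (lam : ℝ) (A : Finset V) (η : V → Bool)
    (f : (A → Bool) → ℝ) : ℝ :=
  expect G lam A η (fun ζ => f ζ ^ 2) - expect G lam A η f ^ 2

/-- The entropy of `f ≥ 0` under the Gibbs distribution, with `0 log 0 = 0`. -/
def entropy (G : SimpleGraph V) (lam : ℝ) (A : Finset V) (η : V → Bool)
    (f : (A → Bool) → ℝ) : ℝ :=
  expect G lam A η (fun ζ => f ζ * Real.log (f ζ)) -
    expect G lam A η f * Real.log (expect G lam A η f)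

/-- The configuration `ζ` with the spin at `x` flipped. -/
def flip {A : Finset V} (ζ : A → Bool) (x : A) : A → Bool :=
  Function.update ζ x (!ζ x)

/-- The heat-bath flip rate at `x`: the probability of the flipped spin at `x` under the Gibbs
distribution on the single site `x` given the configuration elsewhere. -/
def flipRate (G : SimpleGraph V) (lam : ℝ) (A : Finset V) (η : V → Bool)
    (x : A) (ζ : A → Bool) : ℝ :=
  gibbs G lam {x.1} (patch A η ζ) (fun _ => !ζ x)

/-- The Dirichlet form of the heat-bath Glauber dynamics, i.e. of the continuous-time Markov chain
with generator `(L f) ζ = ∑ x, c_x(ζ) (f (ζ^x) - f ζ)`.  The values of `f` at configurations of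
Gibbs probability zero do not contribute, as flips into them have rate zero. -/
def dirichlet (G : SimpleGraph V) (lam : ℝ) (A : Finset V) (η : V → Bool)
    (f : (A → Bool) → ℝ) : ℝ :=
  (1 / 2) * ∑ x : A,
    expect G lam A η (fun ζ => flipRate G lam A η x ζ * (f (flip ζ x) - f ζ) ^ 2)

/-- `f` is not constant on the set of valid configurations (those of positive probability). -/
def NonConst (G : SimpleGraph V) (lam : ℝ) (A : Finset V) (η : V → Bool)
    (f : (A → Bool) → ℝ) : Prop :=
  ∃ ζ ζ' : A → Bool, 0 < gibbs G lam A η ζ ∧ 0 < gibbs G lam A η ζ' ∧ f ζ ≠ f ζ'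

/-- The spectral gap of the Glauber dynamics on `A` with boundary condition `η`.  The infimum is
taken in the extended reals; it is `⊤` if there is only one valid configuration. -/
def spectralGap (G : SimpleGraph V) (lam : ℝ) (A : Finset V) (η : V → Bool) : EReal :=
  ⨅ (f : (A → Bool) → ℝ) (_ : NonConst G lam A η f),
    ((dirichlet G lam A η f / variance G lam A η f : ℝ) : EReal)

/-- The logarithmic Sobolev constant of the Glauber dynamics on `A` with boundary condition `η`,
again as an infimum in the extended reals. -/
def logSobolev (G : SimpleGraph V) (lam : ℝ) (A : Finset V) (η : V → Bool) : EReal :=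
  ⨅ (f : (A → Bool) → ℝ) (_ : ∀ ζ, 0 ≤ f ζ) (_ : NonConst G lam A η f),
    ((dirichlet G lam A η (fun ζ => √(f ζ)) / entropy G lam A η f : ℝ) : EReal)

end Model

end HardCore

end

noncomputable section
namespace HardCore

section ProductWeight

variable {α ι : Type*} [Fintype ι]

/-- The product weight. -/
def pw (w : ι → α → ℝ) (c : ι → α) : ℝ := ∏ i, w i (c i)

theorem pw_update [DecidableEq ι] (w : ι → α → ℝ) (c : ι → α) (i : ι) (d : α) :
    pw w (Function.update c i d) * w i (c i) = pw w c * w i d := by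
  have h : ∀ j ∈ Finset.univ.erase i, w j (Function.update c i d j) = w j (c j) := fun j hj => by
    rw [Function.update_of_ne (Finset.ne_of_mem_erase hj)]
  simp only [pw]
  rw [← Finset.mul_prod_erase _ _ (Finset.mem_univ i), Finset.prod_congr rfl h,
    ← Finset.mul_prod_erase _ (fun j => w j (c j)) (Finset.mem_univ i), Function.update_self]
  ring

end ProductWeight

section FiniteExpectation

variable {α β ι : Type*} [Fintype α] [Fintype β]

/-- The expectation of `f` for the weight `w` on a finite type. -/
def ex (w f : α → ℝ) : ℝ := ∑ x, w x * f x

/-- `w` is a probability weight. -/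
structure IsProb (w : α → ℝ) : Prop where
  nonneg : ∀ x, 0 ≤ w x
  sum_eq_one : ∑ x, w x = 1

theorem ex_add (w f g : α → ℝ) : ex w (fun x => f x + g x) = ex w f + ex w g := by
  simp [ex, mul_add, Finset.sum_add_distrib]

theorem ex_sub (w f g : α → ℝ) : ex w (fun x => f x - g x) = ex w f - ex w g := by
  simp [ex, mul_sub, Finset.sum_sub_distrib]

theorem ex_const_mul (w f : α → ℝ) (a : ℝ) : ex w (fun x => a * f x) = a * ex w f := by
  simp only [ex, Finset.mul_sum]
  exact Finset.sum_congr rfl fun x _ => by ring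

theorem ex_mul_const (w f : α → ℝ) (a : ℝ) : ex w (fun x => f x * a) = ex w f * a := by
  simp only [ex, Finset.sum_mul]
  exact Finset.sum_congr rfl fun x _ => by ring

theorem ex_sum {κ : Type*} (s : Finset κ) (w : α → ℝ) (f : κ → α → ℝ) :
    ex w (fun x => ∑ k ∈ s, f k x) = ∑ k ∈ s, ex w (f k) := by
  simp only [ex, Finset.mul_sum]
  exact Finset.sum_comm

theorem ex_comm (w : α → ℝ) (v : β → ℝ) (f : α → β → ℝ) :
    ex w (fun x => ex v (f x)) = ex v (fun y => ex w fun x => f x y) := by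
  simp only [ex, Finset.mul_sum]
  rw [Finset.sum_comm]
  exact Finset.sum_congr rfl fun _ _ => Finset.sum_congr rfl fun _ _ => by ring

theorem ex_zero (w : α → ℝ) : ex w (fun _ => 0) = 0 := by simp [ex]

theorem IsProb.ex_const {w : α → ℝ} (hw : IsProb w) (a : ℝ) : ex w (fun _ => a) = a := by
  simp [ex, ← Finset.sum_mul, hw.sum_eq_one]

theorem IsProb.ex_mono {w f g : α → ℝ} (hw : IsProb w) (h : ∀ x, f x ≤ g x) :
    ex w f ≤ ex w g :=
  Finset.sum_le_sum fun x _ => mul_le_mul_of_nonneg_left (h x) (hw.nonneg x)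

theorem IsProb.ex_nonneg {w f : α → ℝ} (hw : IsProb w) (h : ∀ x, 0 ≤ f x) : 0 ≤ ex w f :=
  Finset.sum_nonneg fun x _ => mul_nonneg (hw.nonneg x) (h x)

theorem IsProb.ex_le_const {w f : α → ℝ} (hw : IsProb w) {a : ℝ} (h : ∀ x, f x ≤ a) :
    ex w f ≤ a := (hw.ex_mono h).trans_eq (hw.ex_const a)

theorem IsProb.abs_ex_le {w f : α → ℝ} (hw : IsProb w) : |ex w f| ≤ ex w (fun x => |f x|) := by
  refine (Finset.abs_sum_le_sum_abs _ _).trans_eq (Finset.sum_congr rfl fun x _ => ?_)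
  rw [abs_mul, abs_of_nonneg (hw.nonneg x)]

theorem IsProb.abs_ex_le_ex {w f g : α → ℝ} (hw : IsProb w) (h : ∀ x, |f x| ≤ g x) :
    |ex w f| ≤ ex w g := hw.abs_ex_le.trans (hw.ex_mono h)

theorem IsProb.ex_pos {w f : α → ℝ} (hw : IsProb w) (h : ∀ x, 0 < f x) : 0 < ex w f := by
  obtain ⟨x, hx⟩ : ∃ x, w x ≠ 0 := by
    by_contra! hne
    simpa [hne] using hw.sum_eq_one
  exact Finset.sum_pos' (fun y _ => mul_nonneg (hw.nonneg y) (h y).le)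
    ⟨x, Finset.mem_univ x, mul_pos (lt_of_le_of_ne (hw.nonneg x) hx.symm) (h x)⟩

theorem IsProb.sq_ex_le {w f : α → ℝ} (hw : IsProb w) : ex w f ^ 2 ≤ ex w (fun x => f x ^ 2) := by
  have h := hw.ex_nonneg (f := fun x => (f x - ex w f) ^ 2) fun x => sq_nonneg _
  have e : ex w (fun x => (f x - ex w f) ^ 2)
      = ex w (fun x => f x ^ 2) - ex w (fun x => 2 * ex w f * f x) + ex w (fun _ => ex w f ^ 2) := by
    rw [← ex_sub, ← ex_add]
    exact congrArg _ (funext fun x => by ring)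
  rw [e, ex_const_mul, hw.ex_const] at h
  nlinarith

/-- The entropy of `f ≥ 0` for the weight `w`. -/
def ent (w f : α → ℝ) : ℝ := ex w (fun x => f x * Real.log (f x)) - ex w f * Real.log (ex w f)

variable [Fintype ι] [DecidableEq ι]

theorem ex_pw_prod (w f : ι → α → ℝ) :
    ex (pw w) (fun c => ∏ i, f i (c i)) = ∏ i, ex (w i) (f i) := by
  simp only [ex, pw, ← Finset.prod_mul_distrib]
  rw [Finset.prod_univ_sum, Fintype.piFinset_univ]

theorem IsProb.pw {w : ι → α → ℝ} (hw : ∀ i, IsProb (w i)) : IsProb (pw w) where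
  nonneg c := Finset.prod_nonneg fun i _ => (hw i).nonneg _
  sum_eq_one := by
    have h := ex_pw_prod w (fun _ _ => 1)
    simp only [Finset.prod_const_one, (hw _).ex_const] at h
    simpa [ex] using h

/-- Resampling one coordinate of a product does not change the expectation. -/
theorem ex_pw_update {w : ι → α → ℝ} {i : ι} (hw : IsProb (w i)) (f : (ι → α) → ℝ) :
    ex (HardCore.pw w) (fun c => ex (w i) fun d => f (Function.update c i d))
      = ex (HardCore.pw w) f := by
  have h1 : ex (HardCore.pw w) (fun c => ex (w i) fun d => f (Function.update c i d))
      = ∑ x : (ι → α) × α, HardCore.pw w x.1 * w i x.2 * f (Function.update x.1 i x.2) := by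
    simp only [ex, Finset.mul_sum, Fintype.sum_prod_type, mul_assoc]
  have h2 : ex (HardCore.pw w) f = ∑ x : (ι → α) × α, HardCore.pw w x.1 * w i x.2 * f x.1 := by
    simp only [Fintype.sum_prod_type, ex]
    refine Finset.sum_congr rfl fun c _ => ?_
    rw [← Finset.sum_mul, ← Finset.mul_sum, hw.sum_eq_one, mul_one]
  rw [h1, h2]
  refine Finset.sum_bij' (fun x _ => (Function.update x.1 i x.2, x.1 i))
    (fun x _ => (Function.update x.1 i x.2, x.1 i)) (by simp) (by simp) (by simp) (by simp) ?_
  rintro ⟨c, d⟩ -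
  simp only [pw_update]

/-- Changing the factors of a product one at a time. -/
theorem abs_ex_pw_sub_le {w v : ι → α → ℝ} (hw : ∀ i, IsProb (w i)) (hv : ∀ i, IsProb (v i))
    (f : (ι → α) → ℝ) (δ : ι → ℝ)
    (h : ∀ i c, |ex (w i) (fun d => f (Function.update c i d))
      - ex (v i) (fun d => f (Function.update c i d))| ≤ δ i) :
    |ex (HardCore.pw w) f - ex (HardCore.pw v) f| ≤ ∑ i, δ i := by
  have hW := IsProb.pw hw
  have hV := IsProb.pw hv
  suffices H : ∀ S : Finset ι,
      |ex (HardCore.pw w) (fun c => ex (HardCore.pw v) fun c' => f (S.piecewise c c'))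
        - ex (HardCore.pw v) f| ≤ ∑ i ∈ S, δ i by
    simpa [hV.ex_const] using H Finset.univ
  intro S
  induction S using Finset.induction_on with
  | empty => simp [hW.ex_const]
  | insert i S hi ih =>
    rw [Finset.sum_insert hi]
    refine (abs_sub_le _ (ex (HardCore.pw w) (fun c => ex (HardCore.pw v) fun c' =>
      f (S.piecewise c c'))) _).trans (add_le_add ?_ ih)
    have e1 : ex (HardCore.pw w) (fun c => ex (HardCore.pw v) fun c' =>
        f ((insert i S).piecewise c c')) = ex (HardCore.pw w) (fun c => ex (HardCore.pw v) fun c' =>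
        ex (w i) fun d => f (Function.update (S.piecewise c c') i d)) := by
      rw [← ex_pw_update (hw i)]
      refine congrArg _ (funext fun c => ?_)
      rw [ex_comm]
      refine congrArg _ (funext fun c' => congrArg _ (funext fun d => congrArg f ?_))
      funext j
      by_cases hj : j = i
      · subst hj; simp
      · by_cases hS : j ∈ S <;> simp [hj, hS]
    have e2 : ex (HardCore.pw w) (fun c => ex (HardCore.pw v) fun c' =>
        f (S.piecewise c c')) = ex (HardCore.pw w) (fun c => ex (HardCore.pw v) fun c' =>
        ex (v i) fun d => f (Function.update (S.piecewise c c') i d)) := by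
      refine congrArg _ (funext fun c => ?_)
      rw [← ex_pw_update (hv i)]
      refine congrArg _ (funext fun c' => congrArg _ (funext fun d => congrArg f ?_))
      funext j
      by_cases hj : j = i
      · subst hj; simp [hi]
      · by_cases hS : j ∈ S <;> simp [hj, hS]
    rw [e1, e2, ← ex_sub]
    simp only [← ex_sub]
    refine (hW.abs_ex_le_ex (g := fun _ => δ i) fun c => ?_).trans_eq (hW.ex_const _)
    refine (hV.abs_ex_le_ex (g := fun _ => δ i) fun c' => ?_).trans_eq (hV.ex_const _)
    exact h i _

/-- The expectation over the coordinates in `S`, the others being kept. -/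
def exOn (w : ι → α → ℝ) (S : Finset ι) (f : (ι → α) → ℝ) (c : ι → α) : ℝ :=
  ex (HardCore.pw w) fun c' => f (S.piecewise c' c)

theorem exOn_insert {w : ι → α → ℝ} {S : Finset ι} {i : ι} (hw : IsProb (w i)) (hi : i ∉ S)
    (f : (ι → α) → ℝ) (c : ι → α) :
    exOn w (insert i S) f c = ex (w i) fun d => exOn w S f (Function.update c i d) := by
  unfold exOn
  rw [ex_comm, ← ex_pw_update hw]
  refine congrArg _ (funext fun c' => congrArg _ (funext fun d => congrArg f ?_))
  funext j
  by_cases hj : j = i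
  · subst hj; simp [hi]
  · by_cases hS : j ∈ S <;> simp [hj, hS]

end FiniteExpectation

section Entropy

variable {α β ι : Type*} [Fintype α] [Fintype β] [Fintype ι] [DecidableEq ι]

/-- The variational inequality for the entropy. -/
theorem IsProb.ex_mul_le_ent {w f : α → ℝ} (hw : IsProb w) (hf : ∀ x, 0 ≤ f x) (φ : α → ℝ) :
    ex w (fun x => f x * φ x)
      ≤ ent w f + ex w f * Real.log (ex w fun x => Real.exp (φ x)) := by
  rcases (hw.ex_nonneg hf).eq_or_lt with hm | hm
  · have h0 : ∀ x, w x * f x = 0 := by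
      intro x
      have := (Finset.sum_eq_zero_iff_of_nonneg
        fun x _ => mul_nonneg (hw.nonneg x) (hf x)).1 hm.symm
      exact this x (Finset.mem_univ x)
    have h1 : ∀ g : α → ℝ, ex w (fun x => f x * g x) = 0 := fun g =>
      Finset.sum_eq_zero fun x _ => by rw [← mul_assoc, h0, zero_mul]
    simp [ent, h1, ← hm]
  · have hZ : 0 < ex w fun x => Real.exp (φ x) := hw.ex_pos fun x => Real.exp_pos _
    set m := ex w f
    set Z := ex w fun x => Real.exp (φ x) with hZdef
    have key : ∀ x, f x * (φ x + (Real.log m - Real.log Z))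
        ≤ f x * Real.log (f x) - f x + Real.exp (φ x) * (m / Z) := by
      intro x
      have he : Real.exp (φ x) * (m / Z) = Real.exp (φ x + (Real.log m - Real.log Z)) := by
        rw [Real.exp_add, Real.exp_sub, Real.exp_log hm, Real.exp_log hZ]
      rw [he]
      rcases (hf x).eq_or_lt with h | h
      · simp only [← h, zero_mul, sub_zero, zero_add]
        positivity
      · have := Real.add_one_le_exp (φ x + (Real.log m - Real.log Z) - Real.log (f x))
        rw [Real.exp_sub, Real.exp_log h, le_div_iff₀ h] at this
        linarith
    have h2 := hw.ex_mono key
    simp only [mul_add] at h2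
    rw [ex_add, ex_add, ex_sub, ex_mul_const, ex_mul_const, ← hZdef, mul_div_cancel₀ _ hZ.ne'] at h2
    unfold ent
    linarith

/-- The entropy is the smallest bound in the variational inequality. -/
theorem IsProb.ent_le_of_forall {w f : α → ℝ} (hw : IsProb w) (hf : ∀ x, 0 ≤ f x) {A : ℝ}
    (h : ∀ φ : α → ℝ, ex w (fun x => f x * φ x)
      ≤ A + ex w f * Real.log (ex w fun x => Real.exp (φ x))) :
    ent w f ≤ A := by
  refine le_of_forall_pos_le_add fun δ hδ => ?_
  have h1 := h fun x => Real.log (f x + δ)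
  have h2 : (fun x => Real.exp (Real.log (f x + δ))) = fun x => f x + δ :=
    funext fun x => Real.exp_log (by linarith [hf x])
  rw [h2, ex_add, hw.ex_const] at h1
  have h3 : ex w (fun x => f x * Real.log (f x)) ≤ ex w (fun x => f x * Real.log (f x + δ)) := by
    refine hw.ex_mono fun x => ?_
    rcases (hf x).eq_or_lt with h | h
    · simp [← h]
    · gcongr
      linarith
  have h4 : ex w f * Real.log (ex w f + δ) ≤ ex w f * Real.log (ex w f) + δ := by
    rcases (hw.ex_nonneg hf).eq_or_lt with hm | hm
    · simp [← hm, hδ.le]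
    · have := Real.log_le_sub_one_of_pos (x := (ex w f + δ) / ex w f) (by positivity)
      rw [Real.log_div (by positivity) hm.ne', div_sub_one hm.ne', le_div_iff₀ hm] at this
      linarith
  unfold ent
  linarith

theorem IsProb.ent_nonneg {w f : α → ℝ} (hw : IsProb w) (hf : ∀ x, 0 ≤ f x) : 0 ≤ ent w f := by
  simpa [hw.ex_const, ex_zero] using hw.ex_mul_le_ent hf fun _ => 0

/-- The entropy is convex. -/
theorem ent_ex_le {w : α → ℝ} {v : β → ℝ} (hw : IsProb w) (hv : IsProb v) {F : β → α → ℝ}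
    (hF : ∀ k x, 0 ≤ F k x) :
    ent w (fun x => ex v fun k => F k x) ≤ ex v fun k => ent w (F k) := by
  refine hw.ent_le_of_forall (fun x => hv.ex_nonneg fun k => hF k x) fun φ => ?_
  have h := hv.ex_mono fun k => hw.ex_mul_le_ent (hF k) φ
  rw [ex_add, ex_mul_const] at h
  simp only [← ex_mul_const] at h ⊢
  rw [ex_comm w v]
  simpa [ex_comm w v, ex_mul_const] using h

theorem IsProb.ent_le_var_div {w f : α → ℝ} (hw : IsProb w) (hf : ∀ x, 0 ≤ f x)
    (hm : 0 < ex w f) :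
    ent w f ≤ (ex w (fun x => f x ^ 2) - ex w f ^ 2) / ex w f := by
  set m := ex w f with hmdef
  have key : ∀ x, f x * Real.log (f x) ≤ f x ^ 2 * m⁻¹ + f x * (Real.log m - 1) := by
    intro x
    rcases (hf x).eq_or_lt with h | h
    · simp [← h]
    · have := Real.log_le_sub_one_of_pos (x := f x / m) (by positivity)
      rw [Real.log_div h.ne' hm.ne'] at this
      have h2 := mul_le_mul_of_nonneg_left this h.le
      have : f x * (f x / m - 1) = f x ^ 2 * m⁻¹ - f x := by field_simp
      linarith
  have h := hw.ex_mono key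
  rw [ex_add, ex_mul_const, ex_mul_const, ← hmdef] at h
  have e : (ex w (fun x => f x ^ 2) - m ^ 2) / m = ex w (fun x => f x ^ 2) * m⁻¹ - m := by
    field_simp
  rw [e, ent, ← hmdef]
  linarith

theorem IsProb.var_le_ent_sq {w F : α → ℝ} (hw : IsProb w) (hF : ∀ x, 0 ≤ F x) :
    ex w (fun x => F x ^ 2) - ex w F ^ 2 ≤ ent w fun x => F x ^ 2 := by
  have hS := hw.ex_nonneg fun x => sq_nonneg (F x)
  rcases hS.eq_or_lt with hS | hS
  · have := hw.ent_nonneg (f := fun x => F x ^ 2) fun x => sq_nonneg _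
    nlinarith [sq_nonneg (ex w F)]
  · set S := ex w fun x => F x ^ 2 with hSdef
    set s := √S
    have hs : 0 < s := Real.sqrt_pos.2 hS
    have hsS : s ^ 2 = S := Real.sq_sqrt hS.le
    have key : ∀ x, F x ^ 2 * (Real.log S + 2) - F x * (2 * s) ≤ F x ^ 2 * Real.log (F x ^ 2) := by
      intro x
      rcases (hF x).eq_or_lt with h | h
      · simp [← h]
      · have := Real.log_le_sub_one_of_pos (x := s / F x) (by positivity)
        rw [Real.log_div hs.ne' h.ne'] at this
        rw [← hsS, Real.log_pow, Real.log_pow]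
        have h2 := mul_le_mul_of_nonneg_left this (sq_nonneg (F x))
        have : F x ^ 2 * (s / F x - 1) = F x * s - F x ^ 2 := by field_simp
        push_cast
        linarith
    have h := hw.ex_mono key
    rw [ex_sub, ex_mul_const, ex_mul_const, ← hSdef] at h
    rw [ent, ← hSdef]
    nlinarith [sq_nonneg (s - ex w F)]

/-- The variational inequality on a product space follows from the inequalities for the factors. -/
theorem ex_pw_mul_le {w : ι → α → ℝ} (hw : ∀ i, IsProb (w i)) (K : ι → (α → ℝ) → Prop)
    (hK : ∀ (i : ι) (φ : (ι → α) → α → ℝ), (∀ k, K i (φ k)) →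
      K i fun d => Real.log (ex (pw w) fun k => Real.exp (φ k d)))
    (Ψ : ι → (α → ℝ) → ℝ)
    (hΨ : ∀ (i : ι) (F : (ι → α) → α → ℝ), (∀ k d, 0 ≤ F k d) →
      Ψ i (fun d => ex (pw w) fun k => F k d) ≤ ex (pw w) fun k => Ψ i (F k))
    (H : ∀ i f φ, (∀ d, 0 ≤ f d) → K i φ → ex (w i) (fun d => f d * φ d)
      ≤ Ψ i f + ex (w i) f * Real.log (ex (w i) fun d => Real.exp (φ d)))
    {f φ : (ι → α) → ℝ} (hf : ∀ c, 0 ≤ f c)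
    (hφ : ∀ i c, K i fun d => φ (Function.update c i d)) :
    ex (pw w) (fun c => f c * φ c)
      ≤ ∑ i, ex (pw w) (fun c => Ψ i fun d => f (Function.update c i d))
        + ex (pw w) f * Real.log (ex (pw w) fun c => Real.exp (φ c)) := by
  have hW := IsProb.pw hw
  suffices h : ∀ (S : Finset ι) (c : ι → α), exOn w S (fun c => f c * φ c) c
      ≤ ∑ i ∈ S, exOn w S (fun c => Ψ i fun d => f (Function.update c i d)) c
        + exOn w S f c * Real.log (exOn w S (fun c => Real.exp (φ c)) c) by
    obtain ⟨c⟩ : Nonempty (ι → α) := by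
      by_contra hne
      rw [not_nonempty_iff] at hne
      simpa using hW.sum_eq_one
    simpa [exOn] using h Finset.univ c
  intro S
  induction S using Finset.induction_on with
  | empty => intro c; simp [exOn, hW.ex_const]
  | insert i S hi ih =>
    intro c
    rw [exOn_insert (hw i) hi]
    refine ((hw i).ex_mono fun d => ih _).trans ?_
    rw [ex_add, Finset.sum_insert hi, add_right_comm, add_comm]
    have hup : ∀ (c' : ι → α) d, S.piecewise c' (Function.update c i d)
        = Function.update (S.piecewise c' c) i d := by
      intro c' d
      funext j
      by_cases hj : j = i
      · subst hj; simp [hi]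
      · by_cases hS : j ∈ S <;> simp [hj, hS]
    refine add_le_add ?_ ?_
    · have hpos : ∀ c, 0 < exOn w S (fun c => Real.exp (φ c)) c := fun c =>
        hW.ex_pos fun _ => Real.exp_pos _
      have h1 := H i (fun d => exOn w S f (Function.update c i d))
        (fun d => Real.log (exOn w S (fun c => Real.exp (φ c)) (Function.update c i d)))
        (fun d => hW.ex_nonneg fun _ => hf _)
        (by
          unfold exOn
          simp only [hup]
          exact hK i (fun c' d => φ (Function.update (S.piecewise c' c) i d)) fun c' => hφ i _)
      refine h1.trans (add_le_add ?_ (le_of_eq ?_))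
      · rw [exOn_insert (hw i) hi]
        unfold exOn
        simp only [hup]
        refine (hΨ i _ fun k d => hf _).trans ?_
        simp [(hw i).ex_const]
      · rw [exOn_insert (hw i) hi, exOn_insert (hw i) hi]
        simp only [Real.exp_log (hpos _)]
    · rw [ex_sum]
      refine Finset.sum_le_sum fun j _ => le_of_eq ?_
      rw [exOn_insert (hw i) hi]

end Entropy

section TreeModel

variable {b : ℕ}

/-- The boundary condition seen from the `i`-th child of the root. -/
def childBoundary (τ : List (Fin b) → Bool) (i : Fin b) : List (Fin b) → Bool :=
  fun v => τ (i :: v)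

/-- Configurations on the `b`-ary tree with `n` levels. -/
def Conf (b : ℕ) : ℕ → Type
  | 0 => Unit
  | n + 1 => Bool × (Fin b → Conf b n)

instance instFintypeConf : ∀ n, Fintype (Conf b n)
  | 0 => inferInstanceAs (Fintype Unit)
  | n + 1 =>
    have := instFintypeConf n
    inferInstanceAs (Fintype (Bool × (Fin b → Conf b n)))

/-- The probability that the root of the tree with `n` levels is vacant if its parent is; for `n = 0`
the root belongs to the boundary. -/
def vac (lam : ℝ) : ℕ → (List (Fin b) → Bool) → ℝ
  | 0, τ => if τ [] then 0 else 1
  | n + 1, τ => 1 / (1 + lam * ∏ i, vac lam n (childBoundary τ i))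

/-- The law of the root of the tree with `n + 1` levels, given the spin `u` of its parent. -/
def rootWt (lam : ℝ) (n : ℕ) (τ : List (Fin b) → Bool) : Bool → Bool → ℝ
  | true, true => 0
  | true, false => 1
  | false, true => 1 - vac lam (n + 1) τ
  | false, false => vac lam (n + 1) τ

/-- The law of the configuration on the tree with `n` levels, given the spin `u` of the parent of
its root. -/
def treeWt (lam : ℝ) : (n : ℕ) → (List (Fin b) → Bool) → Bool → Conf b n → ℝ
  | 0, _, _, _ => 1
  | n + 1, τ, u, σ =>
    rootWt lam n τ u σ.1 * ∏ i, treeWt lam n (childBoundary τ i) σ.1 (σ.2 i)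

/-- The law of the configuration below the root, given the spin `s` of the root. -/
def childWt (lam : ℝ) (n : ℕ) (τ : List (Fin b) → Bool) (s : Bool) : (Fin b → Conf b n) → ℝ :=
  pw fun i => treeWt lam n (childBoundary τ i) s

variable {lam : ℝ}

theorem vac_succ (n : ℕ) (τ : List (Fin b) → Bool) :
    vac lam (n + 1) τ = 1 / (1 + lam * ∏ i, vac lam n (childBoundary τ i)) := rfl

theorem vac_mem (hlam : 0 ≤ lam) :
    ∀ (n : ℕ) (τ : List (Fin b) → Bool), 0 ≤ vac lam n τ ∧ vac lam n τ ≤ 1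
  | 0, τ => by
    unfold vac
    split_ifs <;> norm_num
  | n + 1, τ => by
    have h : 0 ≤ lam * ∏ i, vac lam n (childBoundary τ i) :=
      mul_nonneg hlam (Finset.prod_nonneg fun i _ => (vac_mem hlam n _).1)
    unfold vac
    exact ⟨by positivity, by rw [div_le_one (by positivity)]; linarith⟩

theorem prod_vac_mem (hlam : 0 ≤ lam) (n : ℕ) (τ : List (Fin b) → Bool) :
    0 ≤ ∏ i, vac lam n (childBoundary τ i) ∧ ∏ i, vac lam n (childBoundary τ i) ≤ 1 :=
  ⟨Finset.prod_nonneg fun _ _ => (vac_mem hlam n _).1,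
    Finset.prod_le_one (fun _ _ => (vac_mem hlam n _).1) fun _ _ => (vac_mem hlam n _).2⟩

theorem vac_succ_ge (hlam : 0 ≤ lam) (n : ℕ) (τ : List (Fin b) → Bool) :
    1 / (1 + lam) ≤ vac lam (n + 1) τ := by
  have h := prod_vac_mem hlam n τ
  unfold vac
  have : 0 ≤ lam * ∏ i, vac lam n (childBoundary τ i) := mul_nonneg hlam h.1
  gcongr
  nlinarith

theorem one_sub_vac_succ (hlam : 0 ≤ lam) (n : ℕ) (τ : List (Fin b) → Bool) :
    1 - vac lam (n + 1) τ
      = lam * (∏ i, vac lam n (childBoundary τ i)) * vac lam (n + 1) τ := by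
  have : 0 ≤ lam * ∏ i, vac lam n (childBoundary τ i) :=
    mul_nonneg hlam (prod_vac_mem hlam n τ).1
  rw [vac_succ]
  field_simp
  ring

theorem isProb_rootWt (hlam : 0 ≤ lam) (n : ℕ) (τ : List (Fin b) → Bool) (u : Bool) :
    IsProb (rootWt lam n τ u) where
  nonneg s := by
    have := vac_mem hlam (n + 1) τ
    cases u <;> cases s <;> simp [rootWt, this.1, this.2]
  sum_eq_one := by cases u <;> simp [rootWt]

theorem isProb_treeWt (hlam : 0 ≤ lam) :
    ∀ (n : ℕ) (τ : List (Fin b) → Bool) (u : Bool), IsProb (treeWt lam n τ u)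
  | 0, τ, u => ⟨fun _ => zero_le_one, by
      change ∑ _x : Unit, (1 : ℝ) = 1
      simp⟩
  | n + 1, τ, u => by
    have hc : ∀ s, IsProb (childWt lam n τ s) := fun s =>
      IsProb.pw fun i => isProb_treeWt hlam n (childBoundary τ i) s
    have hr := isProb_rootWt hlam n τ u
    refine ⟨fun σ => mul_nonneg (hr.nonneg _) ((hc σ.1).nonneg σ.2), ?_⟩
    change ∑ σ : Bool × (Fin b → Conf b n), rootWt lam n τ u σ.1 * childWt lam n τ σ.1 σ.2 = 1
    rw [Fintype.sum_prod_type]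
    simp only [← Finset.mul_sum, (hc _).sum_eq_one, mul_one, hr.sum_eq_one]

theorem isProb_childWt (hlam : 0 ≤ lam) (n : ℕ) (τ : List (Fin b) → Bool) (s : Bool) :
    IsProb (childWt lam n τ s) :=
  IsProb.pw fun i => isProb_treeWt hlam n (childBoundary τ i) s

theorem ex_treeWt_zero (τ : List (Fin b) → Bool) (u : Bool) (f : Conf b 0 → ℝ) :
    ex (treeWt lam 0 τ u) f = f () := by
  change ∑ x : Unit, 1 * f x = f ()
  rw [Fintype.sum_unique, one_mul]

theorem ex_treeWt_succ (n : ℕ) (τ : List (Fin b) → Bool) (u : Bool) (f : Conf b (n + 1) → ℝ) :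
    ex (treeWt lam (n + 1) τ u) f
      = ex (rootWt lam n τ u) fun s => ex (childWt lam n τ s) fun c => f (s, c) := by
  change ∑ σ : Bool × (Fin b → Conf b n),
    rootWt lam n τ u σ.1 * childWt lam n τ σ.1 σ.2 * f σ = _
  rw [Fintype.sum_prod_type]
  simp only [ex, Finset.mul_sum, mul_assoc]

/-- A functional of functions on the configurations of each tree. -/
abbrev Functional (b : ℕ) : Type :=
  (n : ℕ) → (List (Fin b) → Bool) → Bool → (Conf b n → ℝ) → ℝ

/-- The sum over the vertices at level `j` of the mean value of `Q` on the subtree at that vertex,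
the configuration outside this subtree being kept. -/
def levelSum (lam : ℝ) (Q : Functional b) : ℕ → Functional b
  | 0, n, τ, u, f => Q n τ u f
  | _ + 1, 0, _, _, _ => 0
  | j + 1, n + 1, τ, u, f => ex (rootWt lam n τ u) fun s => ∑ i, ex (childWt lam n τ s) fun c =>
      levelSum lam Q j n (childBoundary τ i) s fun d => f (s, Function.update c i d)

theorem levelSum_mono (hlam : 0 ≤ lam) {P : ℕ → (List (Fin b) → Bool) → Prop}
    (hP : ∀ n τ i, P (n + 1) τ → P n (childBoundary τ i)) {Q R : Functional b}
    (h : ∀ n τ u f, P n τ → (∀ x, 0 ≤ f x) → Q n τ u f ≤ R n τ u f) :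
    ∀ (j n : ℕ) (τ : List (Fin b) → Bool) (u : Bool) (f : Conf b n → ℝ), P n τ → (∀ x, 0 ≤ f x) →
      levelSum lam Q j n τ u f ≤ levelSum lam R j n τ u f
  | 0, n, τ, u, f, hp, hf => h n τ u f hp hf
  | _ + 1, 0, _, _, _, _, _ => le_rfl
  | j + 1, n + 1, τ, u, _, hp, hf =>
    (isProb_rootWt hlam n τ u).ex_mono fun s => Finset.sum_le_sum fun i _ =>
      (isProb_childWt hlam n τ s).ex_mono fun _ =>
        levelSum_mono hlam hP h j n _ s _ (hP n τ i hp) fun _ => hf _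

theorem levelSum_add (Q R : Functional b) :
    ∀ (j n : ℕ) (τ : List (Fin b) → Bool) (u : Bool) (f : Conf b n → ℝ),
      levelSum lam (fun n τ u f => Q n τ u f + R n τ u f) j n τ u f
        = levelSum lam Q j n τ u f + levelSum lam R j n τ u f
  | 0, n, τ, u, f => rfl
  | _ + 1, 0, _, _, _ => (add_zero 0).symm
  | j + 1, n + 1, τ, u, f => by
    simp only [levelSum, levelSum_add Q R j, ex_add, Finset.sum_add_distrib]

theorem levelSum_const_mul (a : ℝ) (Q : Functional b) :
    ∀ (j n : ℕ) (τ : List (Fin b) → Bool) (u : Bool) (f : Conf b n → ℝ),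
      levelSum lam (fun n τ u f => a * Q n τ u f) j n τ u f = a * levelSum lam Q j n τ u f
  | 0, n, τ, u, f => rfl
  | _ + 1, 0, _, _, _ => (mul_zero a).symm
  | j + 1, n + 1, τ, u, f => by
    simp only [levelSum, levelSum_const_mul a Q j, ex_const_mul, ← Finset.mul_sum]

theorem levelSum_zero : ∀ (j n : ℕ) (τ : List (Fin b) → Bool) (u : Bool) (f : Conf b n → ℝ),
    levelSum lam (fun _ _ _ _ => 0) j n τ u f = 0
  | 0, _, _, _, _ => rfl
  | _ + 1, 0, _, _, _ => rfl
  | j + 1, n + 1, τ, u, f => by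
    simp only [levelSum, levelSum_zero j, ex_zero, Finset.sum_const_zero]

theorem levelSum_sum {κ : Type*} (s : Finset κ) (Q : κ → Functional b) (j n : ℕ)
    (τ : List (Fin b) → Bool) (u : Bool) (f : Conf b n → ℝ) :
    levelSum lam (fun n τ u f => ∑ k ∈ s, Q k n τ u f) j n τ u f
      = ∑ k ∈ s, levelSum lam (Q k) j n τ u f := by
  classical
  induction s using Finset.induction_on with
  | empty => simp [levelSum_zero]
  | insert k s hk ih => simp only [Finset.sum_insert hk, levelSum_add, ih]

theorem levelSum_levelSum (Q : Functional b) (j : ℕ) :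
    ∀ (k n : ℕ) (τ : List (Fin b) → Bool) (u : Bool) (f : Conf b n → ℝ),
      levelSum lam (levelSum lam Q j) k n τ u f = levelSum lam Q (j + k) n τ u f
  | 0, _, _, _, _ => rfl
  | _ + 1, 0, _, _, _ => rfl
  | k + 1, n + 1, τ, u, f => by
    simp only [levelSum, levelSum_levelSum Q j k]
    rfl

theorem levelSum_comp (Q : Functional b) (T : ℝ → ℝ) :
    ∀ (j n : ℕ) (τ : List (Fin b) → Bool) (u : Bool) (f : Conf b n → ℝ),
      levelSum lam (fun n τ u f => Q n τ u fun x => T (f x)) j n τ u f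
        = levelSum lam Q j n τ u fun x => T (f x)
  | 0, _, _, _, _ => rfl
  | _ + 1, 0, _, _, _ => rfl
  | j + 1, n + 1, τ, u, f => by simp only [levelSum, levelSum_comp Q T j]

theorem levelSum_eq_zero {Q : Functional b} (hQ : ∀ τ u f, Q 0 τ u f = 0) :
    ∀ (j n : ℕ) (τ : List (Fin b) → Bool) (u : Bool) (f : Conf b n → ℝ), n ≤ j →
      levelSum lam Q j n τ u f = 0
  | 0, 0, τ, u, f, _ => hQ τ u f
  | _ + 1, 0, _, _, _, _ => rfl
  | j + 1, n + 1, τ, u, f, h => by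
    simp only [levelSum, levelSum_eq_zero hQ j n _ _ _ (Nat.le_of_succ_le_succ h), ex_zero,
      Finset.sum_const_zero]

theorem levelSum_nonneg (hlam : 0 ≤ lam) {Q : Functional b}
    (hQ : ∀ n τ u f, (∀ x, 0 ≤ f x) → 0 ≤ Q n τ u f) (j n : ℕ) (τ : List (Fin b) → Bool) (u : Bool)
    (f : Conf b n → ℝ) (hf : ∀ x, 0 ≤ f x) : 0 ≤ levelSum lam Q j n τ u f := by
  have h := levelSum_mono hlam (P := fun _ _ => True) (fun _ _ _ _ => trivial)
    (Q := fun _ _ _ _ => 0) (R := Q) (fun n τ u f _ hf => hQ n τ u f hf) j n τ u f trivial hf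
  rwa [levelSum_zero] at h

theorem levelSum_convex (hlam : 0 ≤ lam) {κ : Type*} [Fintype κ] {v : κ → ℝ} (hv : IsProb v)
    {Q : Functional b}
    (hQ : ∀ n τ u (F : κ → Conf b n → ℝ), (∀ k x, 0 ≤ F k x) →
      Q n τ u (fun x => ex v fun k => F k x) ≤ ex v fun k => Q n τ u (F k)) :
    ∀ (j n : ℕ) (τ : List (Fin b) → Bool) (u : Bool) (F : κ → Conf b n → ℝ), (∀ k x, 0 ≤ F k x) →
      levelSum lam Q j n τ u (fun x => ex v fun k => F k x)
        ≤ ex v fun k => levelSum lam Q j n τ u (F k)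
  | 0, n, τ, u, F, hF => hQ n τ u F hF
  | _ + 1, 0, _, _, _, _ => (ex_zero v).symm.le
  | j + 1, n + 1, τ, u, F, hF => by
    simp only [levelSum]
    rw [ex_comm v]
    refine (isProb_rootWt hlam n τ u).ex_mono fun s => ?_
    rw [ex_sum]
    refine Finset.sum_le_sum fun i _ => ?_
    rw [ex_comm v]
    refine (isProb_childWt hlam n τ s).ex_mono fun c => ?_
    exact levelSum_convex hlam hv hQ j n _ s (fun k d => F k (s, Function.update c i d))
      fun _ _ => hF _ _

/-- The entropy of the mean value of `f` given the root. -/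
def rootEnt (lam : ℝ) : Functional b
  | 0, _, _, _ => 0
  | n + 1, τ, u, f => ent (rootWt lam n τ u) fun s => ex (childWt lam n τ s) fun c => f (s, c)

/-- The Dirichlet form of the heat-bath dynamics at the root. -/
def rootDir (lam : ℝ) : Functional b
  | 0, _, _, _ => 0
  | n + 1, τ, u, f =>
    rootWt lam n τ u true * ex (childWt lam n τ true) (fun c => (f (true, c) - f (false, c)) ^ 2)

/-- The `L¹` version of `rootDir`. -/
def rootGrad (lam : ℝ) : Functional b
  | 0, _, _, _ => 0
  | n + 1, τ, u, f =>
    rootWt lam n τ u true * ex (childWt lam n τ true) (fun c => |f (true, c) - f (false, c)|)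

theorem rootEnt_nonneg (hlam : 0 ≤ lam) (n : ℕ) (τ : List (Fin b) → Bool) (u : Bool)
    (f : Conf b n → ℝ) (hf : ∀ x, 0 ≤ f x) : 0 ≤ rootEnt lam n τ u f := by
  cases n with
  | zero => exact le_rfl
  | succ n =>
    exact (isProb_rootWt hlam n τ u).ent_nonneg fun s =>
      (isProb_childWt hlam n τ s).ex_nonneg fun c => hf _

theorem rootEnt_convex (hlam : 0 ≤ lam) {κ : Type*} [Fintype κ] {v : κ → ℝ} (hv : IsProb v)
    (n : ℕ) (τ : List (Fin b) → Bool) (u : Bool) (F : κ → Conf b n → ℝ) (hF : ∀ k x, 0 ≤ F k x) :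
    rootEnt lam n τ u (fun x => ex v fun k => F k x) ≤ ex v fun k => rootEnt lam n τ u (F k) := by
  cases n with
  | zero => exact (ex_zero v).symm.le
  | succ n =>
    simp only [rootEnt]
    refine le_trans (le_of_eq ?_) (ent_ex_le (isProb_rootWt hlam n τ u) hv
      (F := fun k s => ex (childWt lam n τ s) fun c => F k (s, c))
      fun k s => (isProb_childWt hlam n τ s).ex_nonneg fun c => hF _ _)
    exact congrArg _ (funext fun s => ex_comm _ _ _)

/-- `φ` depends only on the spins at the levels `0, …, l`. -/
def DependsUpTo : ℕ → (n : ℕ) → (Conf b n → ℝ) → Prop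
  | _, 0, _ => True
  | 0, _ + 1, φ => ∀ s c c', φ (s, c) = φ (s, c')
  | l + 1, n + 1, φ => ∀ s c i, DependsUpTo l n fun d => φ (s, Function.update c i d)

theorem DependsUpTo.comp {κ : Type*} (Θ : (κ → ℝ) → ℝ) :
    ∀ {l n : ℕ} {φ : κ → Conf b n → ℝ}, (∀ k, DependsUpTo l n (φ k)) →
      DependsUpTo l n fun d => Θ fun k => φ k d
  | 0, 0, _, _ => trivial
  | _ + 1, 0, _, _ => trivial
  | 0, _ + 1, _, h => fun s c c' => congrArg Θ (funext fun k => h k s c c')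
  | l + 1, n + 1, φ, h => fun s c i =>
    DependsUpTo.comp Θ (l := l) (n := n) (φ := fun k d => φ k (s, Function.update c i d))
      fun k => h k s c i

/-- The variational inequality for functions of the first levels. -/
theorem ex_treeWt_mul_le (hlam : 0 ≤ lam) :
    ∀ (l n : ℕ) (τ : List (Fin b) → Bool) (u : Bool) (f φ : Conf b n → ℝ), (∀ x, 0 ≤ f x) →
      DependsUpTo l n φ →
      ex (treeWt lam n τ u) (fun x => f x * φ x)
        ≤ ∑ j ∈ Finset.range (l + 1), levelSum lam (rootEnt lam) j n τ u f
          + ex (treeWt lam n τ u) f * Real.log (ex (treeWt lam n τ u) fun x => Real.exp (φ x))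
  | l, 0, τ, u, f, φ, hf, _ => by
    simp only [ex_treeWt_zero, Real.log_exp]
    have := Finset.sum_nonneg fun j (_ : j ∈ Finset.range (l + 1)) =>
      levelSum_nonneg hlam (rootEnt_nonneg hlam) j 0 τ u f hf
    linarith
  | 0, n + 1, τ, u, f, φ, hf, hφ => by
    simp only [ex_treeWt_succ, zero_add, Finset.sum_range_one, levelSum, rootEnt]
    have hc := isProb_childWt hlam n τ
    have hne : Nonempty (Fin b → Conf b n) := by
      by_contra hne
      rw [not_nonempty_iff] at hne
      simpa using (hc true).sum_eq_one
    obtain ⟨c₀⟩ := hne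
    have hd : ∀ s c, φ (s, c) = φ (s, c₀) := fun s c => hφ s c c₀
    simp only [hd, ex_mul_const, (hc _).ex_const]
    exact (isProb_rootWt hlam n τ u).ex_mul_le_ent (fun s => (hc s).ex_nonneg fun c => hf _) _
  | l + 1, n + 1, τ, u, f, φ, hf, hφ => by
    simp only [ex_treeWt_succ]
    have hc := isProb_childWt hlam n τ
    have hr := isProb_rootWt hlam n τ u
    have hw : ∀ s i, IsProb (treeWt lam n (childBoundary τ i) s) := fun s i =>
      isProb_treeWt hlam n _ s
    have h1 : ∀ s, ex (childWt lam n τ s) (fun c => f (s, c) * φ (s, c))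
        ≤ (∑ i, ex (childWt lam n τ s) fun c => ∑ j ∈ Finset.range (l + 1),
            levelSum lam (rootEnt lam) j n (childBoundary τ i) s
              fun d => f (s, Function.update c i d))
          + ex (childWt lam n τ s) (fun c => f (s, c))
            * Real.log (ex (childWt lam n τ s) fun c => Real.exp (φ (s, c))) := by
      intro s
      refine ex_pw_mul_le (hw s) (fun _ => DependsUpTo l n)
        (fun i ψ hψ => DependsUpTo.comp
          (fun y => Real.log (ex (childWt lam n τ s) fun k => Real.exp (y k))) hψ)
        (fun i g => ∑ j ∈ Finset.range (l + 1),
            levelSum lam (rootEnt lam) j n (childBoundary τ i) s g) ?_ ?_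
        (f := fun c => f (s, c)) (φ := fun c => φ (s, c)) (fun c => hf _) (fun i c => hφ s c i)
      · intro i F hF
        rw [ex_sum]
        exact Finset.sum_le_sum fun j _ => levelSum_convex hlam (hc s)
          (rootEnt_convex hlam (hc s)) j n _ s F hF
      · intro i g ψ hg hψ
        exact ex_treeWt_mul_le hlam l n _ s g ψ hg hψ
    refine (hr.ex_mono h1).trans ?_
    have h2 := hr.ex_mul_le_ent (f := fun s => ex (childWt lam n τ s) fun c => f (s, c))
      (fun s => (hc s).ex_nonneg fun c => hf _)
      fun s => Real.log (ex (childWt lam n τ s) fun c => Real.exp (φ (s, c)))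
    simp only [Real.exp_log ((hc _).ex_pos fun _ => Real.exp_pos _)] at h2
    rw [ex_add, Finset.sum_range_succ']
    simp only [levelSum, rootEnt]
    have h3 : (ex (rootWt lam n τ u) fun s => ∑ i, ex (childWt lam n τ s) fun c =>
        ∑ j ∈ Finset.range (l + 1), levelSum lam (rootEnt lam) j n (childBoundary τ i) s
          fun d => f (s, Function.update c i d))
        = ∑ j ∈ Finset.range (l + 1), ex (rootWt lam n τ u) fun s => ∑ i,
          ex (childWt lam n τ s) fun c => levelSum lam (rootEnt lam) j n (childBoundary τ i) s
            fun d => f (s, Function.update c i d) := by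
      rw [← ex_sum]
      refine congrArg _ (funext fun s => ?_)
      rw [Finset.sum_comm]
      exact Finset.sum_congr rfl fun i _ => ex_sum _ _ _
    rw [h3]
    linarith

theorem dependsUpTo_of_le : ∀ {l n : ℕ} (φ : Conf b n → ℝ), n ≤ l → DependsUpTo l n φ
  | 0, 0, _, _ => trivial
  | _ + 1, 0, _, _ => trivial
  | l + 1, n + 1, _, h => fun _ _ _ =>
    dependsUpTo_of_le (l := l) (n := n) _ (Nat.le_of_succ_le_succ h)

/-- The entropy is bounded by the sum of the entropies of the successive conditional means. -/
theorem ent_treeWt_le (hlam : 0 ≤ lam) (n : ℕ) (τ : List (Fin b) → Bool) (u : Bool)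
    (f : Conf b n → ℝ) (hf : ∀ x, 0 ≤ f x) :
    ent (treeWt lam n τ u) f ≤ ∑ j ∈ Finset.range n, levelSum lam (rootEnt lam) j n τ u f := by
  refine (isProb_treeWt hlam n τ u).ent_le_of_forall hf fun φ => ?_
  have h := ex_treeWt_mul_le hlam n n τ u f φ hf (dependsUpTo_of_le φ le_rfl)
  rwa [Finset.sum_range_succ, levelSum_eq_zero (fun _ _ _ => rfl) n n τ u f le_rfl, add_zero] at h

end TreeModel

/-- Replacing the factors of a product one at a time, in the presence of a weight `K` that depends
on the coordinates in `S` only through the functions `x`. -/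
theorem abs_ex_pw_mul_prod_sub_le {α ι : Type*} [Fintype α] [Fintype ι] [DecidableEq ι]
    {w : ι → α → ℝ} (hw : ∀ i, IsProb (w i)) {x y : ι → α → ℝ}
    (hx : ∀ i d, 0 ≤ x i d ∧ x i d ≤ 1) (hy : ∀ i d, 0 ≤ y i d ∧ y i d ≤ 1)
    (B : ι → (α → ℝ) → ℝ) (g : (ι → α) → ℝ)
    (hB : ∀ (i : ι) (c : ι → α) (κ : ℝ → ℝ), (∀ t, 0 ≤ κ t ∧ κ t ≤ 1) →
      |ex (w i) fun d => g (Function.update c i d) * κ (x i d) * (x i d - y i d)|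
        ≤ B i fun d => g (Function.update c i d)) (S : Finset ι) :
    ∀ K : (ι → α) → ℝ, (∀ c, 0 ≤ K c ∧ K c ≤ 1) →
      (∀ j ∈ S, ∀ c, ∃ κ : ℝ → ℝ, (∀ t, 0 ≤ κ t ∧ κ t ≤ 1) ∧
        ∀ d, K (Function.update c j d) = κ (x j d)) →
      |ex (pw w) fun c => g c * K c * (∏ i ∈ S, y i (c i) - ∏ i ∈ S, x i (c i))|
        ≤ ∑ i ∈ S, ex (pw w) fun c => B i fun d => g (Function.update c i d) := by
  have hW := IsProb.pw hw
  induction S using Finset.induction_on with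
  | empty => intro K _ _; simp [ex_zero]
  | insert i S hi ih =>
    intro K hK hKx
    have e : (fun c => g c * K c * (∏ j ∈ insert i S, y j (c j) - ∏ j ∈ insert i S, x j (c j)))
        = fun c => g c * (K c * y i (c i)) * (∏ j ∈ S, y j (c j) - ∏ j ∈ S, x j (c j))
          - g c * (K c * ∏ j ∈ S, x j (c j)) * (x i (c i) - y i (c i)) := by
      funext c
      rw [Finset.prod_insert hi, Finset.prod_insert hi]
      ring
    rw [e, ex_sub, Finset.sum_insert hi, add_comm]
    refine (abs_sub _ _).trans (add_le_add ?_ ?_)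
    · refine ih (fun c => K c * y i (c i)) (fun c => ⟨mul_nonneg (hK c).1 (hy _ _).1,
        mul_le_one₀ (hK c).2 (hy _ _).1 (hy _ _).2⟩) fun j hj c => ?_
      obtain ⟨κ, hκ, h⟩ := hKx j (Finset.mem_insert_of_mem hj) c
      have hij : i ≠ j := fun h => hi (h ▸ hj)
      refine ⟨fun t => κ t * y i (c i), fun t => ⟨mul_nonneg (hκ t).1 (hy _ _).1,
        mul_le_one₀ (hκ t).2 (hy _ _).1 (hy _ _).2⟩, fun d => ?_⟩
      simp only [h, Function.update_of_ne hij]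
    · rw [← ex_pw_update (hw i)]
      refine hW.abs_ex_le_ex fun c => ?_
      obtain ⟨κ, hκ, h⟩ := hKx i (Finset.mem_insert_self i S) c
      have hS0 : 0 ≤ ∏ j ∈ S, x j (c j) := Finset.prod_nonneg fun j _ => (hx _ _).1
      have hS1 : ∏ j ∈ S, x j (c j) ≤ 1 :=
        Finset.prod_le_one (fun j _ => (hx _ _).1) fun j _ => (hx _ _).2
      refine le_of_eq_of_le ?_ (hB i c (fun t => κ t * ∏ j ∈ S, x j (c j))
        fun t => ⟨mul_nonneg (hκ t).1 hS0, mul_le_one₀ (hκ t).2 hS0 hS1⟩)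
      refine congrArg _ (congrArg _ (funext fun d => ?_))
      have : ∏ j ∈ S, x j (Function.update c i d j) = ∏ j ∈ S, x j (c j) :=
        Finset.prod_congr rfl fun j hj => by
          rw [Function.update_of_ne (ne_of_mem_of_not_mem hj hi)]
      rw [this, h, Function.update_self]

section CondVac

variable {b : ℕ} {lam : ℝ}

/-- The probability that the root is vacant, given that its parent is vacant and given the spins at
the levels `≥ l`. -/
def condVac (lam : ℝ) : ℕ → (n : ℕ) → (List (Fin b) → Bool) → Conf b n → ℝ
  | _, 0, τ, _ => vac lam 0 τ
  | 0, _ + 1, _, σ => if σ.1 then 0 else 1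
  | l + 1, n + 1, τ, σ => 1 / (1 + lam * ∏ i, condVac lam l n (childBoundary τ i) (σ.2 i))

theorem condVac_mem (hlam : 0 ≤ lam) : ∀ (l n : ℕ) (τ : List (Fin b) → Bool) (σ : Conf b n),
    0 ≤ condVac lam l n τ σ ∧ condVac lam l n τ σ ≤ 1
  | 0, 0, τ, _ => vac_mem hlam 0 τ
  | _ + 1, 0, τ, _ => vac_mem hlam 0 τ
  | 0, _ + 1, _, σ => by
    unfold condVac
    split_ifs <;> norm_num
  | l + 1, n + 1, τ, σ => by
    have h : 0 ≤ lam * ∏ i, condVac lam l n (childBoundary τ i) (σ.2 i) :=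
      mul_nonneg hlam (Finset.prod_nonneg fun i _ => (condVac_mem hlam l n _ _).1)
    unfold condVac
    exact ⟨by positivity, by rw [div_le_one (by positivity)]; linarith⟩

theorem prod_condVac_mem (hlam : 0 ≤ lam) (l n : ℕ) (τ : List (Fin b) → Bool)
    (c : Fin b → Conf b n) :
    0 ≤ ∏ i, condVac lam l n (childBoundary τ i) (c i) ∧
      ∏ i, condVac lam l n (childBoundary τ i) (c i) ≤ 1 :=
  ⟨Finset.prod_nonneg fun _ _ => (condVac_mem hlam l n _ _).1,
    Finset.prod_le_one (fun _ _ => (condVac_mem hlam l n _ _).1)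
      fun _ _ => (condVac_mem hlam l n _ _).2⟩

theorem dependsUpTo_condVac : ∀ (l n : ℕ) (τ : List (Fin b) → Bool),
    DependsUpTo l n (condVac lam l n τ)
  | 0, 0, _ => trivial
  | _ + 1, 0, _ => trivial
  | 0, _ + 1, _ => fun _ _ _ => rfl
  | l + 1, n + 1, τ => fun s c i => by
    have h := DependsUpTo.comp
      (κ := Unit) (φ := fun _ => condVac lam l n (childBoundary τ i)) (fun y =>
      1 / (1 + lam * (y () * ∏ j ∈ Finset.univ.erase i, condVac lam l n (childBoundary τ j) (c j))))
      fun _ => dependsUpTo_condVac l n (childBoundary τ i)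
    convert h using 2 with d
    simp only [condVac]
    rw [← Finset.mul_prod_erase _ _ (Finset.mem_univ i), Function.update_self]
    congr 4
    exact Finset.prod_congr rfl fun j hj => by
      rw [Function.update_of_ne (Finset.ne_of_mem_erase hj)]

theorem treeWt_false_mul_condVac : ∀ (n : ℕ) (τ : List (Fin b) → Bool) (σ : Conf b n),
    treeWt lam n τ false σ * condVac lam 0 n τ σ = vac lam n τ * treeWt lam n τ true σ
  | 0, τ, σ => mul_comm 1 (vac lam 0 τ)
  | n + 1, τ, (true, c) => by simp [treeWt, condVac, rootWt]
  | n + 1, τ, (false, c) => by simp [treeWt, condVac, rootWt]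

/-- Conditioning the children of a vacant root to be vacant. -/
theorem ex_childWt_false (n : ℕ) (τ : List (Fin b) → Bool) (φ : (Fin b → Conf b n) → ℝ) :
    ex (childWt lam n τ false) (fun c => φ c * ∏ i, condVac lam 0 n (childBoundary τ i) (c i))
      = (∏ i, vac lam n (childBoundary τ i)) * ex (childWt lam n τ true) φ := by
  simp only [ex, Finset.mul_sum, childWt, pw]
  refine Finset.sum_congr rfl fun c _ => ?_
  rw [mul_left_comm, mul_comm, ← Finset.prod_mul_distrib, ← mul_assoc, ← Finset.prod_mul_distrib]
  simp only [treeWt_false_mul_condVac]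

theorem rootWt_mul_ex_childWt_true (hlam : 0 ≤ lam) (n : ℕ) (τ : List (Fin b) → Bool)
    (φ : (Fin b → Conf b n) → ℝ) :
    rootWt lam n τ false true * ex (childWt lam n τ true) φ
      = lam * rootWt lam n τ false false * ex (childWt lam n τ false)
        fun c => φ c * ∏ i, condVac lam 0 n (childBoundary τ i) (c i) := by
  rw [ex_childWt_false]
  simp only [rootWt]
  rw [one_sub_vac_succ hlam]
  ring

theorem ex_rootWt (n : ℕ) (τ : List (Fin b) → Bool) (u : Bool) (F : Bool → ℝ) :
    ex (rootWt lam n τ u) F = rootWt lam n τ u true * F true + rootWt lam n τ u false * F false := by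
  simp [ex]

theorem rootGrad_nonneg (hlam : 0 ≤ lam) (n : ℕ) (τ : List (Fin b) → Bool) (u : Bool)
    (f : Conf b n → ℝ) : 0 ≤ rootGrad lam n τ u f := by
  cases n with
  | zero => exact le_rfl
  | succ n =>
    exact mul_nonneg ((isProb_rootWt hlam n τ u).nonneg _)
      ((isProb_childWt hlam n τ true).ex_nonneg fun c => abs_nonneg _)

/-- The root spin is nearly the function `condVac` of the spins far below, up to local terms. -/
theorem abs_ex_mul_condVac_sub_le (hlam : 0 ≤ lam) :
    ∀ (l n : ℕ) (τ : List (Fin b) → Bool) (f : Conf b n → ℝ), (∀ x, 0 ≤ f x) →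
      ∀ κ : ℝ → ℝ, (∀ t, 0 ≤ κ t ∧ κ t ≤ 1) →
      |ex (treeWt lam n τ false) fun x => f x * κ (condVac lam l n τ x) *
          (condVac lam l n τ x - condVac lam 0 n τ x)|
        ≤ (1 + lam) ^ l * ∑ j ∈ Finset.range l, levelSum lam (rootGrad lam) j n τ false f
  | 0, n, τ, f, hf, κ, hκ => by simp [ex_zero]
  | l + 1, 0, τ, f, hf, κ, hκ => by
    have := Finset.sum_nonneg fun j (_ : j ∈ Finset.range (l + 1)) =>
      levelSum_nonneg hlam (fun n τ u f _ => rootGrad_nonneg hlam n τ u f) j 0 τ false f hf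
    have h2 : (0 : ℝ) ≤ (1 + lam) ^ (l + 1) := by positivity
    simpa [ex_treeWt_zero, condVac] using mul_nonneg h2 this
  | l + 1, n + 1, τ, f, hf, κ, hκ => by
    set v : (Fin b → Conf b n) → ℝ := fun c =>
      1 / (1 + lam * ∏ i, condVac lam l n (childBoundary τ i) (c i)) with hv
    have hc := isProb_childWt hlam n τ
    have hr := isProb_rootWt hlam n τ false
    have hvmem : ∀ c, 0 ≤ v c ∧ v c ≤ 1 := fun c => condVac_mem hlam (l + 1) (n + 1) τ (false, c)
    have hv1 : ∀ c, 1 - v c = lam * (∏ i, condVac lam l n (childBoundary τ i) (c i)) * v c := by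
      intro c
      have : 0 ≤ lam * ∏ i, condVac lam l n (childBoundary τ i) (c i) :=
        mul_nonneg hlam (prod_condVac_mem hlam l n τ c).1
      simp only [hv]
      field_simp
      ring
    have e1 : (ex (treeWt lam (n + 1) τ false) fun x => f x * κ (condVac lam (l + 1) (n + 1) τ x) *
          (condVac lam (l + 1) (n + 1) τ x - condVac lam 0 (n + 1) τ x))
        = rootWt lam n τ false true * ex (childWt lam n τ true)
            (fun c => (f (true, c) - f (false, c)) * (κ (v c) * v c))
          + lam * (rootWt lam n τ false false * ex (childWt lam n τ false)
            (fun c => f (false, c) * (κ (v c) * v c) *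
              (∏ i, condVac lam 0 n (childBoundary τ i) (c i)
                - ∏ i, condVac lam l n (childBoundary τ i) (c i)))) := by
      have h2 := rootWt_mul_ex_childWt_true hlam n τ fun c => f (false, c) * (κ (v c) * v c)
      have h3 : (fun c => f (false, c) * κ (v c) * (v c - 1))
          = fun c => - lam * (f (false, c) * (κ (v c) * v c) *
            ∏ i, condVac lam l n (childBoundary τ i) (c i)) := by
        funext c
        linear_combination (-(f (false, c) * κ (v c))) * hv1 c
      have h4 : (fun c => f (true, c) * κ (v c) * (v c - 0))
          = fun c => f (true, c) * (κ (v c) * v c) := by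
        funext c
        ring
      have h5 : (ex (treeWt lam (n + 1) τ false) fun x =>
          f x * κ (condVac lam (l + 1) (n + 1) τ x) *
          (condVac lam (l + 1) (n + 1) τ x - condVac lam 0 (n + 1) τ x))
          = rootWt lam n τ false true * ex (childWt lam n τ true)
            (fun c => f (true, c) * κ (v c) * (v c - 0)) + rootWt lam n τ false false *
            ex (childWt lam n τ false) (fun c => f (false, c) * κ (v c) * (v c - 1)) := by
        rw [ex_treeWt_succ, ex_rootWt]
        rfl
      rw [h5, h3, h4]
      simp only [ex_const_mul, sub_mul, mul_sub, ex_sub]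
      rw [h2]
      ring
    have e2 : |rootWt lam n τ false true * ex (childWt lam n τ true)
          (fun c => (f (true, c) - f (false, c)) * (κ (v c) * v c))|
        ≤ levelSum lam (rootGrad lam) 0 (n + 1) τ false f := by
      rw [abs_mul, abs_of_nonneg (hr.nonneg _)]
      refine mul_le_mul_of_nonneg_left ((hc true).abs_ex_le_ex fun c => ?_) (hr.nonneg _)
      have h0 : 0 ≤ κ (v c) * v c := mul_nonneg (hκ _).1 (hvmem c).1
      rw [abs_mul, abs_of_nonneg h0]
      exact mul_le_of_le_one_right (abs_nonneg _) (mul_le_one₀ (hκ _).2 (hvmem c).1 (hvmem c).2)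
    have e3 : |ex (childWt lam n τ false)
            (fun c => f (false, c) * (κ (v c) * v c) *
              (∏ i, condVac lam 0 n (childBoundary τ i) (c i)
                - ∏ i, condVac lam l n (childBoundary τ i) (c i)))|
        ≤ ∑ i, ex (childWt lam n τ false) fun c => (1 + lam) ^ l * ∑ j ∈ Finset.range l,
            levelSum lam (rootGrad lam) j n (childBoundary τ i) false
              fun d => f (false, Function.update c i d) := by
      refine abs_ex_pw_mul_prod_sub_le (fun i => isProb_treeWt hlam n (childBoundary τ i) false)
        (x := fun i => condVac lam l n (childBoundary τ i))
        (y := fun i => condVac lam 0 n (childBoundary τ i))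
        (fun i d => condVac_mem hlam l n _ d) (fun i d => condVac_mem hlam 0 n _ d)
        (fun i g => (1 + lam) ^ l * ∑ j ∈ Finset.range l,
            levelSum lam (rootGrad lam) j n (childBoundary τ i) false g)
        (fun c => f (false, c)) (fun i c κ hκ => ?_) Finset.univ (fun c => κ (v c) * v c)
        (fun c => ⟨mul_nonneg (hκ _).1 (hvmem c).1,
          mul_le_one₀ (hκ _).2 (hvmem c).1 (hvmem c).2⟩) fun i _ c => ?_
      · exact abs_ex_mul_condVac_sub_le hlam l n _ _ (fun _ => hf _) κ hκ
      · set P := ∏ j ∈ Finset.univ.erase i, condVac lam l n (childBoundary τ j) (c j) with hP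
        have hP0 : 0 ≤ P := Finset.prod_nonneg fun j _ => (condVac_mem hlam l n _ _).1
        set ψ : ℝ → ℝ := fun t => 1 / (1 + lam * (max 0 t * P)) with hψ
        have hψmem : ∀ t, 0 ≤ ψ t ∧ ψ t ≤ 1 := by
          intro t
          have : 0 ≤ lam * (max 0 t * P) := by positivity
          exact ⟨by positivity, by rw [div_le_one (by positivity)]; linarith⟩
        refine ⟨fun t => κ (ψ t) * ψ t, fun t => ⟨mul_nonneg (hκ _).1 (hψmem t).1,
          mul_le_one₀ (hκ _).2 (hψmem t).1 (hψmem t).2⟩, fun d => ?_⟩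
        have : v (Function.update c i d) = ψ (condVac lam l n (childBoundary τ i) d) := by
          simp only [hv, hψ, hP]
          rw [← Finset.mul_prod_erase _ _ (Finset.mem_univ i), Function.update_self,
            max_eq_right (condVac_mem hlam l n _ d).1]
          congr 4
          exact Finset.prod_congr rfl fun j hj => by
            rw [Function.update_of_ne (Finset.ne_of_mem_erase hj)]
        rw [this]
    have e4 : rootWt lam n τ false false * (∑ i, ex (childWt lam n τ false) fun c =>
          (1 + lam) ^ l * ∑ j ∈ Finset.range l,
            levelSum lam (rootGrad lam) j n (childBoundary τ i) false
              fun d => f (false, Function.update c i d))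
        ≤ (1 + lam) ^ l * ∑ j ∈ Finset.range l,
          levelSum lam (rootGrad lam) (j + 1) (n + 1) τ false f := by
      simp only [ex_const_mul, ← Finset.mul_sum, ex_sum]
      rw [mul_left_comm]
      refine mul_le_mul_of_nonneg_left ?_ (by positivity)
      rw [Finset.sum_comm, Finset.mul_sum]
      refine Finset.sum_le_sum fun j _ => ?_
      simp only [levelSum]
      rw [ex_rootWt]
      refine le_add_of_nonneg_left (mul_nonneg (hr.nonneg _) (Finset.sum_nonneg fun i _ =>
        (hc _).ex_nonneg fun c => ?_))
      exact levelSum_nonneg hlam (fun n τ u f _ => rootGrad_nonneg hlam n τ u f) j n _ _ _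
        fun _ => hf _
    rw [e1, Finset.sum_range_succ', mul_add]
    refine (abs_add_le _ _).trans ?_
    rw [abs_mul lam, abs_mul (rootWt lam n τ false false), abs_of_nonneg hlam,
      abs_of_nonneg (hr.nonneg false), add_comm]
    have hL0 := levelSum_nonneg hlam (fun n τ u f _ => rootGrad_nonneg hlam n τ u f) 0 (n + 1) τ
      false f hf
    have hLs := Finset.sum_nonneg fun j (_ : j ∈ Finset.range l) => levelSum_nonneg hlam
      (fun n τ u f _ => rootGrad_nonneg hlam n τ u f) (j + 1) (n + 1) τ false f hf
    have h1l : (1 : ℝ) ≤ (1 + lam) ^ l := one_le_pow₀ (by linarith)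
    refine add_le_add ?_ (e2.trans (le_mul_of_one_le_left hL0 (one_le_pow₀ (by linarith))))
    calc _ ≤ lam * _ := mul_le_mul_of_nonneg_left
            ((mul_le_mul_of_nonneg_left e3 (hr.nonneg _)).trans e4) hlam
      _ ≤ _ := by
        rw [← mul_assoc, pow_succ']
        refine mul_le_mul_of_nonneg_right ?_ hLs
        nlinarith

end CondVac

section LocalTerms

variable {b : ℕ} {lam : ℝ}

theorem levelSum_rootGrad_const (a : ℝ) : ∀ (j n : ℕ) (τ : List (Fin b) → Bool) (u : Bool),
    levelSum lam (rootGrad lam) j n τ u (fun _ => a) = 0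
  | 0, 0, _, _ => rfl
  | _ + 1, 0, _, _ => rfl
  | 0, n + 1, τ, u => by simp [levelSum, rootGrad, ex_zero]
  | j + 1, n + 1, τ, u => by
    simp only [levelSum, levelSum_rootGrad_const a j n, ex_zero, Finset.sum_const_zero]

theorem ex_clamp_mul_condVac_sub (hlam : 0 ≤ lam) (l n : ℕ) (τ : List (Fin b) → Bool) (κ : ℝ → ℝ)
    (hκ : ∀ t, 0 ≤ κ t ∧ κ t ≤ 1) :
    ex (treeWt lam n τ false) (fun x => κ (condVac lam l n τ x) *
      (condVac lam l n τ x - condVac lam 0 n τ x)) = 0 := by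
  have h := abs_ex_mul_condVac_sub_le hlam l n τ (fun _ => 1) (fun _ => zero_le_one) κ hκ
  simp only [levelSum_rootGrad_const, Finset.sum_const_zero, mul_zero, one_mul] at h
  exact abs_nonpos_iff.1 h

theorem ex_condVac_zero (hlam : 0 ≤ lam) (n : ℕ) (τ : List (Fin b) → Bool) :
    ex (treeWt lam n τ false) (condVac lam 0 n τ) = vac lam n τ := by
  have h : ex (treeWt lam n τ false) (condVac lam 0 n τ)
      = ∑ σ, vac lam n τ * treeWt lam n τ true σ :=
    Finset.sum_congr rfl fun σ _ => treeWt_false_mul_condVac n τ σ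
  rw [h, ← Finset.mul_sum, (isProb_treeWt hlam n τ true).sum_eq_one, mul_one]

theorem ex_condVac (hlam : 0 ≤ lam) (l n : ℕ) (τ : List (Fin b) → Bool) :
    ex (treeWt lam n τ false) (condVac lam l n τ) = vac lam n τ := by
  have h := ex_clamp_mul_condVac_sub hlam l n τ (fun _ => 1) fun _ => ⟨zero_le_one, le_rfl⟩
  simp only [one_mul] at h
  rw [ex_sub, ex_condVac_zero hlam] at h
  linarith

theorem ex_condVac_sq (hlam : 0 ≤ lam) (l n : ℕ) (τ : List (Fin b) → Bool) :
    ex (treeWt lam n τ false) (fun x => condVac lam l n τ x ^ 2)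
      = ex (treeWt lam n τ false) fun x => condVac lam l n τ x * condVac lam 0 n τ x := by
  have h := ex_clamp_mul_condVac_sub hlam l n τ (fun t => max 0 (min 1 t))
    fun t => ⟨le_max_left _ _, max_le zero_le_one (min_le_left _ _)⟩
  have e : ∀ x, max 0 (min 1 (condVac lam l n τ x)) = condVac lam l n τ x := fun x => by
    have := condVac_mem hlam l n τ x
    rw [min_eq_right this.2, max_eq_right this.1]
  simp only [e, mul_sub, ex_sub, ← sq] at h
  linarith

/-- The mean value as a functional. -/
def mean (lam : ℝ) : Functional b := fun n τ u f => ex (treeWt lam n τ u) f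

theorem levelSum_mean_le (hlam : 0 ≤ lam) :
    ∀ (j n : ℕ) (τ : List (Fin b) → Bool) (u : Bool) (f : Conf b n → ℝ), (∀ x, 0 ≤ f x) →
      levelSum lam (mean lam) j n τ u f ≤ (b : ℝ) ^ j * ex (treeWt lam n τ u) f
  | 0, n, τ, u, f, hf => by simp [levelSum, mean]
  | j + 1, 0, τ, u, f, hf =>
    mul_nonneg (by positivity) ((isProb_treeWt hlam 0 τ u).ex_nonneg hf)
  | j + 1, n + 1, τ, u, f, hf => by
    have h1 : ∀ s i, ex (childWt lam n τ s) (fun c => levelSum lam (mean lam) j n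
        (childBoundary τ i) s fun d => f (s, Function.update c i d))
        ≤ (b : ℝ) ^ j * ex (childWt lam n τ s) fun c => f (s, c) := by
      intro s i
      have h := (isProb_childWt hlam n τ s).ex_mono fun c => levelSum_mean_le hlam j n
        (childBoundary τ i) s (fun d => f (s, Function.update c i d)) fun _ => hf _
      rw [ex_const_mul] at h
      refine h.trans_eq (congrArg _ ?_)
      exact ex_pw_update (w := fun i => treeWt lam n (childBoundary τ i) s)
        (isProb_treeWt hlam n _ s) fun c => f (s, c)
    rw [ex_treeWt_succ, ← ex_const_mul]
    refine (isProb_rootWt hlam n τ u).ex_mono fun s => ?_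
    refine (Finset.sum_le_sum fun i _ => h1 s i).trans_eq ?_
    simp [pow_succ]
    ring

theorem rootDir_nonneg (hlam : 0 ≤ lam) (n : ℕ) (τ : List (Fin b) → Bool) (u : Bool)
    (f : Conf b n → ℝ) : 0 ≤ rootDir lam n τ u f := by
  cases n with
  | zero => exact le_rfl
  | succ n =>
    exact mul_nonneg ((isProb_rootWt hlam n τ u).nonneg _)
      ((isProb_childWt hlam n τ true).ex_nonneg fun c => sq_nonneg _)

theorem rootGrad_le (hlam : 0 ≤ lam) {t : ℝ} (ht : 0 < t) (n : ℕ) (τ : List (Fin b) → Bool)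
    (u : Bool) (f : Conf b n → ℝ) (hf : ∀ x, 0 ≤ f x) :
    rootGrad lam n τ u f
      ≤ t * (1 + lam) * mean lam n τ u f + 1 / (2 * t) * rootDir lam n τ u fun x => √(f x) := by
  cases n with
  | zero =>
    have := (isProb_treeWt hlam 0 τ u).ex_nonneg hf
    simp only [rootGrad, rootDir, mul_zero, add_zero, mean]
    positivity
  | succ n =>
    have hc := isProb_childWt hlam n τ
    have hr := isProb_rootWt hlam n τ u
    have hpt : ∀ c : Fin b → Conf b n, |f (true, c) - f (false, c)|
        ≤ t * (f (true, c) + f (false, c))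
          + 1 / (2 * t) * (√(f (true, c)) - √(f (false, c))) ^ 2 := by
      intro c
      have hx := Real.sq_sqrt (hf (true, c))
      have hy := Real.sq_sqrt (hf (false, c))
      have hx0 := Real.sqrt_nonneg (f (true, c))
      have hy0 := Real.sqrt_nonneg (f (false, c))
      set x := √(f (true, c))
      set y := √(f (false, c))
      rw [← hx, ← hy, sq_sub_sq, abs_mul, abs_of_nonneg (add_nonneg hx0 hy0), ← sq_abs (x - y)]
      set d := |x - y|
      have e : t * (x ^ 2 + y ^ 2) + 1 / (2 * t) * d ^ 2 - (x + y) * d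
          = (1 / (2 * t)) * (d - t * (x + y)) ^ 2 + t / 2 * (x - y) ^ 2 := by
        field_simp
        ring
      have : 0 ≤ (1 / (2 * t)) * (d - t * (x + y)) ^ 2 + t / 2 * (x - y) ^ 2 := by positivity
      linarith
    have h1 := mul_le_mul_of_nonneg_left ((hc true).ex_mono hpt) (hr.nonneg true)
    rw [ex_add, ex_const_mul, ex_const_mul, ex_add] at h1
    have h0 : rootWt lam n τ u true * ex (childWt lam n τ true) (fun c => f (false, c))
        ≤ lam * (rootWt lam n τ u false * ex (childWt lam n τ false) fun c => f (false, c)) := by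
      cases u with
      | true =>
        simp only [rootWt, zero_mul, one_mul]
        exact mul_nonneg hlam ((hc _).ex_nonneg fun c => hf _)
      | false =>
        rw [rootWt_mul_ex_childWt_true hlam, mul_assoc]
        refine mul_le_mul_of_nonneg_left (mul_le_mul_of_nonneg_left ((hc _).ex_mono fun c => ?_)
          (hr.nonneg false)) hlam
        exact mul_le_of_le_one_right (hf _) (prod_condVac_mem hlam 0 n τ c).2
    have hA := mul_nonneg (hr.nonneg true) ((hc true).ex_nonneg fun c => hf (true, c))
    have hB := mul_nonneg (hr.nonneg false) ((hc false).ex_nonneg fun c => hf (false, c))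
    have hm : mean lam (n + 1) τ u f
        = rootWt lam n τ u true * ex (childWt lam n τ true) (fun c => f (true, c))
          + rootWt lam n τ u false * ex (childWt lam n τ false) fun c => f (false, c) := by
      rw [mean, ex_treeWt_succ, ex_rootWt]
    rw [hm]
    simp only [rootGrad, rootDir]
    set A := rootWt lam n τ u true * ex (childWt lam n τ true) (fun c => f (true, c))
    set B := rootWt lam n τ u false * ex (childWt lam n τ false) fun c => f (false, c)
    have h2 : t * (A + rootWt lam n τ u true * ex (childWt lam n τ true) (fun c => f (false, c)))
        ≤ t * ((1 + lam) * (A + B)) := by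
      refine mul_le_mul_of_nonneg_left ?_ ht.le
      nlinarith [mul_nonneg hlam hA]
    nlinarith

/-- A quantity bounded by `t * A + B / t` for all `t > 0`. -/
theorem sq_le_of_forall_le {x A B : ℝ} (hA : 0 ≤ A) (hB : 0 ≤ B) (hx : 0 ≤ x)
    (h : ∀ t, 0 < t → x ≤ t * A + 1 / t * B) : x ^ 2 ≤ 4 * (A * B) := by
  rcases hx.eq_or_lt with rfl | hx
  · simpa using mul_nonneg hA hB
  rcases hA.eq_or_lt with rfl | hA
  · exfalso
    have h1 := h ((B + 1) / x) (by positivity)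
    rw [mul_zero, zero_add, one_div_div, div_mul_eq_mul_div, le_div_iff₀ (by positivity)] at h1
    nlinarith
  · have h1 := h (x / (2 * A)) (by positivity)
    have e : x / (2 * A) * A + 1 / (x / (2 * A)) * B = x / 2 + 2 * A * B / x := by
      field_simp
    rw [e] at h1
    have h2 : x / 2 ≤ 2 * A * B / x := by linarith
    rw [le_div_iff₀ hx] at h2
    nlinarith

theorem sq_ex_mul_condVac_sub_le (hlam : 0 ≤ lam) (l : ℕ) :
    ∃ C : ℝ, 0 ≤ C ∧ ∀ (n : ℕ) (τ : List (Fin b) → Bool) (f : Conf b n → ℝ), (∀ x, 0 ≤ f x) →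
      (ex (treeWt lam n τ false) fun x => f x * (condVac lam l n τ x - condVac lam 0 n τ x)) ^ 2
        ≤ C * (ex (treeWt lam n τ false) f * ∑ j ∈ Finset.range l,
          levelSum lam (rootDir lam) j n τ false fun x => √(f x)) := by
  set N : ℝ := ∑ j ∈ Finset.range l, (b : ℝ) ^ j with hN
  have hN0 : 0 ≤ N := Finset.sum_nonneg fun _ _ => by positivity
  refine ⟨4 * ((1 + lam) ^ l * (1 + lam) * N * ((1 + lam) ^ l * (1 / 2))), by positivity,
    fun n τ f hf => ?_⟩
  set m := ex (treeWt lam n τ false) f with hm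
  set D := ∑ j ∈ Finset.range l, levelSum lam (rootDir lam) j n τ false fun x => √(f x)
  have hm0 : 0 ≤ m := (isProb_treeWt hlam n τ false).ex_nonneg hf
  have hD0 : 0 ≤ D := Finset.sum_nonneg fun j _ => levelSum_nonneg hlam
    (fun n τ u f _ => rootDir_nonneg hlam n τ u f) j n τ false _ fun _ => Real.sqrt_nonneg _
  have h1 := abs_ex_mul_condVac_sub_le hlam l n τ f hf (fun _ => 1) fun _ => ⟨zero_le_one, le_rfl⟩
  simp only [mul_one] at h1
  rw [← sq_abs]
  have h2 := sq_le_of_forall_le (A := (1 + lam) ^ l * (1 + lam) * N * m)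
    (B := (1 + lam) ^ l * (1 / 2) * D) (by positivity) (by positivity) (abs_nonneg _)
    (fun t ht => h1.trans ?_)
  · refine h2.trans_eq ?_
    ring
  · have h3 : ∀ j ∈ Finset.range l, levelSum lam (rootGrad lam) j n τ false f
        ≤ t * (1 + lam) * ((b : ℝ) ^ j * m)
          + 1 / (2 * t) * levelSum lam (rootDir lam) j n τ false fun x => √(f x) := by
      intro j _
      have h4 := levelSum_mono hlam (P := fun _ _ => True) (fun _ _ _ _ => trivial)
        (fun n τ u f _ hf => rootGrad_le hlam ht n τ u f hf) j n τ false f trivial hf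
      rw [levelSum_add, levelSum_const_mul, levelSum_const_mul,
        levelSum_comp (rootDir lam) Real.sqrt] at h4
      have h5 := mul_le_mul_of_nonneg_left (levelSum_mean_le hlam j n τ false f hf)
        (show 0 ≤ t * (1 + lam) by positivity)
      linarith
    refine (mul_le_mul_of_nonneg_left (Finset.sum_le_sum h3) (by positivity)).trans_eq ?_
    rw [Finset.sum_add_distrib, ← Finset.mul_sum, ← Finset.mul_sum, ← Finset.sum_mul, ← hN]
    field_simp
    rfl

end LocalTerms

section Recursion

/-- The tree recursion in the coordinate `z = - ∑ log (vacancy)` is a contraction. -/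
theorem abs_log_one_add_mul_exp_sub_le {lam : ℝ} (hlam : 0 ≤ lam) {z z' : ℝ} (hz : 0 ≤ z)
    (hz' : 0 ≤ z') :
    |Real.log (1 / (1 + lam * Real.exp (-z))) - Real.log (1 / (1 + lam * Real.exp (-z')))|
      ≤ lam / (1 + lam) * |z - z'| := by
  have hd : ∀ x ∈ Set.Ici (0 : ℝ), HasDerivWithinAt
      (fun z => Real.log (1 / (1 + lam * Real.exp (-z))))
      (lam * Real.exp (-x) / (1 + lam * Real.exp (-x))) (Set.Ici 0) x := by
    intro x _
    have hpos : 0 < 1 + lam * Real.exp (-x) := by positivity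
    have h1 : HasDerivAt (fun z => 1 + lam * Real.exp (-z)) (lam * (Real.exp (-x) * -1)) x :=
      (((hasDerivAt_neg x).exp).const_mul lam).const_add 1
    have h2 := (h1.log hpos.ne').neg
    have e : (fun z => Real.log (1 / (1 + lam * Real.exp (-z))))
        = fun z => -Real.log (1 + lam * Real.exp (-z)) := by
      funext z
      rw [one_div, Real.log_inv]
    rw [e]
    exact (h2.congr_deriv (by ring)).hasDerivWithinAt
  have hb : ∀ x ∈ Set.Ici (0 : ℝ),
      ‖lam * Real.exp (-x) / (1 + lam * Real.exp (-x))‖ ≤ lam / (1 + lam) := by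
    intro x hx
    have hx1 : Real.exp (-x) ≤ 1 := Real.exp_le_one_iff.2 (neg_nonpos.2 hx)
    have hpos : 0 < 1 + lam * Real.exp (-x) := by positivity
    rw [Real.norm_of_nonneg (by positivity), div_le_div_iff₀ hpos (by positivity)]
    nlinarith
  have h := (convex_Ici (0 : ℝ)).norm_image_sub_le_of_norm_hasDerivWithin_le hd hb hz' hz
  simpa [Real.norm_eq_abs] using h

theorem abs_log_recursion_sub_le {ι : Type*} [Fintype ι] {lam : ℝ} (hlam : 0 ≤ lam) {a a' : ι → ℝ}
    (ha : ∀ i, 0 < a i ∧ a i ≤ 1) (ha' : ∀ i, 0 < a' i ∧ a' i ≤ 1) :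
    |Real.log (1 / (1 + lam * ∏ i, a i)) - Real.log (1 / (1 + lam * ∏ i, a' i))|
      ≤ lam / (1 + lam) * ∑ i, |Real.log (a i) - Real.log (a' i)| := by
  have key : ∀ a : ι → ℝ, (∀ i, 0 < a i ∧ a i ≤ 1) →
      0 ≤ - ∑ i, Real.log (a i) ∧ ∏ i, a i = Real.exp (- - ∑ i, Real.log (a i)) := by
    intro a ha
    refine ⟨neg_nonneg.2 (Finset.sum_nonpos fun i _ =>
      Real.log_nonpos (ha i).1.le (ha i).2), ?_⟩
    rw [neg_neg, Real.exp_sum]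
    exact Finset.prod_congr rfl fun i _ => (Real.exp_log (ha i).1).symm
  rw [(key a ha).2, (key a' ha').2]
  refine (abs_log_one_add_mul_exp_sub_le hlam (key a ha).1 (key a' ha').1).trans ?_
  refine mul_le_mul_of_nonneg_left ?_ (by positivity)
  rw [neg_sub_neg, ← Finset.sum_sub_distrib]
  refine (Finset.abs_sum_le_sum_abs _ _).trans (Finset.sum_le_sum fun i _ => ?_)
  rw [abs_sub_comm]

variable {b : ℕ} {lam : ℝ}

theorem condVac_succ_ge (hlam : 0 ≤ lam) (l n : ℕ) (τ : List (Fin b) → Bool)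
    (σ : Conf b (n + 1)) : 1 / (1 + lam) ≤ condVac lam (l + 1) (n + 1) τ σ := by
  have h := prod_condVac_mem hlam l n τ σ.2
  have : 0 ≤ lam * ∏ i, condVac lam l n (childBoundary τ i) (σ.2 i) := mul_nonneg hlam h.1
  simp only [condVac]
  gcongr
  nlinarith

theorem condVac_succ_pos (hlam : 0 ≤ lam) (l n : ℕ) (τ : List (Fin b) → Bool)
    (σ : Conf b (n + 1)) :
    0 < condVac lam (l + 1) (n + 1) τ σ ∧ condVac lam (l + 1) (n + 1) τ σ ≤ 1 :=
  ⟨lt_of_lt_of_le (by positivity) (condVac_succ_ge hlam l n τ σ), (condVac_mem hlam _ _ τ σ).2⟩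

theorem vac_succ_pos (hlam : 0 ≤ lam) (n : ℕ) (τ : List (Fin b) → Bool) :
    0 < vac lam (n + 1) τ ∧ vac lam (n + 1) τ ≤ 1 :=
  ⟨lt_of_lt_of_le (by positivity) (vac_succ_ge hlam n τ), (vac_mem hlam _ τ).2⟩

theorem abs_log_sub_log_le {x y : ℝ} (hlam : 0 ≤ lam) (hx : 1 / (1 + lam) ≤ x ∧ x ≤ 1)
    (hy : 1 / (1 + lam) ≤ y ∧ y ≤ 1) :
    |Real.log x - Real.log y| ≤ Real.log (1 + lam) ∧
      |Real.log x - Real.log y| ≤ (1 + lam) * |x - y| := by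
  have h0 : 0 < 1 / (1 + lam) := by positivity
  have hx0 := h0.trans_le hx.1
  have hy0 := h0.trans_le hy.1
  have hbd : ∀ {x : ℝ}, 1 / (1 + lam) ≤ x ∧ x ≤ 1 →
      -Real.log (1 + lam) ≤ Real.log x ∧ Real.log x ≤ 0 := by
    intro x hx
    refine ⟨?_, Real.log_nonpos (h0.trans_le hx.1).le hx.2⟩
    rw [← Real.log_inv, ← one_div]
    exact Real.log_le_log h0 hx.1
  refine ⟨abs_sub_le_iff.2 ⟨by linarith [hbd hx, hbd hy], by linarith [hbd hx, hbd hy]⟩, ?_⟩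
  have half : ∀ {x y : ℝ}, 0 < x → 1 / (1 + lam) ≤ y →
      Real.log x - Real.log y ≤ (1 + lam) * |x - y| := by
    intro x y hx hy
    have hy0 := h0.trans_le hy
    have h := Real.log_le_sub_one_of_pos (div_pos hx hy0)
    rw [Real.log_div hx.ne' hy0.ne', div_sub_one hy0.ne'] at h
    refine h.trans ?_
    rw [div_le_iff₀ hy0]
    have h1 : 1 ≤ (1 + lam) * y := by
      rw [div_le_iff₀ (by positivity)] at hy
      linarith
    nlinarith [le_abs_self (x - y), abs_nonneg (x - y)]
  refine abs_sub_le_iff.2 ⟨half hx0 hy.1, ?_⟩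
  rw [abs_sub_comm]
  exact half hy0 hx.1

theorem abs_sub_le_abs_log_sub_log {x y : ℝ} (hx : 0 < x ∧ x ≤ 1) (hy : 0 < y ∧ y ≤ 1) :
    |x - y| ≤ |Real.log x - Real.log y| := by
  have half : ∀ {x y : ℝ}, 0 < x → x ≤ 1 → 0 < y → x - y ≤ |Real.log x - Real.log y| := by
    intro x y hx hx1 hy
    have h := Real.log_le_sub_one_of_pos (div_pos hy hx)
    rw [Real.log_div hy.ne' hx.ne', div_sub_one hx.ne', le_div_iff₀ hx] at h
    nlinarith [neg_abs_le (Real.log x - Real.log y), le_abs_self (Real.log x - Real.log y),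
      abs_nonneg (Real.log x - Real.log y)]
  refine abs_sub_le_iff.2 ⟨half hx.1 hx.2 hy.1, ?_⟩
  rw [abs_sub_comm]
  exact half hy.1 hy.2 hx.1

/-- The total influence of the root on the vertices `l` levels below, weighted by the maximal
influence in the opposite direction. -/
def influence (lam : ℝ) : ℕ → ℕ → (List (Fin b) → Bool) → ℝ
  | 0, _, _ => Real.log (1 + lam)
  | _ + 1, 0, _ => 0
  | l + 1, n + 1, τ => lam / (1 + lam) *
      ∑ i, (1 - vac lam (n + 1) (childBoundary τ i)) * influence lam l n (childBoundary τ i)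

theorem influence_nonneg (hlam : 0 ≤ lam) : ∀ (l n : ℕ) (τ : List (Fin b) → Bool),
    0 ≤ influence lam l n τ
  | 0, _, _ => Real.log_nonneg (by linarith)
  | _ + 1, 0, _ => le_rfl
  | l + 1, n + 1, τ => mul_nonneg (by positivity) (Finset.sum_nonneg fun i _ =>
      mul_nonneg (sub_nonneg.2 (vac_mem hlam _ _).2) (influence_nonneg hlam l n _))

/-- The conditional vacancy probability of the root as a function of the configuration below. -/
def belowVac (lam : ℝ) (l n : ℕ) (τ : List (Fin b) → Bool) (c : Fin b → Conf b n) : ℝ :=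
  1 / (1 + lam * ∏ i, condVac lam l n (childBoundary τ i) (c i))

theorem belowVac_mem (hlam : 0 ≤ lam) (l n : ℕ) (τ : List (Fin b) → Bool)
    (c : Fin b → Conf b n) : 1 / (1 + lam) ≤ belowVac lam l n τ c ∧ belowVac lam l n τ c ≤ 1 :=
  ⟨condVac_succ_ge hlam l n τ (false, c), (condVac_mem hlam (l + 1) (n + 1) τ (false, c)).2⟩

theorem ex_treeWt_belowVac (n l : ℕ) (τ : List (Fin b) → Bool) (u : Bool) (F : ℝ → ℝ) :
    ex (treeWt lam (n + 1) τ u) (fun x => F (condVac lam (l + 1) (n + 1) τ x))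
      = rootWt lam n τ u true * ex (childWt lam n τ true) (fun c => F (belowVac lam l n τ c))
        + rootWt lam n τ u false * ex (childWt lam n τ false)
          fun c => F (belowVac lam l n τ c) := by
  rw [ex_treeWt_succ, ex_rootWt]
  rfl

theorem IsProb.abs_ex_sub_ex_le {α : Type*} [Fintype α] {w v F : α → ℝ} (hw : IsProb w)
    (hv : IsProb v) {δ : ℝ} (h : ∀ x y, |F x - F y| ≤ δ) : |ex w F - ex v F| ≤ δ := by
  have e : ex w F - ex v F = ex w fun x => ex v fun y => F x - F y := by
    simp only [ex_sub, hv.ex_const, hw.ex_const]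
  rw [e]
  refine (hw.abs_ex_le_ex (g := fun _ => δ) fun x => ?_).trans_eq (hw.ex_const _)
  exact (hv.abs_ex_le_ex (g := fun _ => δ) fun y => h x y).trans_eq (hv.ex_const _)

theorem abs_ex_childWt_sub_le (hlam : 0 ≤ lam) :
    ∀ (l n : ℕ) (τ : List (Fin b) → Bool) (ψ : ℝ → ℝ) (K : ℝ), 0 ≤ K →
      (∀ s t, |ψ s - ψ t| ≤ K * |s - t|) →
      |ex (childWt lam n τ true) (fun c => ψ (Real.log (belowVac lam l n τ c)))
        - ex (childWt lam n τ false) (fun c => ψ (Real.log (belowVac lam l n τ c)))|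
        ≤ K * influence lam l n τ
  | 0, n, τ, ψ, K, hK, hψ => by
    refine (isProb_childWt hlam n τ true).abs_ex_sub_ex_le (isProb_childWt hlam n τ false)
      fun c c' => (hψ _ _).trans (mul_le_mul_of_nonneg_left ?_ hK)
    exact (abs_log_sub_log_le hlam (belowVac_mem hlam 0 n τ c) (belowVac_mem hlam 0 n τ c')).1
  | l + 1, 0, τ, ψ, K, hK, hψ => by
    refine (isProb_childWt hlam 0 τ true).abs_ex_sub_ex_le (isProb_childWt hlam 0 τ false)
      fun c c' => ?_
    simp [belowVac, condVac, influence]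
  | l + 1, n + 1, τ, ψ, K, hK, hψ => by
    simp only [influence]
    rw [← mul_assoc, Finset.mul_sum]
    refine abs_ex_pw_sub_le (fun i => isProb_treeWt hlam (n + 1) (childBoundary τ i) true)
      (fun i => isProb_treeWt hlam (n + 1) (childBoundary τ i) false) _ _ fun i c => ?_
    set P : Fin b → ℝ := fun j => condVac lam (l + 1) (n + 1) (childBoundary τ j) (c j) with hP
    have hPmem : ∀ j, 0 < P j ∧ P j ≤ 1 := fun j => condVac_succ_pos hlam l n _ _
    set χ : ℝ → ℝ := fun t => Real.log (1 / (1 + lam * ∏ j,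
      Function.update P i (Real.exp (min t 0)) j)) with hχ
    have hup : ∀ t j, 0 < Function.update P i (Real.exp (min t 0)) j ∧
        Function.update P i (Real.exp (min t 0)) j ≤ 1 := by
      intro t j
      by_cases hj : j = i
      · subst hj
        simpa using Real.exp_pos _
      · simpa [hj] using hPmem j
    have hχL : ∀ s t, |χ s - χ t| ≤ lam / (1 + lam) * |s - t| := by
      intro s t
      refine (abs_log_recursion_sub_le hlam (hup s) (hup t)).trans
        (mul_le_mul_of_nonneg_left ?_ (by positivity))
      rw [Finset.sum_eq_single i]
      · simpa using abs_min_sub_min_le_max s 0 t 0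
      · intro j _ hj
        simp [hj]
      · simp
    have e : ∀ d, Real.log (belowVac lam (l + 1) (n + 1) τ (Function.update c i d))
        = χ (Real.log (condVac lam (l + 1) (n + 1) (childBoundary τ i) d)) := by
      intro d
      have hd := condVac_succ_pos hlam l n (childBoundary τ i) d
      simp only [hχ, belowVac]
      rw [min_eq_left (Real.log_nonpos hd.1.le hd.2), Real.exp_log hd.1]
      congr 4
      refine Finset.prod_congr rfl fun j _ => ?_
      by_cases hj : j = i
      · subst hj; simp
      · simp [hj, hP]
    simp only [e]
    have ih := abs_ex_childWt_sub_le hlam l n (childBoundary τ i) (fun t => ψ (χ t))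
      (K * (lam / (1 + lam))) (by positivity) fun s t => (hψ _ _).trans (by
        rw [mul_assoc]
        exact mul_le_mul_of_nonneg_left (hχL s t) hK)
    rw [ex_treeWt_belowVac n l _ true (fun t => ψ (χ (Real.log t))),
      ex_treeWt_belowVac n l _ false (fun t => ψ (χ (Real.log t)))]
    simp only [rootWt, zero_mul, one_mul, zero_add]
    set X := ex (childWt lam n (childBoundary τ i) true) fun c =>
      ψ (χ (Real.log (belowVac lam l n (childBoundary τ i) c)))
    set Y := ex (childWt lam n (childBoundary τ i) false) fun c =>
      ψ (χ (Real.log (belowVac lam l n (childBoundary τ i) c)))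
    have hv := vac_mem hlam (n + 1) (childBoundary τ i)
    have e2 : Y - ((1 - vac lam (n + 1) (childBoundary τ i)) * X
        + vac lam (n + 1) (childBoundary τ i) * Y)
        = -((1 - vac lam (n + 1) (childBoundary τ i)) * (X - Y)) := by ring
    rw [e2, abs_neg, abs_mul, abs_of_nonneg (sub_nonneg.2 hv.2), mul_left_comm]
    exact mul_le_mul_of_nonneg_left ih (sub_nonneg.2 hv.2)

/-- The variance of the conditional vacancy probability. -/
theorem ex_sq_condVac_sub_le (hlam : 0 ≤ lam) (l n : ℕ) (τ : List (Fin b) → Bool) :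
    ex (treeWt lam (n + 1) τ false)
        (fun x => (condVac lam (l + 1) (n + 1) τ x - vac lam (n + 1) τ) ^ 2)
      ≤ influence lam l n τ := by
  have hw := isProb_treeWt hlam (n + 1) τ false
  have hv := vac_mem hlam (n + 1) τ
  set q := vac lam (n + 1) τ with hq
  have h1 : ex (treeWt lam (n + 1) τ false)
      (fun x => (condVac lam (l + 1) (n + 1) τ x - q) ^ 2)
      = ex (treeWt lam (n + 1) τ false) (fun x => condVac lam (l + 1) (n + 1) τ x ^ 2) - q ^ 2 := by
    have e : (fun x => (condVac lam (l + 1) (n + 1) τ x - q) ^ 2)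
        = fun x => condVac lam (l + 1) (n + 1) τ x ^ 2 - 2 * q * condVac lam (l + 1) (n + 1) τ x
          + q ^ 2 := by
      funext x
      ring
    rw [e, ex_add, ex_sub, ex_const_mul, hw.ex_const, ex_condVac hlam, ← hq]
    ring
  have hm := ex_condVac hlam (l + 1) (n + 1) τ
  have hm2 := ex_treeWt_belowVac (lam := lam) n l τ false fun t => t
  rw [hm] at hm2
  set X := ex (childWt lam n τ true) (belowVac lam l n τ) with hX
  set Y := ex (childWt lam n τ false) (belowVac lam l n τ) with hY
  have h2 : ex (treeWt lam (n + 1) τ false) (fun x => condVac lam (l + 1) (n + 1) τ x ^ 2)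
      = q * Y := by
    rw [ex_condVac_sq hlam, ex_treeWt_succ, ex_rootWt]
    have e1 : (fun c => condVac lam (l + 1) (n + 1) τ (true, c) * condVac lam 0 (n + 1) τ (true, c))
        = fun _ => 0 := by
      funext c
      exact mul_zero _
    have e2 : (fun c => condVac lam (l + 1) (n + 1) τ (false, c)
        * condVac lam 0 (n + 1) τ (false, c)) = belowVac lam l n τ := by
      funext c
      exact mul_one _
    rw [e1, e2, ex_zero, mul_zero, zero_add]
    rfl
  have h3 := abs_ex_childWt_sub_le hlam l n τ (fun t => Real.exp (min t 0)) 1 zero_le_one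
    fun s t => by
      have h := abs_sub_le_abs_log_sub_log (x := Real.exp (min s 0)) (y := Real.exp (min t 0))
        ⟨Real.exp_pos _, Real.exp_le_one_iff.2 (min_le_right _ _)⟩
        ⟨Real.exp_pos _, Real.exp_le_one_iff.2 (min_le_right _ _)⟩
      rw [Real.log_exp, Real.log_exp] at h
      rw [one_mul]
      refine h.trans ?_
      simpa using abs_min_sub_min_le_max s 0 t 0
  have e3 : ∀ c, Real.exp (min (Real.log (belowVac lam l n τ c)) 0) = belowVac lam l n τ c := by
    intro c
    have h := belowVac_mem hlam l n τ c
    have h0 : 0 < belowVac lam l n τ c := lt_of_lt_of_le (by positivity) h.1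
    rw [min_eq_left (Real.log_nonpos h0.le h.2), Real.exp_log h0]
  simp only [e3, one_mul] at h3
  rw [h1, h2]
  have hm3 : q = (1 - q) * X + q * Y := hm2
  have h4 : Y - X ≤ influence lam l n τ := (neg_le_abs _).trans' (by
    change Y - X ≤ -(X - Y)
    linarith) |>.trans h3
  have hW := influence_nonneg hlam l n τ
  have e5 : q * Y - q ^ 2 = q * (1 - q) * (Y - X) := by
    linear_combination (-q) * hm3
  rw [e5]
  have hq1 : 0 ≤ q * (1 - q) := mul_nonneg hv.1 (sub_nonneg.2 hv.2)
  have hq2 : q * (1 - q) ≤ 1 := by nlinarith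
  exact (mul_le_mul_of_nonneg_left h4 hq1).trans (mul_le_of_le_one_left hW hq2)

end Recursion
section Concentration

open Filter Topology

variable {b : ℕ} {lam : ℝ}

/-- The deviation of the logarithm of the conditional vacancy probability of the root. -/
def logDev (lam : ℝ) (l n : ℕ) (τ : List (Fin b) → Bool) (σ : Conf b n) : ℝ :=
  |Real.log (condVac lam l n τ σ) - Real.log (vac lam n τ)|

theorem logDev_succ_le (hlam : 0 ≤ lam) (l : ℕ) : ∀ (n : ℕ) (τ : List (Fin b) → Bool) (s : Bool)
    (c : Fin b → Conf b n), logDev lam (l + 2) (n + 1) τ (s, c)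
      ≤ lam / (1 + lam) * ∑ i, logDev lam (l + 1) n (childBoundary τ i) (c i)
  | 0, τ, s, c => by simp [logDev, condVac, vac_succ]
  | n + 1, τ, s, c => abs_log_recursion_sub_le hlam
      (fun i => condVac_succ_pos hlam l n (childBoundary τ i) (c i))
      fun i => vac_succ_pos hlam n (childBoundary τ i)

theorem exp_le_one_add_mul_exp (x : ℝ) : Real.exp x ≤ 1 + x * Real.exp x := by
  have h := Real.add_one_le_exp (-x)
  have h2 := mul_le_mul_of_nonneg_left h (Real.exp_pos x).le
  rw [← Real.exp_add, add_neg_cancel, Real.exp_zero] at h2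
  linarith

theorem ex_treeWt_true_le (hlam : 0 ≤ lam) (n l : ℕ) (τ : List (Fin b) → Bool) (F : ℝ → ℝ)
    (hF : ∀ t, 0 ≤ F t) (u : Bool) :
    ex (treeWt lam (n + 1) τ u) (fun x => F (condVac lam (l + 1) (n + 1) τ x))
      ≤ (1 + lam) * ex (treeWt lam (n + 1) τ false)
        fun x => F (condVac lam (l + 1) (n + 1) τ x) := by
  have h0 := (isProb_treeWt hlam (n + 1) τ false).ex_nonneg
    fun x => hF (condVac lam (l + 1) (n + 1) τ x)
  cases u with
  | false => nlinarith
  | true =>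
    rw [ex_treeWt_belowVac, ex_treeWt_belowVac]
    simp only [rootWt, zero_mul, one_mul, zero_add]
    have hA := (isProb_childWt hlam n τ true).ex_nonneg fun c => hF (belowVac lam l n τ c)
    have hB := (isProb_childWt hlam n τ false).ex_nonneg fun c => hF (belowVac lam l n τ c)
    have hv := vac_mem hlam (n + 1) τ
    have hv2 := vac_succ_ge hlam n τ
    rw [div_le_iff₀ (by positivity)] at hv2
    have h1 := mul_nonneg (sub_nonneg.2 hv.2) hA
    nlinarith

theorem ex_exp_logDev_le (hlam : 0 ≤ lam) {l : ℕ} {W : ℝ} {t : ℝ} (ht : 0 ≤ t) (n : ℕ)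
    (τ : List (Fin b) → Bool) (u : Bool) (hW : influence lam l n τ ≤ W) :
    ex (treeWt lam (n + 1) τ u) (fun x => Real.exp (t * logDev lam (l + 1) (n + 1) τ x))
      ≤ 1 + t * Real.exp (t * Real.log (1 + lam)) * ((1 + lam) ^ 2 * √W) := by
  have hu := isProb_treeWt hlam (n + 1) τ u
  have hw := isProb_treeWt hlam (n + 1) τ false
  have hv : 1 / (1 + lam) ≤ vac lam (n + 1) τ ∧ vac lam (n + 1) τ ≤ 1 :=
    ⟨vac_succ_ge hlam n τ, (vac_mem hlam _ _).2⟩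
  have hc : ∀ x, 1 / (1 + lam) ≤ condVac lam (l + 1) (n + 1) τ x ∧
      condVac lam (l + 1) (n + 1) τ x ≤ 1 := fun x =>
    ⟨condVac_succ_ge hlam l n τ x, (condVac_mem hlam _ _ _ _).2⟩
  have h1 : ∀ x, Real.exp (t * logDev lam (l + 1) (n + 1) τ x)
      ≤ 1 + t * Real.exp (t * Real.log (1 + lam)) * ((1 + lam) *
        |condVac lam (l + 1) (n + 1) τ x - vac lam (n + 1) τ|) := by
    intro x
    have h := abs_log_sub_log_le hlam (hc x) hv
    have h0 : 0 ≤ logDev lam (l + 1) (n + 1) τ x := abs_nonneg _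
    refine (exp_le_one_add_mul_exp _).trans (add_le_add le_rfl ?_)
    calc t * logDev lam (l + 1) (n + 1) τ x * Real.exp (t * logDev lam (l + 1) (n + 1) τ x)
        = t * Real.exp (t * logDev lam (l + 1) (n + 1) τ x) * logDev lam (l + 1) (n + 1) τ x := by
          ring
      _ ≤ _ := by
          gcongr
          · exact h.1
          · exact h.2
  refine (hu.ex_mono h1).trans ?_
  rw [ex_add, hu.ex_const, ex_const_mul, ex_const_mul]
  refine add_le_add le_rfl (mul_le_mul_of_nonneg_left ?_ (by positivity))
  have h2 := ex_treeWt_true_le hlam n l τ (fun y => |y - vac lam (n + 1) τ|)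
    (fun y => abs_nonneg _) u
  have h3 : ex (treeWt lam (n + 1) τ false)
      (fun x => |condVac lam (l + 1) (n + 1) τ x - vac lam (n + 1) τ|) ≤ √W := by
    refine Real.le_sqrt_of_sq_le ((hw.sq_ex_le).trans ?_)
    simp only [sq_abs]
    exact (ex_sq_condVac_sub_le hlam l n τ).trans hW
  calc _ ≤ (1 + lam) * ((1 + lam) * √W) := by
        refine mul_le_mul_of_nonneg_left (h2.trans ?_) (by positivity)
        exact mul_le_mul_of_nonneg_left h3 (by positivity)
    _ = _ := by ring

theorem logDev_zero_right (l : ℕ) (τ : List (Fin b) → Bool) (σ : Conf b 0) :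
    logDev lam l 0 τ σ = 0 := by
  cases l <;> simp [logDev, condVac]

theorem ex_exp_logDev_iterate_le (hlam : 0 ≤ lam) {P : ℕ → (List (Fin b) → Bool) → Prop}
    (hP : ∀ n τ i, P (n + 1) τ → P n (childBoundary τ i)) {l : ℕ} {W : ℝ}
    (hW : ∀ n τ, P (n + 1) τ → influence lam l n τ ≤ W) :
    ∀ (k n : ℕ) (τ : List (Fin b) → Bool) (u : Bool) (t : ℝ), 0 ≤ t → P n τ →
      ex (treeWt lam n τ u) (fun x => Real.exp (t * logDev lam (l + 1 + k) n τ x))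
        ≤ (1 + (lam / (1 + lam)) ^ k * t *
          Real.exp ((lam / (1 + lam)) ^ k * t * Real.log (1 + lam)) *
            ((1 + lam) ^ 2 * √W)) ^ b ^ k
  | k, 0, τ, u, t, ht, _ => by
    simp only [logDev_zero_right, mul_zero, Real.exp_zero, (isProb_treeWt hlam 0 τ u).ex_const]
    refine one_le_pow₀ ?_
    have : 0 ≤ (lam / (1 + lam)) ^ k * t *
          Real.exp ((lam / (1 + lam)) ^ k * t * Real.log (1 + lam)) *
            ((1 + lam) ^ 2 * √W) := by positivity
    linarith
  | 0, n + 1, τ, u, t, ht, hp => by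
    simpa using ex_exp_logDev_le hlam ht n τ u (hW n τ hp)
  | k + 1, n + 1, τ, u, t, ht, hp => by
    rw [ex_treeWt_succ]
    refine (isProb_rootWt hlam n τ u).ex_le_const fun s => ?_
    have hg : 0 ≤ lam / (1 + lam) := by positivity
    calc ex (childWt lam n τ s)
          (fun c => Real.exp (t * logDev lam (l + 1 + (k + 1)) (n + 1) τ (s, c)))
        ≤ ex (childWt lam n τ s) fun c => ∏ i, Real.exp (lam / (1 + lam) * t *
            logDev lam (l + 1 + k) n (childBoundary τ i) (c i)) := by
          refine (isProb_childWt hlam n τ s).ex_mono fun c => ?_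
          rw [← Real.exp_sum, ← Finset.mul_sum]
          refine Real.exp_le_exp.2 ?_
          have h := logDev_succ_le hlam (l + k) n τ s c
          rw [show l + 1 + (k + 1) = l + k + 2 by ring, show l + 1 + k = l + k + 1 by ring]
          nlinarith
      _ = ∏ i, ex (treeWt lam n (childBoundary τ i) s) fun d => Real.exp (lam / (1 + lam) * t *
            logDev lam (l + 1 + k) n (childBoundary τ i) d) :=
          ex_pw_prod (fun i => treeWt lam n (childBoundary τ i) s) fun i d =>
            Real.exp (lam / (1 + lam) * t * logDev lam (l + 1 + k) n (childBoundary τ i) d)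
      _ ≤ ∏ _i : Fin b, _ := Finset.prod_le_prod
          (fun i _ => (isProb_treeWt hlam n _ s).ex_nonneg fun d => (Real.exp_pos _).le)
          fun i _ => ex_exp_logDev_iterate_le hlam hP hW k n (childBoundary τ i) s
            (lam / (1 + lam) * t) (by positivity) (hP n τ i hp)
      _ = _ := by
          rw [Finset.prod_const, Finset.card_univ, Fintype.card_fin, ← pow_mul, ← pow_succ,
            show (lam / (1 + lam)) ^ k * (lam / (1 + lam) * t) = (lam / (1 + lam)) ^ (k + 1) * t by
              ring]

theorem exists_pow_le_two (b : ℕ) {r C A M K g : ℝ} (hr : 0 < r) (hr1 : r < 1)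
    (hg : 0 ≤ g) (hg1 : g < 1) (hA : 0 ≤ A) (hK : 0 ≤ K) :
    ∃ k n : ℕ, (1 + g ^ k * (K * (n + 1 + k + 1)) * Real.exp (g ^ k * (K * (n + 1 + k + 1)) * M) *
      (A * √(C * (r ^ 4) ^ n))) ^ b ^ k ≤ 2 := by
  have hlog : 0 < -Real.log r := neg_pos.2 (Real.log_neg hr hr1)
  have hk : Tendsto (fun k : ℕ => g ^ k * (K * M)) atTop (𝓝 0) := by
    simpa using (tendsto_pow_atTop_nhds_zero_of_lt_one hg hg1).mul_const (K * M)
  obtain ⟨k, hk⟩ := (hk.eventually (ge_mem_nhds hlog)).exists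
  refine ⟨k, ?_⟩
  have hlim : Tendsto (fun n : ℕ => (n * r ^ n + (k + 2) * r ^ n) * (K * r⁻¹ ^ (k + 2) * (A * √C)))
      atTop (𝓝 0) := by
    have h1 := tendsto_self_mul_const_pow_of_lt_one hr.le hr1
    have h2 := (tendsto_pow_atTop_nhds_zero_of_lt_one hr.le hr1).const_mul ((k : ℝ) + 2)
    simpa using (h1.add h2).mul_const (K * r⁻¹ ^ (k + 2) * (A * √C))
  have hlim2 : Tendsto (fun n : ℕ => (1 + (n * r ^ n + (k + 2) * r ^ n) *
      (K * r⁻¹ ^ (k + 2) * (A * √C))) ^ b ^ k) atTop (𝓝 1) := by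
    simpa using (hlim.const_add 1).pow (b ^ k)
  obtain ⟨n, hn⟩ := (hlim2.eventually (ge_mem_nhds one_lt_two)).exists
  refine ⟨n, le_trans ?_ hn⟩
  have hexp : Real.exp (g ^ k * (K * (n + 1 + k + 1)) * M) ≤ r⁻¹ ^ (n + k + 2) := by
    have e : r⁻¹ ^ (n + k + 2) = Real.exp ((n + k + 2 : ℕ) * (-Real.log r)) := by
      rw [Real.exp_nat_mul, Real.exp_neg, Real.exp_log hr]
    rw [e]
    refine Real.exp_le_exp.2 ?_
    have := mul_le_mul_of_nonneg_left hk (show (0 : ℝ) ≤ (n + k + 2 : ℕ) by positivity)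
    push_cast at this ⊢
    linarith
  have hsq : √(C * (r ^ 4) ^ n) = √C * (r ^ n * r ^ n) := by
    rw [show (r ^ 4) ^ n = (r ^ n * r ^ n) ^ 2 by ring, Real.sqrt_mul' _ (sq_nonneg _),
      Real.sqrt_sq (by positivity)]
  have hgk : g ^ k ≤ 1 := pow_le_one₀ hg hg1.le
  rw [hsq]
  refine pow_le_pow_left₀ (by positivity) (add_le_add le_rfl ?_) _
  calc g ^ k * (K * (n + 1 + k + 1)) * Real.exp (g ^ k * (K * (n + 1 + k + 1)) * M) *
        (A * (√C * (r ^ n * r ^ n)))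
      ≤ 1 * (K * (n + 1 + k + 1)) * r⁻¹ ^ (n + k + 2) * (A * (√C * (r ^ n * r ^ n))) := by
        gcongr
    _ = _ := by
        have h1 : r⁻¹ ^ (n + k + 2) * r ^ n = r⁻¹ ^ (k + 2) := by
          rw [show n + k + 2 = k + 2 + n by ring, pow_add, mul_assoc, ← mul_pow,
            inv_mul_cancel₀ hr.ne', one_pow, mul_one]
        rw [← h1]
        ring

/-- Exponential moments of the conditional vacancy probability of the root. -/
theorem exists_ex_exp_condVac_le (hlam : 0 ≤ lam) {P : ℕ → (List (Fin b) → Bool) → Prop}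
    (hP : ∀ n τ i, P (n + 1) τ → P n (childBoundary τ i)) {r C : ℝ} (hr : 0 < r) (hr1 : r < 1)
    (hW : ∀ l n τ, P (n + 1) τ → influence lam l n τ ≤ C * (r ^ 4) ^ l) {K : ℝ} (hK : 0 ≤ K) :
    ∃ l : ℕ, ∀ n τ, P n τ → ex (treeWt lam n τ false)
      (fun x => Real.exp (K * (l + 1) * |condVac lam l n τ x - vac lam n τ|)) ≤ 2 := by
  obtain ⟨k, l, h⟩ := exists_pow_le_two b (C := C) (A := (1 + lam) ^ 2) (M := Real.log (1 + lam))
    (K := K) (g := lam / (1 + lam)) hr hr1 (by positivity)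
    (by rw [div_lt_one (by positivity)]; linarith) (by positivity) hK
  refine ⟨l + 1 + k, fun n τ hp => ?_⟩
  have h1 := ex_exp_logDev_iterate_le hlam hP (hW l) k n τ false (K * (l + 1 + k + 1))
    (by positivity) hp
  refine le_trans ((isProb_treeWt hlam n τ false).ex_mono fun x => ?_) (h1.trans h)
  refine Real.exp_le_exp.2 ?_
  push_cast
  refine mul_le_mul_of_nonneg_left ?_ (by positivity)
  cases n with
  | zero => simp [condVac, logDev_zero_right]
  | succ n =>
    rw [show l + 1 + k = l + k + 1 by ring]
    exact abs_sub_le_abs_log_sub_log (condVac_succ_pos hlam _ n τ x) (vac_succ_pos hlam n τ)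

theorem exp_le_one_add_add_sq (w : ℝ) : Real.exp w ≤ 1 + w + w ^ 2 * Real.exp |w| := by
  have h1 := exp_le_one_add_mul_exp w
  rcases le_total 0 w with hw | hw
  · rw [abs_of_nonneg hw]
    nlinarith
  · have h2 : 1 ≤ Real.exp |w| := Real.one_le_exp (abs_nonneg w)
    have h3 := Real.add_one_le_exp w
    nlinarith [sq_nonneg w]

/-- The correlation of the conditional vacancy probability with `f`. -/
theorem sq_ex_mul_condVac_sub_vac_le (hlam : 0 ≤ lam) {T : ℝ} (hT : 1 ≤ T) (l n : ℕ)
    (τ : List (Fin b) → Bool) (hexp : ex (treeWt lam n τ false)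
      (fun x => Real.exp (T * |condVac lam l n τ x - vac lam n τ|)) ≤ 2)
    (f : Conf b n → ℝ) (hf : ∀ x, 0 ≤ f x) :
    (ex (treeWt lam n τ false) fun x => f x * (condVac lam l n τ x - vac lam n τ)) ^ 2
      ≤ 64 / T * (ex (treeWt lam n τ false) f *
        ∑ j ∈ Finset.range (l + 1), levelSum lam (rootEnt lam) j n τ false f) := by
  have hw := isProb_treeWt hlam n τ false
  have hT0 : 0 < T := by linarith
  set m := ex (treeWt lam n τ false) f with hm
  set S := ∑ j ∈ Finset.range (l + 1), levelSum lam (rootEnt lam) j n τ false f with hS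
  have hm0 : 0 ≤ m := hw.ex_nonneg hf
  have hS0 : 0 ≤ S := Finset.sum_nonneg fun j _ =>
    levelSum_nonneg hlam (rootEnt_nonneg hlam) j n τ false f hf
  obtain ⟨ε, hε, hc⟩ : ∃ ε : ℝ, |ε| = 1 ∧
      |ex (treeWt lam n τ false) fun x => f x * (condVac lam l n τ x - vac lam n τ)|
        = ε * ex (treeWt lam n τ false) fun x => f x * (condVac lam l n τ x - vac lam n τ) := by
    rcases abs_choice (ex (treeWt lam n τ false) fun x =>
      f x * (condVac lam l n τ x - vac lam n τ)) with h | h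
    · exact ⟨1, by simp, by rw [h, one_mul]⟩
    · exact ⟨-1, by simp, by rw [h, neg_one_mul]⟩
  rw [← sq_abs]
  set X : Conf b n → ℝ := fun x => condVac lam l n τ x - vac lam n τ with hX
  have hX1 : ∀ x, |X x| ≤ 1 := fun x => by
    have h1 := condVac_mem hlam l n τ x
    have h2 := vac_mem hlam n τ
    exact abs_sub_le_iff.2 ⟨by linarith, by linarith⟩
  have hX0 : ex (treeWt lam n τ false) X = 0 := by
    rw [hX, ex_sub, hw.ex_const, ex_condVac hlam, sub_self]
  set c := |ex (treeWt lam n τ false) fun x => f x * X x| with hcdef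
  have hc0 : 0 ≤ c := abs_nonneg _
  have hcm : c ≤ m := hw.abs_ex_le_ex fun x => by
    rw [abs_mul, abs_of_nonneg (hf x)]
    exact mul_le_of_le_one_right (hf x) (hX1 x)
  have key : ∀ α : ℝ, 0 ≤ α → α ≤ 1 / 2 → α * T * c ≤ S + m * (16 * α ^ 2) := by
    intro α hα hα2
    have hdep : DependsUpTo l n fun x => α * T * ε * X x :=
      DependsUpTo.comp (κ := Unit) (φ := fun _ => condVac lam l n τ)
        (fun y => α * T * ε * (y () - vac lam n τ)) fun _ => dependsUpTo_condVac l n τ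
    have h1 := ex_treeWt_mul_le hlam l n τ false f (fun x => α * T * ε * X x) hf hdep
    have e1 : ex (treeWt lam n τ false) (fun x => f x * (α * T * ε * X x)) = α * T * c := by
      rw [hc, ← mul_assoc, ← ex_const_mul]
      exact congrArg _ (funext fun x => by ring)
    rw [e1] at h1
    refine h1.trans (add_le_add le_rfl (mul_le_mul_of_nonneg_left ?_ hm0))
    have h2 : ∀ x, Real.exp (α * T * ε * X x)
        ≤ 1 + α * T * ε * X x + 8 * α ^ 2 * Real.exp (T * |X x|) := by
      intro x
      refine (exp_le_one_add_add_sq _).trans (add_le_add le_rfl ?_)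
      have hz : 0 ≤ T * |X x| := by positivity
      have e : |α * T * ε * X x| = α * (T * |X x|) := by
        rw [abs_mul, abs_mul, hε, abs_of_nonneg (by positivity)]
        ring
      rw [← sq_abs, e]
      set z := T * |X x|
      have h3 : Real.exp (α * z) ≤ Real.exp (z / 2) := Real.exp_le_exp.2 (by nlinarith)
      have h4 : z ^ 2 ≤ 8 * Real.exp (z / 2) := by
        have := Real.quadratic_le_exp_of_nonneg (show 0 ≤ z / 2 by positivity)
        nlinarith
      calc (α * z) ^ 2 * Real.exp (α * z) = α ^ 2 * z ^ 2 * Real.exp (α * z) := by ring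
        _ ≤ α ^ 2 * (8 * Real.exp (z / 2)) * Real.exp (z / 2) := by gcongr
        _ = 8 * α ^ 2 * Real.exp z := by
          have : Real.exp z = Real.exp (z / 2) * Real.exp (z / 2) := by
            rw [← Real.exp_add, add_halves]
          rw [this]
          ring
    have h5 := hw.ex_mono h2
    rw [ex_add, ex_add, hw.ex_const, ex_const_mul, ex_const_mul, hX0, mul_zero, add_zero] at h5
    have hpos : 0 < ex (treeWt lam n τ false) fun x => Real.exp (α * T * ε * X x) :=
      hw.ex_pos fun _ => Real.exp_pos _
    have h6 := Real.log_le_sub_one_of_pos hpos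
    have h7 := mul_le_mul_of_nonneg_left hexp (show 0 ≤ 8 * α ^ 2 by positivity)
    linarith
  rcases hm0.eq_or_lt with hm0 | hm0
  · have : c = 0 := le_antisymm (hcm.trans_eq hm0.symm) hc0
    rw [this, ← hm0]
    simp
  · have h := key (c / (32 * m)) (by positivity) (by
      rw [div_le_iff₀ (by positivity)]
      linarith)
    have e1 : c / (32 * m) * T * c = T * c ^ 2 / (32 * m) := by ring
    have e2 : m * (16 * (c / (32 * m)) ^ 2) = c ^ 2 / (64 * m) := by
      field_simp
      ring
    rw [e1, e2] at h
    have h2 : c ^ 2 / (64 * m) ≤ T * c ^ 2 / (64 * m) := by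
      gcongr
      nlinarith [sq_nonneg c]
    have e3 : T * c ^ 2 / (32 * m) = T * c ^ 2 / (64 * m) + T * c ^ 2 / (64 * m) := by
      field_simp
      ring
    have h3 : T * c ^ 2 / (64 * m) ≤ S := by linarith
    rw [div_le_iff₀ (by positivity)] at h3
    rw [div_mul_eq_mul_div, le_div_iff₀ hT0]
    linarith

end Concentration

section LogSobolev

variable {b : ℕ} {lam : ℝ}

theorem IsProb.ent_eq_zero {α : Type*} [Fintype α] {w f : α → ℝ} (hw : IsProb w)
    (hf : ∀ x, 0 ≤ f x) (h : ex w f = 0) : ent w f = 0 := by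
  have h0 : ∀ x, w x * f x = 0 := fun x =>
    (Finset.sum_eq_zero_iff_of_nonneg fun x _ => mul_nonneg (hw.nonneg x) (hf x)).1 h x
      (Finset.mem_univ x)
  rw [ent, h, zero_mul, sub_zero]
  exact Finset.sum_eq_zero fun x _ => by rw [← mul_assoc, h0, zero_mul]

theorem exists_occupied_ge (b : ℕ) (hlam : 0 ≤ lam) :
    ∃ p₀ : ℝ, 0 < p₀ ∧ ∀ (n : ℕ) (τ : List (Fin b) → Bool), 1 - vac lam (n + 1) τ = 0 ∨
      p₀ ≤ (1 - vac lam (n + 1) τ) * vac lam (n + 1) τ := by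
  rcases hlam.eq_or_lt with rfl | hlam'
  · exact ⟨1, one_pos, fun n τ => Or.inl (by simp [vac_succ])⟩
  refine ⟨lam * (1 / (1 + lam)) ^ b * (1 / (1 + lam)) * (1 / (1 + lam)), by positivity,
    fun n τ => ?_⟩
  rw [one_sub_vac_succ hlam]
  have hor : ∀ i, vac lam n (childBoundary τ i) = 0 ∨
      1 / (1 + lam) ≤ vac lam n (childBoundary τ i) := by
    intro i
    cases n with
    | zero =>
      by_cases h : childBoundary τ i []
      · exact Or.inl (by simp [vac, h])
      · refine Or.inr ?_
        simp only [vac, h]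
        rw [if_neg (by simp), div_le_one (by positivity)]
        linarith
    | succ n => exact Or.inr (vac_succ_ge hlam n _)
  by_cases h : ∃ i, vac lam n (childBoundary τ i) = 0
  · obtain ⟨i, hi⟩ := h
    left
    rw [Finset.prod_eq_zero (Finset.mem_univ i) hi]
    ring
  · right
    push Not at h
    have h1 : (1 / (1 + lam)) ^ b ≤ ∏ i, vac lam n (childBoundary τ i) := by
      have := Finset.prod_le_prod (s := Finset.univ) (f := fun _ : Fin b => 1 / (1 + lam))
        (g := fun i => vac lam n (childBoundary τ i)) (fun i _ => by positivity)
        fun i _ => (hor i).resolve_left (h i)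
      simpa using this
    have h2 := vac_succ_ge hlam n τ
    have h3 : 0 ≤ ∏ i, vac lam n (childBoundary τ i) := (prod_vac_mem hlam n τ).1
    have h4 := (vac_mem hlam (n + 1) τ).1
    gcongr

theorem rootEnt_le (hlam : 0 ≤ lam) {p₀ : ℝ} (hp₀ : 0 < p₀) (l n : ℕ)
    (τ : List (Fin b) → Bool) (f : Conf b (n + 1) → ℝ) (hf : ∀ x, 0 ≤ f x)
    (hp : p₀ ≤ (1 - vac lam (n + 1) τ) * vac lam (n + 1) τ) {A B : ℝ} (hA : 0 ≤ A) (hB : 0 ≤ B)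
    (h1 : (ex (treeWt lam (n + 1) τ false) fun x =>
      f x * (condVac lam l (n + 1) τ x - vac lam (n + 1) τ)) ^ 2
        ≤ ex (treeWt lam (n + 1) τ false) f * A)
    (h2 : (ex (treeWt lam (n + 1) τ false) fun x =>
      f x * (condVac lam l (n + 1) τ x - condVac lam 0 (n + 1) τ x)) ^ 2
        ≤ ex (treeWt lam (n + 1) τ false) f * B) :
    rootEnt lam (n + 1) τ false f ≤ 2 / p₀ * (A + B) := by
  have hr := isProb_rootWt hlam n τ false
  have hc := isProb_childWt hlam n τ
  set F : Bool → ℝ := fun s => ex (childWt lam n τ s) fun c => f (s, c) with hF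
  have hF0 : ∀ s, 0 ≤ F s := fun s => (hc s).ex_nonneg fun c => hf _
  have hm : ex (treeWt lam (n + 1) τ false) f = ex (rootWt lam n τ false) F := ex_treeWt_succ _ _ _ _
  change ent (rootWt lam n τ false) F ≤ _
  rcases (hr.ex_nonneg hF0).eq_or_lt with h0 | h0
  · rw [hr.ent_eq_zero hF0 h0.symm]
    positivity
  refine (hr.ent_le_var_div hF0 h0).trans ?_
  rw [div_le_iff₀ h0]
  rw [hm] at h1 h2
  set m := ex (rootWt lam n τ false) F with hmdef
  set q := vac lam (n + 1) τ with hq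
  have hcov : ex (treeWt lam (n + 1) τ false) (fun x => f x * (condVac lam 0 (n + 1) τ x - q))
      = (1 - q) * q * (F false - F true) := by
    rw [ex_treeWt_succ, ex_rootWt]
    have e1 : ex (childWt lam n τ true) (fun c => f (true, c) *
        (condVac lam 0 (n + 1) τ (true, c) - q)) = F true * (0 - q) := by
      rw [hF, ← ex_mul_const]
      rfl
    have e2 : ex (childWt lam n τ false) (fun c => f (false, c) *
        (condVac lam 0 (n + 1) τ (false, c) - q)) = F false * (1 - q) := by
      rw [hF, ← ex_mul_const]
      rfl
    rw [e1, e2]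
    simp only [rootWt, ← hq]
    ring
  have hvar : ex (rootWt lam n τ false) (fun s => F s ^ 2) - m ^ 2
      = (1 - q) * q * (F false - F true) ^ 2 := by
    rw [hmdef, ex_rootWt, ex_rootWt]
    simp only [rootWt, ← hq]
    ring
  set X := ex (treeWt lam (n + 1) τ false) fun x => f x * (condVac lam l (n + 1) τ x - q)
  set Y := ex (treeWt lam (n + 1) τ false) fun x =>
      f x * (condVac lam l (n + 1) τ x - condVac lam 0 (n + 1) τ x)
  have hXY : (1 - q) * q * (F false - F true) = X - Y := by
    rw [← hcov, ← ex_sub]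
    exact congrArg _ (funext fun x => by ring)
  rw [hvar]
  have hpq : 0 < (1 - q) * q := hp₀.trans_le hp
  have h3 : ((1 - q) * q * (F false - F true)) ^ 2 ≤ 2 * (m * A + m * B) := by
    rw [hXY]
    nlinarith [sq_nonneg (X + Y)]
  have h4 : (1 - q) * q * (F false - F true) ^ 2 * p₀ ≤ 2 * (m * A + m * B) := by
    refine le_trans ?_ h3
    have h5 := mul_le_mul_of_nonneg_left
      (mul_le_mul_of_nonneg_right hp (sq_nonneg (F false - F true))) hpq.le
    linarith
  rw [← le_div_iff₀ hp₀] at h4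
  refine h4.trans_eq ?_
  field_simp

theorem rootEnt_eq_zero (n : ℕ) (τ : List (Fin b) → Bool) (u : Bool) (f : Conf b (n + 1) → ℝ)
    (h : u = true ∨ 1 - vac lam (n + 1) τ = 0) : rootEnt lam (n + 1) τ u f = 0 := by
  have h1 : rootWt lam n τ u true = 0 ∧ rootWt lam n τ u false = 1 := by
    rcases h with rfl | h
    · exact ⟨rfl, rfl⟩
    · cases u
      · exact ⟨h, by simp only [rootWt]; linarith⟩
      · exact ⟨rfl, rfl⟩
  simp only [rootEnt, ent, ex_rootWt, h1.1, h1.2, zero_mul, one_mul, zero_add, sub_self]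

/-- The entropy at the root is a small multiple of the entropies at the next levels, up to local
terms. -/
theorem exists_rootEnt_le (hlam : 0 ≤ lam) {P : ℕ → (List (Fin b) → Bool) → Prop}
    (hP : ∀ n τ i, P (n + 1) τ → P n (childBoundary τ i)) {r C : ℝ} (hr : 0 < r) (hr1 : r < 1)
    (hW : ∀ l n τ, P (n + 1) τ → influence lam l n τ ≤ C * (r ^ 4) ^ l) :
    ∃ (l : ℕ) (C : ℝ), 0 ≤ C ∧ ∀ n τ u (f : Conf b n → ℝ), P n τ → (∀ x, 0 ≤ f x) →
      rootEnt lam n τ u f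
        ≤ 1 / (2 * (l + 1)) * ∑ j ∈ Finset.range (l + 1), levelSum lam (rootEnt lam) j n τ u f
          + C * ∑ j ∈ Finset.range l, levelSum lam (rootDir lam) j n τ u fun x => √(f x) := by
  obtain ⟨p₀, hp₀, hp⟩ := exists_occupied_ge b hlam
  obtain ⟨l, hl⟩ := exists_ex_exp_condVac_le hlam hP hr hr1 hW (K := 256 / p₀ + 1) (by positivity)
  obtain ⟨C', hC', hloc⟩ := sq_ex_mul_condVac_sub_le (b := b) hlam l
  refine ⟨l, 2 / p₀ * C', by positivity, fun n τ u f hPn hf => ?_⟩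
  set S := ∑ j ∈ Finset.range (l + 1), levelSum lam (rootEnt lam) j n τ u f with hS
  set D := ∑ j ∈ Finset.range l, levelSum lam (rootDir lam) j n τ u fun x => √(f x) with hD
  have hS0 : 0 ≤ S := Finset.sum_nonneg fun j _ =>
    levelSum_nonneg hlam (rootEnt_nonneg hlam) j n τ u f hf
  have hD0 : 0 ≤ D := Finset.sum_nonneg fun j _ => levelSum_nonneg hlam
    (fun n τ u f _ => rootDir_nonneg hlam n τ u f) j n τ u _ fun _ => Real.sqrt_nonneg _
  have hRHS : 0 ≤ 1 / (2 * ((l : ℝ) + 1)) * S + 2 / p₀ * C' * D := by positivity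
  cases n with
  | zero => exact hRHS
  | succ n =>
    by_cases hz : u = true ∨ 1 - vac lam (n + 1) τ = 0
    · rwa [rootEnt_eq_zero n τ u f hz]
    · push Not at hz
      obtain ⟨hu, hz⟩ := hz
      rw [ne_eq, Bool.not_eq_true] at hu
      subst hu
      have hT : 1 ≤ (256 / p₀ + 1) * ((l : ℝ) + 1) := by
        have h1 : 0 ≤ 256 / p₀ := by positivity
        have h2 : (0 : ℝ) ≤ l := by positivity
        nlinarith
      have h1 := sq_ex_mul_condVac_sub_vac_le hlam hT l (n + 1) τ (hl _ τ hPn) f hf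
      have h2 := hloc (n + 1) τ f hf
      rw [← hS] at h1
      rw [← hD] at h2
      have h := rootEnt_le hlam hp₀ l n τ f hf ((hp n τ).resolve_left hz)
        (A := 64 / ((256 / p₀ + 1) * ((l : ℝ) + 1)) * S) (B := C' * D) (by positivity)
        (by positivity) (h1.trans_eq (by ring)) (h2.trans_eq (by ring))
      refine h.trans ?_
      rw [mul_add, ← mul_assoc, ← mul_assoc]
      refine add_le_add (mul_le_mul_of_nonneg_right ?_ hS0) le_rfl
      rw [div_mul_div_comm, div_le_div_iff₀ (by positivity) (by positivity)]
      have e : p₀ * ((256 / p₀ + 1) * ((l : ℝ) + 1)) = (256 + p₀) * (l + 1) := by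
        field_simp
      rw [e]
      nlinarith [mul_pos hp₀ (show (0 : ℝ) < l + 1 by positivity)]

theorem sum_range_shift_le {a : ℕ → ℝ} (ha : ∀ k, 0 ≤ a k) {n : ℕ} (h0 : ∀ k, n ≤ k → a k = 0)
    (j : ℕ) : ∑ k ∈ Finset.range n, a (j + k) ≤ ∑ k ∈ Finset.range n, a k := by
  have h1 := Finset.sum_range_add a j n
  have h2 := Finset.sum_range_add a n j
  rw [add_comm n j, Finset.sum_eq_zero fun k _ => h0 (n + k) (Nat.le_add_right n k)] at h2
  have h3 := Finset.sum_nonneg fun k (_ : k ∈ Finset.range j) => ha k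
  linarith

/-- The logarithmic Sobolev inequality for the tree model. -/
theorem exists_ent_treeWt_le (hlam : 0 ≤ lam) {P : ℕ → (List (Fin b) → Bool) → Prop}
    (hP : ∀ n τ i, P (n + 1) τ → P n (childBoundary τ i)) {r C : ℝ} (hr : 0 < r) (hr1 : r < 1)
    (hW : ∀ l n τ, P (n + 1) τ → influence lam l n τ ≤ C * (r ^ 4) ^ l) :
    ∃ C : ℝ, 0 < C ∧ ∀ n τ (f : Conf b n → ℝ), P n τ → (∀ x, 0 ≤ f x) →
      ent (treeWt lam n τ false) f ≤ C * ∑ j ∈ Finset.range n,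
        levelSum lam (rootDir lam) j n τ false fun x => √(f x) := by
  obtain ⟨l, C, hC, h⟩ := exists_rootEnt_le hlam hP hr hr1 hW
  refine ⟨2 * (C * l) + 1, by positivity, fun n τ f hPn hf => ?_⟩
  set L : ℕ → ℝ := fun k => levelSum lam (rootEnt lam) k n τ false f with hL
  set D : ℕ → ℝ := fun k => levelSum lam (rootDir lam) k n τ false fun x => √(f x) with hD
  have hL0 : ∀ k, 0 ≤ L k := fun k => levelSum_nonneg hlam (rootEnt_nonneg hlam) k n τ false f hf
  have hD0 : ∀ k, 0 ≤ D k := fun k => levelSum_nonneg hlam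
    (fun n τ u f _ => rootDir_nonneg hlam n τ u f) k n τ false _ fun _ => Real.sqrt_nonneg _
  have hk : ∀ k ∈ Finset.range n, L k ≤ 1 / (2 * ((l : ℝ) + 1)) *
      ∑ j ∈ Finset.range (l + 1), L (j + k) + C * ∑ j ∈ Finset.range l, D (j + k) := by
    intro k _
    have h1 := levelSum_mono hlam hP h k n τ false f hPn hf
    rw [levelSum_add, levelSum_const_mul, levelSum_const_mul, levelSum_sum, levelSum_sum] at h1
    simp only [levelSum_comp (levelSum lam (rootDir lam) _) Real.sqrt, levelSum_levelSum] at h1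
    exact h1
  set S := ∑ k ∈ Finset.range n, L k with hS
  set DD := ∑ k ∈ Finset.range n, D k with hDD
  have hDD0 : 0 ≤ DD := Finset.sum_nonneg fun k _ => hD0 k
  have h1 := Finset.sum_le_sum hk
  rw [Finset.sum_add_distrib, ← Finset.mul_sum, ← Finset.mul_sum, Finset.sum_comm,
    Finset.sum_comm (s := Finset.range n) (t := Finset.range l)] at h1
  have h2 : ∑ j ∈ Finset.range (l + 1), ∑ k ∈ Finset.range n, L (j + k) ≤ (l + 1) * S := by
    refine (Finset.sum_le_sum fun j _ => sum_range_shift_le hL0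
      (fun k hk => levelSum_eq_zero (fun _ _ _ => rfl) k n τ false f hk) j).trans_eq ?_
    simp [hS]
  have h3 : ∑ j ∈ Finset.range l, ∑ k ∈ Finset.range n, D (j + k) ≤ l * DD := by
    refine (Finset.sum_le_sum fun j _ => sum_range_shift_le hD0
      (fun k hk => levelSum_eq_zero (fun _ _ _ => rfl) k n τ false _ hk) j).trans_eq ?_
    simp [hDD]
  have h4 : 1 / (2 * ((l : ℝ) + 1)) * ∑ j ∈ Finset.range (l + 1),
      ∑ k ∈ Finset.range n, L (j + k) ≤ S / 2 := by
    refine (mul_le_mul_of_nonneg_left h2 (by positivity)).trans_eq ?_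
    field_simp
  have h5 := mul_le_mul_of_nonneg_left h3 hC
  have h6 := ent_treeWt_le hlam n τ false f hf
  change _ ≤ S at h6
  nlinarith

end LogSobolev
section Decay

open Filter Topology

variable {b : ℕ} {lam : ℝ}

theorem influence_eq_zero : ∀ (l n : ℕ) (τ : List (Fin b) → Bool), n < l →
    influence lam l n τ = 0
  | _ + 1, 0, _, _ => rfl
  | l + 1, n + 1, τ, h => by
    simp [influence, influence_eq_zero l n _ (Nat.lt_of_succ_lt_succ h)]

theorem influence_le_pow (hlam : 0 ≤ lam) : ∀ (l n : ℕ) (τ : List (Fin b) → Bool),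
    influence lam l n τ ≤ ((b : ℝ) + 1) ^ l * Real.log (1 + lam)
  | 0, n, τ => by simp [influence]
  | l + 1, 0, τ => mul_nonneg (by positivity) (Real.log_nonneg (by linarith))
  | l + 1, n + 1, τ => by
    have hM : 0 ≤ Real.log (1 + lam) := Real.log_nonneg (by linarith)
    have hg : lam / (1 + lam) ≤ 1 := by rw [div_le_one (by positivity)]; linarith
    have h1 : ∑ i, (1 - vac lam (n + 1) (childBoundary τ i)) * influence lam l n (childBoundary τ i)
        ≤ ∑ _i : Fin b, ((b : ℝ) + 1) ^ l * Real.log (1 + lam) :=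
      Finset.sum_le_sum fun i _ =>
        (mul_le_of_le_one_left (influence_nonneg hlam l n _)
          (sub_le_self _ (vac_mem hlam _ _).1)).trans (influence_le_pow hlam l n _)
    have h0 := Finset.sum_nonneg fun i (_ : i ∈ Finset.univ) => mul_nonneg
      (sub_nonneg.2 (vac_mem hlam (n + 1) (childBoundary τ i)).2)
      (influence_nonneg hlam l n (childBoundary τ i))
    simp only [influence]
    refine (mul_le_of_le_one_left h0 hg).trans (h1.trans ?_)
    rw [Finset.sum_const, Finset.card_univ, Fintype.card_fin, nsmul_eq_mul, pow_succ]
    have : 0 ≤ ((b : ℝ) + 1) ^ l * Real.log (1 + lam) := by positivity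
    nlinarith

/-- Exponential decay of the influence if it contracts over two levels, far from the boundary. -/
theorem exists_influence_le (hlam : 0 ≤ lam) {P : ℕ → (List (Fin b) → Bool) → Prop}
    (hP : ∀ n τ i, P (n + 1) τ → P n (childBoundary τ i)) {s : ℝ} (hs : 0 < s) (hs1 : s < 1)
    (N : ℕ) (h : ∀ n τ, N ≤ n → P (n + 3) τ → (lam / (1 + lam)) ^ 2 *
      ∑ i, (1 - vac lam (n + 2) (childBoundary τ i)) *
        ∑ j, (1 - vac lam (n + 1) (childBoundary (childBoundary τ i) j)) ≤ s ^ 2) :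
    ∃ C : ℝ, ∀ l n τ, P (n + 1) τ → influence lam l n τ ≤ C * s ^ l := by
  have hM : 0 ≤ Real.log (1 + lam) := Real.log_nonneg (by linarith)
  set C := ((b : ℝ) + 1) ^ (N + 2) * Real.log (1 + lam) * s⁻¹ ^ (N + 2) with hC
  have hC0 : 0 ≤ C := by positivity
  refine ⟨C, fun l => ?_⟩
  induction l using Nat.strong_induction_on with
  | _ l ih =>
    intro n τ hp
    rcases le_or_gt l (N + 2) with hl | hl
    · refine (influence_le_pow hlam l n τ).trans ?_
      have h1 : ((b : ℝ) + 1) ^ l ≤ ((b : ℝ) + 1) ^ (N + 2) :=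
        pow_le_pow_right₀ (by linarith [(Nat.cast_nonneg b : (0 : ℝ) ≤ b)]) hl
      have h2 : 1 ≤ s⁻¹ ^ (N + 2) * s ^ l := by
        rw [inv_pow, inv_mul_eq_div, one_le_div (by positivity)]
        exact pow_le_pow_of_le_one hs.le hs1.le hl
      calc ((b : ℝ) + 1) ^ l * Real.log (1 + lam)
          ≤ ((b : ℝ) + 1) ^ (N + 2) * Real.log (1 + lam) := by gcongr
        _ ≤ ((b : ℝ) + 1) ^ (N + 2) * Real.log (1 + lam) * (s⁻¹ ^ (N + 2) * s ^ l) :=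
          le_mul_of_one_le_right (by positivity) h2
        _ = C * s ^ l := by rw [hC]; ring
    · rcases lt_or_ge n l with hn | hn
      · rw [influence_eq_zero l n τ hn]
        positivity
      · obtain ⟨l, rfl⟩ : ∃ k, l = k + 2 := ⟨l - 2, by omega⟩
        obtain ⟨n, rfl⟩ : ∃ k, n = k + 2 := ⟨n - 2, by omega⟩
        have hg : 0 ≤ lam / (1 + lam) := by positivity
        have h1 := h n τ (by omega) hp
        have hp0 : ∀ n (τ : List (Fin b) → Bool), 0 ≤ 1 - vac lam n τ := fun n τ =>
          sub_nonneg.2 (vac_mem hlam n τ).2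
        calc influence lam (l + 2) (n + 2) τ
            = lam / (1 + lam) * ∑ i, (1 - vac lam (n + 2) (childBoundary τ i)) *
              (lam / (1 + lam) * ∑ j, (1 - vac lam (n + 1) (childBoundary (childBoundary τ i) j)) *
                influence lam l n (childBoundary (childBoundary τ i) j)) := rfl
          _ ≤ lam / (1 + lam) * ∑ i, (1 - vac lam (n + 2) (childBoundary τ i)) *
              (lam / (1 + lam) * ∑ j, (1 - vac lam (n + 1) (childBoundary (childBoundary τ i) j)) *
                (C * s ^ l)) := by
            refine mul_le_mul_of_nonneg_left (Finset.sum_le_sum fun i _ =>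
              mul_le_mul_of_nonneg_left (mul_le_mul_of_nonneg_left (Finset.sum_le_sum fun j _ =>
                mul_le_mul_of_nonneg_left ?_ (hp0 _ _)) hg) (hp0 _ _)) hg
            exact ih l (by omega) n _ (hP _ _ j (hP _ _ i hp))
          _ = ((lam / (1 + lam)) ^ 2 * ∑ i, (1 - vac lam (n + 2) (childBoundary τ i)) *
              ∑ j, (1 - vac lam (n + 1) (childBoundary (childBoundary τ i) j))) * (C * s ^ l) := by
            rw [Finset.mul_sum, Finset.mul_sum, Finset.sum_mul]
            refine Finset.sum_congr rfl fun i _ => ?_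
            rw [← Finset.sum_mul]
            ring
          _ ≤ s ^ 2 * (C * s ^ l) := mul_le_mul_of_nonneg_right h1 (by positivity)
          _ = C * s ^ (l + 2) := by ring

theorem exists_le_pow_eight {ρ : ℝ} (hρ : 0 ≤ ρ) (hρ1 : ρ < 1) :
    ∃ r : ℝ, 0 < r ∧ r < 1 ∧ ρ ≤ (r ^ 4) ^ 2 := by
  refine ⟨1 + -((1 - ρ) / 8), by linarith, by linarith, ?_⟩
  have h := one_add_mul_le_pow (show (-2 : ℝ) ≤ -((1 - ρ) / 8) by linarith) 8
  rw [← pow_mul]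
  push_cast at h
  linarith

/-- The logarithmic Sobolev inequality, if the influence contracts over two levels. -/
theorem exists_ent_treeWt_le_of_contraction (hlam : 0 ≤ lam)
    {P : ℕ → (List (Fin b) → Bool) → Prop}
    (hP : ∀ n τ i, P (n + 1) τ → P n (childBoundary τ i)) {ρ : ℝ} (hρ : 0 ≤ ρ) (hρ1 : ρ < 1)
    (N : ℕ) (h : ∀ n τ, N ≤ n → P (n + 3) τ → (lam / (1 + lam)) ^ 2 *
      ∑ i, (1 - vac lam (n + 2) (childBoundary τ i)) *
        ∑ j, (1 - vac lam (n + 1) (childBoundary (childBoundary τ i) j)) ≤ ρ) :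
    ∃ C : ℝ, 0 < C ∧ ∀ n τ (f : Conf b n → ℝ), P n τ → (∀ x, 0 ≤ f x) →
      ent (treeWt lam n τ false) f ≤ C * ∑ j ∈ Finset.range n,
        levelSum lam (rootDir lam) j n τ false fun x => √(f x) := by
  obtain ⟨r, hr, hr1, hrρ⟩ := exists_le_pow_eight hρ hρ1
  obtain ⟨C, hC⟩ := exists_influence_le hlam hP (s := r ^ 4) (by positivity)
    (pow_lt_one₀ hr.le hr1 (by norm_num)) N fun n τ hn hp => (h n τ hn hp).trans hrρ
  exact exists_ent_treeWt_le hlam hP hr hr1 hC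

theorem one_sub_vac_succ_le (hlam : 0 ≤ lam) (n : ℕ) (τ : List (Fin b) → Bool) {Q : ℝ}
    (hQ : ∏ i, vac lam n (childBoundary τ i) ≤ Q) :
    1 - vac lam (n + 1) τ ≤ lam * Q / (1 + lam * Q) := by
  have h0 := (prod_vac_mem hlam n τ).1
  have h1 : 0 ≤ lam * ∏ i, vac lam n (childBoundary τ i) := mul_nonneg hlam h0
  have h2 : lam * ∏ i, vac lam n (childBoundary τ i) ≤ lam * Q := mul_le_mul_of_nonneg_left hQ hlam
  rw [vac_succ, one_sub_div (by positivity), div_le_div_iff₀ (by positivity) (by linarith)]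
  nlinarith

theorem two_level_sum_le {θ ρ : ℝ}
    (h : ∀ n (τ : List (Fin b) → Bool), (1 - vac lam (n + 2) τ) *
      ∑ j, (1 - vac lam (n + 1) (childBoundary τ j)) ≤ θ)
    (hρ : (lam / (1 + lam)) ^ 2 * (b * θ) ≤ ρ) (n : ℕ) (τ : List (Fin b) → Bool) :
    (lam / (1 + lam)) ^ 2 * ∑ i, (1 - vac lam (n + 2) (childBoundary τ i)) *
        ∑ j, (1 - vac lam (n + 1) (childBoundary (childBoundary τ i) j)) ≤ ρ := by
  refine le_trans (mul_le_mul_of_nonneg_left ((Finset.sum_le_sum fun i _ =>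
    h n (childBoundary τ i)).trans_eq ?_) (by positivity)) hρ
  simp

theorem pow_mul_sub_le_one {t : ℝ} (ht : 0 ≤ t) (b : ℕ) : t ^ b * (b + 1 - b * t) ≤ 1 := by
  induction b with
  | zero => simp
  | succ b ih =>
    have h1 : 0 ≤ (1 - t) * (1 - t ^ (b + 1)) := by
      rcases le_total t 1 with h | h
      · exact mul_nonneg (by linarith) (by linarith [pow_le_one₀ ht h (n := b + 1)])
      · exact mul_nonneg_of_nonpos_of_nonpos (by linarith)
          (by linarith [one_le_pow₀ h (n := b + 1)])
    have h2 := mul_le_mul_of_nonneg_left ih ht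
    push_cast
    have e : t ^ (b + 1) * ((b : ℝ) + 1 + 1 - (b + 1) * t)
        = t * (t ^ b * (b + 1 - b * t)) + 1 - t - (1 - t) * (1 - t ^ (b + 1)) := by ring
    rw [e]
    linarith

theorem prod_le_mean_pow {b : ℕ} (hb : b ≠ 0) {q : Fin b → ℝ} (hq : ∀ i, 0 ≤ q i) :
    ∏ i, q i ≤ ((∑ i, q i) / b) ^ b := by
  have hb' : (b : ℝ) ≠ 0 := Nat.cast_ne_zero.2 hb
  have h := Real.geom_mean_le_arith_mean_weighted Finset.univ (fun _ : Fin b => (b : ℝ)⁻¹) q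
    (fun _ _ => by positivity) (by simp [hb']) fun i _ => hq i
  have h0 : 0 ≤ ∏ i, q i ^ (b : ℝ)⁻¹ := Finset.prod_nonneg fun i _ => Real.rpow_nonneg (hq i) _
  have h1 := pow_le_pow_left₀ h0 h b
  rw [← Finset.prod_pow] at h1
  simp only [Real.rpow_inv_natCast_pow (hq _) hb] at h1
  refine h1.trans_eq ?_
  rw [← Finset.mul_sum, inv_mul_eq_div]

/-- The contraction below the uniqueness threshold. -/
theorem occupied_mul_sum_le_of_le_threshold (hb : 2 ≤ b) (hlam : 0 ≤ lam)
    (h : lam ≤ (b : ℝ) ^ b / ((b : ℝ) - 1) ^ (b + 1)) (n : ℕ) (τ : List (Fin b) → Bool) :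
    (1 - vac lam (n + 2) τ) * ∑ j, (1 - vac lam (n + 1) (childBoundary τ j)) ≤ 1 / b := by
  have hb2 : (2 : ℝ) ≤ b := by exact_mod_cast hb
  have hb1 : 0 < (b : ℝ) - 1 := by linarith
  set q := (∑ j, vac lam (n + 1) (childBoundary τ j)) / b with hq
  have hsum0 : 0 ≤ ∑ j, vac lam (n + 1) (childBoundary τ j) :=
    Finset.sum_nonneg fun j _ => (vac_mem hlam _ _).1
  have hq0 : 0 ≤ q := by positivity
  have hS : ∑ j, (1 - vac lam (n + 1) (childBoundary τ j)) = b * (1 - q) := by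
    rw [Finset.sum_sub_distrib, hq]
    simp
    field_simp
  have hS0 : 0 ≤ ∑ j, (1 - vac lam (n + 1) (childBoundary τ j)) :=
    Finset.sum_nonneg fun j _ => sub_nonneg.2 (vac_mem hlam _ _).2
  have hp := one_sub_vac_succ_le hlam (n + 1) τ
    (prod_le_mean_pow (by omega) fun i => (vac_mem hlam (n + 1) (childBoundary τ i)).1)
  rw [← hq] at hp
  refine (mul_le_mul_of_nonneg_right hp hS0).trans ?_
  rw [hS, div_mul_eq_mul_div, div_le_div_iff₀ (by positivity) (by positivity)]
  have key : lam * (q ^ b * (b ^ 2 * (1 - q) - 1)) ≤ 1 := by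
    rcases le_total (b ^ 2 * (1 - q) - 1) 0 with h0 | h0
    · have : q ^ b * (b ^ 2 * (1 - q) - 1) ≤ 0 := mul_nonpos_of_nonneg_of_nonpos (by positivity) h0
      nlinarith
    · refine (mul_le_mul_of_nonneg_right h (by positivity)).trans ?_
      have h1 := pow_mul_sub_le_one (t := q * b / (b - 1)) (by positivity) b
      refine le_of_eq_of_le ?_ h1
      clear_value q
      rw [div_pow, mul_pow]
      field_simp
      ring
  nlinarith

theorem two_mul_le_of_le_gap_threshold (hb : 2 ≤ b) (hlam : 0 ≤ lam)
    (h : lam ≤ 1 / (√(b : ℝ) - 1)) :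
    lam / (1 + lam) * √b ≤ 1 ∧ ∃ ρ : ℝ, 0 ≤ ρ ∧ ρ < 1 ∧ ∀ n (τ : List (Fin b) → Bool),
      (1 - vac lam (n + 2) τ) * ∑ j, (1 - vac lam (n + 1) (childBoundary τ j)) ≤ ρ := by
  have hb2 : (2 : ℝ) ≤ b := by exact_mod_cast hb
  set s := √(b : ℝ) with hs
  have hss : s * s = b := Real.mul_self_sqrt (by linarith)
  have hs1 : 1 < s := by
    rw [hs, Real.lt_sqrt (by norm_num)]
    linarith
  rw [le_div_iff₀ (by linarith)] at h
  have hg : lam / (1 + lam) * s ≤ 1 := by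
    rw [div_mul_eq_mul_div, div_le_one (by positivity)]
    linarith
  refine ⟨hg, ?_⟩
  set x := 1 - 1 / (2 * s) with hx
  have hx1 : x < 1 := by
    have : 0 < 1 / (2 * s) := by positivity
    linarith
  have hx0 : 0 < x := by
    have : 1 / (2 * s) < 1 := by
      rw [div_lt_one (by positivity)]
      linarith
    linarith
  have hlx : 0 ≤ lam * x := by positivity
  refine ⟨max (1 / 2) (lam * x / (1 + lam * x) * s), by positivity, max_lt (by norm_num) ?_,
    fun n τ => ?_⟩
  · rw [div_mul_eq_mul_div, div_lt_one (by positivity)]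
    nlinarith
  · set S := ∑ j, (1 - vac lam (n + 1) (childBoundary τ j)) with hS
    have hpj : ∀ (n : ℕ) (τ : List (Fin b) → Bool), 1 - vac lam (n + 1) τ ≤ lam / (1 + lam) := by
      intro n τ
      have := one_sub_vac_succ_le hlam n τ (prod_vac_mem hlam n τ).2
      simpa using this
    have hS0 : 0 ≤ S := Finset.sum_nonneg fun j _ => sub_nonneg.2 (vac_mem hlam _ _).2
    have hSs : S ≤ s := by
      have h1 : S ≤ ∑ _j : Fin b, lam / (1 + lam) := Finset.sum_le_sum fun j _ => hpj n _
      rw [Finset.sum_const, Finset.card_univ, Fintype.card_fin, nsmul_eq_mul] at h1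
      have h2 : (b : ℝ) * (lam / (1 + lam)) = s * (lam / (1 + lam) * s) := by
        rw [← hss]
        ring
      rw [h2] at h1
      exact h1.trans (mul_le_of_le_one_right (by linarith) hg)
    rcases le_total S (s / 2) with hle | hle
    · refine le_trans ?_ (le_max_left _ _)
      calc _ ≤ lam / (1 + lam) * (s / 2) :=
            mul_le_mul (hpj (n + 1) τ) hle hS0 (by positivity)
        _ ≤ 1 / 2 := by linarith
    · refine le_trans ?_ (le_max_right _ _)
      have hQ : ∏ j, vac lam (n + 1) (childBoundary τ j) ≤ x := by
        have h1 : ∀ j, ∏ i, vac lam (n + 1) (childBoundary τ i)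
            ≤ vac lam (n + 1) (childBoundary τ j) := by
          intro j
          rw [← Finset.mul_prod_erase _ _ (Finset.mem_univ j)]
          exact mul_le_of_le_one_right (vac_mem hlam _ _).1
            (Finset.prod_le_one (fun i _ => (vac_mem hlam _ _).1) fun i _ => (vac_mem hlam _ _).2)
        have h2 := Finset.sum_le_sum fun j (_ : j ∈ Finset.univ) => h1 j
        rw [Finset.sum_const, Finset.card_univ, Fintype.card_fin, nsmul_eq_mul] at h2
        have h3 : ∑ j, vac lam (n + 1) (childBoundary τ j) = b - S := by
          rw [hS, Finset.sum_sub_distrib]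
          simp
        rw [h3] at h2
        have h4 : (b : ℝ) * x = b - s / 2 := by
          rw [hx, ← hss]
          field_simp
        have h5 : (b : ℝ) * ∏ j, vac lam (n + 1) (childBoundary τ j) ≤ b * x := by linarith
        exact le_of_mul_le_mul_left h5 (by linarith)
      exact mul_le_mul (one_sub_vac_succ_le hlam (n + 1) τ hQ) hSs hS0 (by positivity)

/-- The contraction for arbitrary boundary conditions. -/
theorem exists_contraction (hb : 2 ≤ b) (hlam : 0 ≤ lam)
    (h : lam ≤ max (1 / (√(b : ℝ) - 1)) ((b : ℝ) ^ b / ((b : ℝ) - 1) ^ (b + 1))) :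
    ∃ ρ : ℝ, 0 ≤ ρ ∧ ρ < 1 ∧ ∀ n (τ : List (Fin b) → Bool), (lam / (1 + lam)) ^ 2 *
      ∑ i, (1 - vac lam (n + 2) (childBoundary τ i)) *
        ∑ j, (1 - vac lam (n + 1) (childBoundary (childBoundary τ i) j)) ≤ ρ := by
  have hb0 : (0 : ℝ) < b := by
    have : 0 < b := by omega
    exact_mod_cast this
  have hg : 0 ≤ lam / (1 + lam) := by positivity
  rcases le_max_iff.1 h with h | h
  · obtain ⟨h1, ρ, hρ, hρ1, h2⟩ := two_mul_le_of_le_gap_threshold hb hlam h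
    refine ⟨ρ, hρ, hρ1, fun n τ => two_level_sum_le h2 ?_ n τ⟩
    have e : (lam / (1 + lam)) ^ 2 * (b * ρ) = (lam / (1 + lam) * √b) ^ 2 * ρ := by
      rw [mul_pow, Real.sq_sqrt hb0.le]
      ring
    rw [e]
    exact mul_le_of_le_one_left hρ (pow_le_one₀ (by positivity) h1)
  · have hg1 : lam / (1 + lam) < 1 := by
      rw [div_lt_one (by positivity)]
      linarith
    refine ⟨(lam / (1 + lam)) ^ 2, by positivity, pow_lt_one₀ hg hg1 (by norm_num), fun n τ =>
      two_level_sum_le (occupied_mul_sum_le_of_le_threshold hb hlam h) ?_ n τ⟩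
    rw [mul_one_div_cancel hb0.ne', mul_one]

end Decay
section AlternatingBoundary

open Filter Topology

/-- The vacancy probabilities of the roots of the trees with `0, 1, 2, …` levels and an occupied
boundary. -/
def vacSeq (b : ℕ) (lam : ℝ) : ℕ → ℝ
  | 0 => 0
  | n + 1 => 1 / (1 + lam * vacSeq b lam n ^ b)

variable {b : ℕ} {lam : ℝ}

theorem vacSeq_mem (hlam : 0 ≤ lam) : ∀ n, 0 ≤ vacSeq b lam n ∧ vacSeq b lam n ≤ 1
  | 0 => by simp [vacSeq]
  | n + 1 => by
    have h : 0 ≤ lam * vacSeq b lam n ^ b := mul_nonneg hlam (pow_nonneg (vacSeq_mem hlam n).1 b)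
    unfold vacSeq
    exact ⟨by positivity, by rw [div_le_one (by positivity)]; linarith⟩

theorem vac_eq_vacSeq (hb : b ≠ 0) (β : Bool) :
    ∀ (n : ℕ) (τ : List (Fin b) → Bool), (∀ v, v.length = n → τ v = β) →
      vac lam n τ = vacSeq b lam (n + if β then 0 else 1)
  | 0, τ, h => by
    cases β <;> simp [vac, h [] rfl, vacSeq, hb]
  | n + 1, τ, h => by
    have ih : ∀ i, vac lam n (childBoundary τ i) = vacSeq b lam (n + if β then 0 else 1) :=
      fun i => vac_eq_vacSeq hb β n _ fun v hv => h (i :: v) (by simp [hv])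
    rw [vac_succ, add_right_comm, vacSeq]
    simp [ih]

theorem strictAnti_step (hb : b ≠ 0) (hlam : 0 < lam) {x y : ℝ} (hx : 0 ≤ x) (hxy : x < y) :
    1 / (1 + lam * y ^ b) < 1 / (1 + lam * x ^ b) := by
  have h : x ^ b < y ^ b := pow_lt_pow_left₀ hxy hx hb
  have hx' : 0 ≤ x ^ b := by positivity
  exact one_div_lt_one_div_of_lt (by positivity) (by nlinarith)

theorem vacSeq_even_lt (hb : b ≠ 0) (hlam : 0 < lam) :
    ∀ k, vacSeq b lam (2 * k) < vacSeq b lam (2 * (k + 1))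
  | 0 => by
    have := (vacSeq_mem (b := b) hlam.le 1).1
    simp only [vacSeq]
    positivity
  | k + 1 => by
    have ih := vacSeq_even_lt hb hlam k
    have h0 := fun n => (vacSeq_mem (b := b) hlam.le n).1
    have h1 : vacSeq b lam (2 * (k + 1) + 1) < vacSeq b lam (2 * k + 1) :=
      strictAnti_step hb hlam (h0 _) ih
    exact strictAnti_step hb hlam (h0 _) h1

theorem hasDerivAt_step (hlam : 0 ≤ lam) {x : ℝ} (hx : 0 < x) :
    HasDerivAt (fun x : ℝ => 1 / (1 + lam * x ^ b))
      (-(b * (1 - 1 / (1 + lam * x ^ b)) * (1 / (1 + lam * x ^ b)) / x)) x := by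
  have hpos : 0 < 1 + lam * x ^ b := by positivity
  have h1 : HasDerivAt (fun x : ℝ => 1 + lam * x ^ b) (lam * (b * x ^ (b - 1))) x :=
    ((hasDerivAt_pow b x).const_mul lam).const_add 1
  have h2 := h1.inv hpos.ne'
  have e : (fun x : ℝ => 1 / (1 + lam * x ^ b)) = (fun x : ℝ => 1 + lam * x ^ b)⁻¹ := by
    funext x
    simp
  rw [e]
  refine h2.congr_deriv ?_
  rcases Nat.eq_zero_or_pos b with rfl | hb
  · simp
  · obtain ⟨k, rfl⟩ : ∃ k, b = k + 1 := ⟨b - 1, by omega⟩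
    simp only [Nat.add_sub_cancel]
    field_simp
    ring

/-- The two limits of the alternating sequence of vacancy probabilities are stable. -/
theorem exists_limits (hb : b ≠ 0) (hlam : 0 < lam) : ∃ α β : ℝ,
    Tendsto (fun k => vacSeq b lam (2 * k)) atTop (𝓝 α) ∧
    Tendsto (fun k => vacSeq b lam (2 * k + 1)) atTop (𝓝 β) ∧
    (b : ℝ) ^ 2 * ((1 - α) * (1 - β)) ≤ 1 := by
  have hmem := vacSeq_mem (b := b) hlam.le
  have hmono : StrictMono fun k => vacSeq b lam (2 * k) :=
    strictMono_nat_of_lt_succ (vacSeq_even_lt hb hlam)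
  have hbdd : BddAbove (Set.range fun k => vacSeq b lam (2 * k)) :=
    ⟨1, by rintro _ ⟨k, rfl⟩; exact (hmem _).2⟩
  set α := ⨆ k, vacSeq b lam (2 * k)
  have hα : Tendsto (fun k => vacSeq b lam (2 * k)) atTop (𝓝 α) :=
    tendsto_atTop_ciSup hmono.monotone hbdd
  have hlt : ∀ k, vacSeq b lam (2 * k) < α := fun k =>
    (hmono (Nat.lt_succ_self k)).trans_le (le_ciSup hbdd (k + 1))
  have hα0 : 0 < α := (hmem (2 * 0)).1.trans_lt (hlt 0)
  set g : ℝ → ℝ := fun x => 1 / (1 + lam * x ^ b) with hg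
  have hgpos : ∀ x, 0 < x → 0 < g x := fun x hx => by
    simp only [hg]
    positivity
  set β := g α with hβdef
  have hβ0 : 0 < β := hgpos α hα0
  have hdα := hasDerivAt_step (b := b) hlam.le hα0
  have hdβ := hasDerivAt_step (b := b) hlam.le hβ0
  have hβ : Tendsto (fun k => vacSeq b lam (2 * k + 1)) atTop (𝓝 β) :=
    hdα.continuousAt.tendsto.comp hα
  have hα2 : Tendsto (fun k => vacSeq b lam (2 * k + 1 + 1)) atTop (𝓝 (g β)) :=
    hdβ.continuousAt.tendsto.comp hβ
  have hfix : g β = α := tendsto_nhds_unique hα2 (hα.comp (tendsto_add_atTop_nat 1))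
  refine ⟨α, β, hα, hβ, ?_⟩
  have hcomp := HasDerivAt.comp α hdβ hdα
  have hslope := hasDerivAt_iff_tendsto_slope.1 hcomp
  have hseq : Tendsto (fun k => vacSeq b lam (2 * k)) atTop (𝓝[≠] α) :=
    tendsto_nhdsWithin_iff.2 ⟨hα, Eventually.of_forall fun k => (hlt k).ne⟩
  have hle := le_of_tendsto' (hslope.comp hseq) (b := 1) fun k => by
    have e1 : ((fun x : ℝ => 1 / (1 + lam * x ^ b)) ∘ fun x : ℝ => 1 / (1 + lam * x ^ b))
        (vacSeq b lam (2 * k)) = vacSeq b lam (2 * (k + 1)) := rfl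
    have e2 : ((fun x : ℝ => 1 / (1 + lam * x ^ b)) ∘ fun x : ℝ => 1 / (1 + lam * x ^ b)) α = α :=
      hfix
    have h0 : 0 < α - vacSeq b lam (2 * k) := sub_pos.2 (hlt k)
    simp only [Function.comp_apply] at e1 e2 ⊢
    rw [slope_comm, slope_def_field, Function.comp_apply, Function.comp_apply, e1, e2,
      div_le_one h0]
    have := vacSeq_even_lt hb hlam k
    linarith
  refine le_of_eq_of_le ?_ hle
  change _ = -(b * (1 - g β) * g β / β) * -(b * (1 - g α) * g α / α)
  rw [hfix, ← hβdef]
  field_simp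

/-- The contraction for a constant boundary condition. -/
theorem exists_vacSeq_contraction (hb : b ≠ 0) (hlam : 0 ≤ lam) :
    ∃ (ρ : ℝ) (N : ℕ), 0 ≤ ρ ∧ ρ < 1 ∧ ∀ n, N ≤ n → (lam / (1 + lam)) ^ 2 *
      ((b : ℝ) ^ 2 * ((1 - vacSeq b lam n) * (1 - vacSeq b lam (n + 1)))) ≤ ρ := by
  rcases hlam.eq_or_lt with rfl | hlam'
  · exact ⟨0, 0, le_rfl, one_pos, fun n _ => by simp⟩
  obtain ⟨α, β, hα, hβ, hαβ⟩ := exists_limits hb hlam'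
  set γ := lam / (1 + lam) with hγ
  have hγ0 : 0 ≤ γ := by positivity
  have hγ1 : γ ^ 2 < 1 := by
    refine pow_lt_one₀ hγ0 ?_ (by norm_num)
    rw [hγ, div_lt_one (by positivity)]
    linarith
  have hlim : γ ^ 2 * ((b : ℝ) ^ 2 * ((1 - α) * (1 - β))) < (γ ^ 2 + 1) / 2 := by
    have := mul_le_mul_of_nonneg_left hαβ (sq_nonneg γ)
    linarith
  have hα' := hα.const_sub 1
  have hβ' := hβ.const_sub 1
  have t1 := ((hα'.mul hβ').const_mul ((b : ℝ) ^ 2)).const_mul (γ ^ 2)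
  have t2 := ((hβ'.mul (hα'.comp (tendsto_add_atTop_nat 1))).const_mul ((b : ℝ) ^ 2)).const_mul
    (γ ^ 2)
  rw [mul_comm (1 - β)] at t2
  obtain ⟨M, hM⟩ := eventually_atTop.1 ((t1.eventually (gt_mem_nhds hlim)).and
    (t2.eventually (gt_mem_nhds hlim)))
  refine ⟨(γ ^ 2 + 1) / 2, 2 * M, by positivity, by linarith, fun n hn => ?_⟩
  obtain ⟨k, hk⟩ := Nat.even_or_odd' n
  have hkM := hM k (by omega)
  rcases hk with rfl | rfl
  · exact hkM.1.le
  · exact hkM.2.le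

/-- The logarithmic Sobolev inequality for the boundary conditions that are constant on the
boundary. -/
theorem exists_ent_treeWt_le_of_const (hb : b ≠ 0) (hlam : 0 ≤ lam) :
    ∃ C : ℝ, 0 < C ∧ ∀ n τ (f : Conf b n → ℝ),
      (∃ β : Bool, ∀ v : List (Fin b), v.length = n → τ v = β) → (∀ x, 0 ≤ f x) →
      ent (treeWt lam n τ false) f ≤ C * ∑ j ∈ Finset.range n,
        levelSum lam (rootDir lam) j n τ false fun x => √(f x) := by
  obtain ⟨ρ, N, hρ, hρ1, h⟩ := exists_vacSeq_contraction hb hlam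
  refine exists_ent_treeWt_le_of_contraction hlam
    (P := fun n τ => ∃ β : Bool, ∀ v : List (Fin b), v.length = n → τ v = β)
    (fun n τ i ⟨β, hβ⟩ => ⟨β, fun v hv => hβ (i :: v) (by simp [hv])⟩) hρ hρ1 N
    fun n τ hn ⟨β, hβ⟩ => ?_
  have h2 : ∀ i, vac lam (n + 2) (childBoundary τ i)
      = vacSeq b lam (n + 2 + if β then 0 else 1) := fun i =>
    vac_eq_vacSeq hb β _ _ fun v hv => hβ (i :: v) (by simp [hv])
  have h1 : ∀ i j, vac lam (n + 1) (childBoundary (childBoundary τ i) j)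
      = vacSeq b lam (n + 1 + if β then 0 else 1) := fun i j =>
    vac_eq_vacSeq hb β _ _ fun v hv => hβ (i :: j :: v) (by simp [hv])
  simp only [h1, h2, Finset.sum_const, Finset.card_univ, Fintype.card_fin, nsmul_eq_mul]
  refine le_of_eq_of_le ?_ (h (n + 1 + if β then 0 else 1) (by omega))
  rw [show n + 1 + (if β then 0 else 1) + 1 = n + 2 + if β then 0 else 1 by ring]
  ring

end AlternatingBoundary

section Bridge

variable {b : ℕ} {lam : ℝ}

/-- The vertices at the levels `< n`. -/
def belowLevel (b : ℕ) : ℕ → Finset (List (Fin b))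
  | 0 => ∅
  | n + 1 => completeSubtree b n

theorem mem_belowLevel {n : ℕ} {x : List (Fin b)} : x ∈ belowLevel b n ↔ x.length < n := by
  cases n <;> simp [belowLevel, completeSubtree]

/-- Prepending a letter to a word. -/
def consEmbedding (b : ℕ) : Fin b × List (Fin b) ↪ List (Fin b) where
  toFun p := p.1 :: p.2
  inj' := by
    rintro ⟨i, x⟩ ⟨j, y⟩ h
    simpa using h

theorem consEmbedding_apply (p : Fin b × List (Fin b)) : consEmbedding b p = p.1 :: p.2 := rfl

theorem belowLevel_succ (n : ℕ) : belowLevel b (n + 1)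
    = insert [] ((Finset.univ ×ˢ belowLevel b n).map (consEmbedding b)) := by
  ext x
  rw [mem_belowLevel, Finset.mem_insert, Finset.mem_map]
  cases x with
  | nil => simp
  | cons i x =>
    simp only [consEmbedding_apply, Finset.mem_product, Finset.mem_univ, true_and, mem_belowLevel,
      List.length_cons, Nat.add_lt_add_iff_right, reduceCtorEq, false_or]
    constructor
    · exact fun h => ⟨(i, x), h, rfl⟩
    · rintro ⟨⟨j, y⟩, h, hxy⟩
      obtain ⟨-, rfl⟩ := List.cons.inj hxy
      exact h

theorem nil_notMem (n : ℕ) :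
    [] ∉ (Finset.univ ×ˢ belowLevel b n).map (consEmbedding b) := by
  simp [consEmbedding_apply]

theorem prod_belowLevel_succ (n : ℕ) (f : List (Fin b) → ℝ) :
    ∏ x ∈ belowLevel b (n + 1), f x = f [] * ∏ i, ∏ x ∈ belowLevel b n, f (i :: x) := by
  rw [belowLevel_succ, Finset.prod_insert (nil_notMem n), Finset.prod_map, Finset.prod_product]
  rfl

theorem sum_belowLevel_succ (n : ℕ) (f : List (Fin b) → ℝ) :
    ∑ x ∈ belowLevel b (n + 1), f x = f [] + ∑ i, ∑ x ∈ belowLevel b n, f (i :: x) := by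
  rw [belowLevel_succ, Finset.sum_insert (nil_notMem n), Finset.sum_map, Finset.sum_product]
  rfl

theorem tree_adj_nil (y : List (Fin b)) : (tree b).Adj [] y ↔ ∃ i, y = [i] := by
  simp only [tree, SimpleGraph.fromRel_adj, List.nil_append]
  constructor
  · rintro ⟨-, h | ⟨i, h⟩⟩
    · exact h
    · simp at h
  · rintro ⟨i, rfl⟩
    exact ⟨by simp, Or.inl ⟨i, rfl⟩⟩

theorem tree_adj_cons (i : Fin b) (x y : List (Fin b)) : (tree b).Adj (i :: x) y ↔
    (x = [] ∧ y = []) ∨ ∃ z, y = i :: z ∧ (tree b).Adj x z := by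
  simp only [tree, SimpleGraph.fromRel_adj]
  cases y with
  | nil =>
    simp only [List.cons_append, and_true, reduceCtorEq, false_and, exists_false, or_false,
      List.nil_append, List.cons.injEq, ne_eq, not_false_eq_true, true_and, false_or]
    constructor
    · rintro ⟨j, -, h⟩
      exact h
    · rintro rfl
      exact ⟨i, rfl, rfl⟩
  | cons j y =>
    simp only [List.cons_append, List.cons.injEq, reduceCtorEq, and_false, false_or, ne_eq]
    constructor
    · rintro ⟨hne, ⟨k, h1, h2⟩ | ⟨k, h1, h2⟩⟩
      · subst h1
        exact ⟨y, ⟨rfl, rfl⟩, by simpa using hne, Or.inl ⟨k, h2⟩⟩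
      · subst h1
        exact ⟨y, ⟨rfl, rfl⟩, by simpa using hne, Or.inr ⟨k, h2⟩⟩
    · rintro ⟨z, ⟨rfl, rfl⟩, hne, ⟨k, h⟩ | ⟨k, h⟩⟩
      · exact ⟨by simpa using hne, Or.inl ⟨k, rfl, h⟩⟩
      · exact ⟨by simpa using hne, Or.inr ⟨k, rfl, h⟩⟩

theorem compatible_succ (n : ℕ) (σ : List (Fin b) → Bool) :
    (∀ x ∈ belowLevel b (n + 1), ∀ y, (tree b).Adj x y → ¬(σ x = true ∧ σ y = true)) ↔
      (∀ i, ¬(σ [] = true ∧ σ [i] = true)) ∧ ∀ i, ∀ x ∈ belowLevel b n, ∀ y, (tree b).Adj x y →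
        ¬(childBoundary σ i x = true ∧ childBoundary σ i y = true) := by
  simp only [mem_belowLevel]
  constructor
  · intro h
    refine ⟨fun i => h [] (by simp) [i] ((tree_adj_nil _).2 ⟨i, rfl⟩), fun i x hx y hxy => ?_⟩
    exact h (i :: x) (by simpa using hx) (i :: y)
      ((tree_adj_cons i x _).2 (Or.inr ⟨y, rfl, hxy⟩))
  · rintro ⟨h1, h2⟩ x hx y hxy
    cases x with
    | nil =>
      obtain ⟨i, rfl⟩ := (tree_adj_nil _).1 hxy
      exact h1 i
    | cons i x =>
      rcases (tree_adj_cons i x y).1 hxy with ⟨rfl, rfl⟩ | ⟨z, rfl, hz⟩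
      · exact fun h => h1 i h.symm
      · exact h2 i x (by simpa using hx) z hz

theorem weight_eq_prod (G : SimpleGraph (List (Fin b))) (A : Finset (List (Fin b)))
    (σ : List (Fin b) → Bool)
    (h : ∀ x ∈ A, ∀ y, G.Adj x y → ¬(σ x = true ∧ σ y = true)) :
    weight G lam A σ = ∏ x ∈ A, if σ x = true then lam else 1 := by
  classical
  rw [weight, if_pos h, Finset.prod_ite, Finset.prod_const, Finset.prod_const_one, mul_one]

theorem weight_succ (n : ℕ) (σ : List (Fin b) → Bool) :
    weight (tree b) lam (belowLevel b (n + 1)) σ = if σ [] = true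
      then lam * ∏ i, (if σ [i] = true then 0 else 1) *
        weight (tree b) lam (belowLevel b n) (childBoundary σ i)
      else ∏ i, weight (tree b) lam (belowLevel b n) (childBoundary σ i) := by
  by_cases hc : ∀ i, ∀ x ∈ belowLevel b n, ∀ y, (tree b).Adj x y →
      ¬(childBoundary σ i x = true ∧ childBoundary σ i y = true)
  · by_cases h0 : ∀ i, ¬(σ [] = true ∧ σ [i] = true)
    · rw [weight_eq_prod _ _ _ ((compatible_succ n σ).2 ⟨h0, hc⟩), prod_belowLevel_succ]
      have h1 : ∀ i, weight (tree b) lam (belowLevel b n) (childBoundary σ i)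
          = ∏ x ∈ belowLevel b n, if σ (i :: x) = true then lam else 1 := fun i =>
        weight_eq_prod _ _ _ (hc i)
      simp only [h1]
      by_cases hs : σ [] = true
      · have h2 : ∀ i, ¬ σ [i] = true := fun i hi => h0 i ⟨hs, hi⟩
        simp [hs, h2]
      · simp [hs]
    · have hn : ¬ ∀ x ∈ belowLevel b (n + 1), ∀ y, (tree b).Adj x y →
          ¬(σ x = true ∧ σ y = true) := fun h => h0 ((compatible_succ n σ).1 h).1
      rw [weight, if_neg hn]
      push Not at h0
      obtain ⟨i, h1, h2⟩ := h0
      rw [if_pos h1, Finset.prod_eq_zero (Finset.mem_univ i) (by simp [h2]), mul_zero]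
  · have hn : ¬ ∀ x ∈ belowLevel b (n + 1), ∀ y, (tree b).Adj x y →
        ¬(σ x = true ∧ σ y = true) := fun h => hc ((compatible_succ n σ).1 h).2
    rw [weight, if_neg hn]
    rw [not_forall] at hc
    obtain ⟨i, hi⟩ := hc
    have h1 : weight (tree b) lam (belowLevel b n) (childBoundary σ i) = 0 := by
      rw [weight, if_neg hi]
    have h2 : ∏ i, (if σ [i] = true then 0 else 1) *
        weight (tree b) lam (belowLevel b n) (childBoundary σ i) = 0 :=
      Finset.prod_eq_zero (Finset.mem_univ i) (by rw [h1, mul_zero])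
    have h3 : ∏ i, weight (tree b) lam (belowLevel b n) (childBoundary σ i) = 0 :=
      Finset.prod_eq_zero (Finset.mem_univ i) h1
    rw [h2, h3]
    simp

/-- The restriction of a configuration to the first `n` levels. -/
def treeConf : (n : ℕ) → (List (Fin b) → Bool) → Conf b n
  | 0, _ => ()
  | n + 1, η => (η [], fun i => treeConf n (childBoundary η i))

/-- The hard-core weight is proportional to the law of the tree model. -/
theorem exists_weight_eq (hlam : 0 ≤ lam) : ∀ (n : ℕ) (τ : List (Fin b) → Bool),
    ∃ Z : ℝ, 0 < Z ∧ ∀ σ : List (Fin b) → Bool, (∀ x, n ≤ x.length → σ x = τ x) →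
      weight (tree b) lam (belowLevel b n) σ = Z * treeWt lam n τ false (treeConf n σ) ∧
      (if σ [] = true then 0 else 1) * weight (tree b) lam (belowLevel b n) σ
        = Z * vac lam n τ * treeWt lam n τ true (treeConf n σ)
  | 0, τ => by
    refine ⟨1, one_pos, fun σ hσ => ?_⟩
    have hw : weight (tree b) lam (belowLevel b 0) σ = 1 := by
      rw [weight_eq_prod _ _ _ (by simp [belowLevel])]
      simp [belowLevel]
    rw [hw]
    simp [treeWt, vac, hσ [] (Nat.zero_le _)]
  | n + 1, τ => by
    choose Z hZ h using fun i => exists_weight_eq hlam n (childBoundary τ i)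
    have hP : 0 ≤ lam * ∏ i, vac lam n (childBoundary τ i) :=
      mul_nonneg hlam (prod_vac_mem hlam n τ).1
    have hZp : 0 < ∏ i, Z i := Finset.prod_pos fun i _ => hZ i
    refine ⟨(∏ i, Z i) * (1 + lam * ∏ i, vac lam n (childBoundary τ i)), by positivity,
      fun σ hσ => ?_⟩
    have hi : ∀ i, ∀ x : List (Fin b), n ≤ x.length → childBoundary σ i x = childBoundary τ i x :=
      fun i x hx => hσ (i :: x) (by simpa using hx)
    have hZv : (∏ i, Z i) * (1 + lam * ∏ i, vac lam n (childBoundary τ i)) * vac lam (n + 1) τ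
        = ∏ i, Z i := by
      rw [vac_succ]
      field_simp
    rw [weight_succ]
    simp only [treeConf, treeWt]
    cases hs : σ []
    · simp only [Bool.false_eq_true, if_false, (h _ _ (hi _)).1, Finset.prod_mul_distrib, rootWt,
        one_mul]
      rw [← mul_assoc, hZv]
      exact ⟨rfl, rfl⟩
    · have h2 : ∀ i, (if σ [i] = true then (0 : ℝ) else 1) *
          weight (tree b) lam (belowLevel b n) (childBoundary σ i)
          = Z i * vac lam n (childBoundary τ i) *
            treeWt lam n (childBoundary τ i) true (treeConf n (childBoundary σ i)) := fun i =>
        (h i _ (hi i)).2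
      simp only [if_true, h2, Finset.prod_mul_distrib, rootWt, zero_mul, mul_zero, and_true]
      rw [one_sub_vac_succ hlam]
      linear_combination (-(lam * (∏ i, vac lam n (childBoundary τ i)) *
        ∏ i, treeWt lam n (childBoundary τ i) true (treeConf n (childBoundary σ i)))) * hZv

/-- The extension of a configuration on the first `n` levels. -/
def extend : (n : ℕ) → Conf b n → List (Fin b) → Bool
  | 0, _, _ => false
  | _ + 1, σ, [] => σ.1
  | n + 1, σ, i :: x => extend n (σ.2 i) x

theorem treeConf_congr : ∀ (n : ℕ) {η η' : List (Fin b) → Bool},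
    (∀ x, x.length < n → η x = η' x) → treeConf n η = treeConf n η'
  | 0, _, _, _ => rfl
  | n + 1, η, η', h => Prod.ext (h [] (by simp)) (funext fun i => treeConf_congr n
      fun x hx => h (i :: x) (by simpa using hx))

theorem treeConf_extend : ∀ (n : ℕ) (σ : Conf b n), treeConf n (extend n σ) = σ
  | 0, _ => rfl
  | n + 1, σ => Prod.ext rfl (funext fun i => treeConf_extend n (σ.2 i))

theorem extend_treeConf : ∀ (n : ℕ) (η : List (Fin b) → Bool) (x : List (Fin b)), x.length < n →
    extend n (treeConf n η) x = η x
  | 0, _, _, h => absurd h (Nat.not_lt_zero _)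
  | _ + 1, _, [], _ => rfl
  | n + 1, η, i :: x, h => extend_treeConf n (childBoundary η i) x (by simpa using h)

/-- Configurations on the first `n` levels as elements of `Conf b n`. -/
def confEquiv (n : ℕ) (τ : List (Fin b) → Bool) : (belowLevel b n → Bool) ≃ Conf b n where
  toFun ζ := treeConf n (patch (belowLevel b n) τ ζ)
  invFun σ x := extend n σ x.1
  left_inv ζ := funext fun x => by
    change extend n (treeConf n _) x.1 = ζ x
    rw [extend_treeConf n _ x.1 (mem_belowLevel.1 x.2), patch, dif_pos x.2]
  right_inv σ := by
    refine (treeConf_congr n fun x hx => ?_).trans (treeConf_extend n σ)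
    rw [patch, dif_pos (mem_belowLevel.2 hx)]

theorem gibbs_eq_treeWt (hlam : 0 ≤ lam) (n : ℕ) (τ : List (Fin b) → Bool)
    (ζ : belowLevel b n → Bool) :
    gibbs (tree b) lam (belowLevel b n) τ ζ = treeWt lam n τ false (confEquiv n τ ζ) := by
  obtain ⟨Z, hZ, h⟩ := exists_weight_eq hlam n τ
  have hw : ∀ ζ, weight (tree b) lam (belowLevel b n) (patch (belowLevel b n) τ ζ)
      = Z * treeWt lam n τ false (confEquiv n τ ζ) := fun ζ =>
    (h _ fun x hx => by
      rw [patch, dif_neg (fun hm => absurd (mem_belowLevel.1 hm) (not_lt.2 hx))]).1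
  have hsum : partitionFn (tree b) lam (belowLevel b n) τ = Z := by
    rw [partitionFn]
    simp only [hw]
    rw [← Finset.mul_sum, Equiv.sum_comp (confEquiv n τ) (treeWt lam n τ false),
      (isProb_treeWt hlam n τ false).sum_eq_one, mul_one]
  rw [gibbs, hw, hsum, mul_div_cancel_left₀ _ hZ.ne']

theorem expect_eq_ex (hlam : 0 ≤ lam) (n : ℕ) (τ : List (Fin b) → Bool)
    (f : (belowLevel b n → Bool) → ℝ) :
    expect (tree b) lam (belowLevel b n) τ f
      = ex (treeWt lam n τ false) fun σ => f ((confEquiv n τ).symm σ) := by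
  rw [expect, ex, ← Equiv.sum_comp (confEquiv n τ)]
  simp only [gibbs_eq_treeWt hlam, Equiv.symm_apply_apply]

theorem entropy_eq_ent (hlam : 0 ≤ lam) (n : ℕ) (τ : List (Fin b) → Bool)
    (f : (belowLevel b n → Bool) → ℝ) :
    entropy (tree b) lam (belowLevel b n) τ f
      = ent (treeWt lam n τ false) fun σ => f ((confEquiv n τ).symm σ) := by
  simp only [entropy, ent, expect_eq_ex hlam]

/-- The configuration with the spin at `x` set to vacant. -/
def clearAt : (n : ℕ) → List (Fin b) → Conf b n → Conf b n
  | 0, _, σ => σ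
  | _ + 1, [], σ => (false, σ.2)
  | n + 1, i :: x, σ => (σ.1, Function.update σ.2 i (clearAt n x (σ.2 i)))

theorem clearAt_treeConf : ∀ (n : ℕ) (x : List (Fin b)) (η : List (Fin b) → Bool), x.length < n →
    clearAt n x (treeConf n η) = treeConf n (Function.update η x false)
  | 0, _, _, h => absurd h (Nat.not_lt_zero _)
  | n + 1, [], η, _ => by
    refine Prod.ext (by simp [clearAt, treeConf]) (funext fun i => treeConf_congr n fun x _ => ?_)
    simp [childBoundary]
  | n + 1, i :: x, η, h => by
    refine Prod.ext (by simp [clearAt, treeConf]) (funext fun j => ?_)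
    have ih := clearAt_treeConf n x (childBoundary η i) (by simpa using h)
    by_cases hj : j = i
    · subst hj
      simp only [clearAt, treeConf, Function.update_self, ih]
      refine treeConf_congr n fun y _ => ?_
      by_cases hy : y = x
      · subst hy; simp [childBoundary]
      · simp [childBoundary, hy]
    · simp only [clearAt, treeConf, Function.update_of_ne hj]
      refine treeConf_congr n fun y _ => ?_
      simp [childBoundary, hj]

/-- The contribution of the vertex `x` to the Dirichlet form. -/
def siteDir (lam : ℝ) (n : ℕ) (τ : List (Fin b) → Bool) (u : Bool) (x : List (Fin b))
    (f : Conf b n → ℝ) : ℝ :=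
  ex (treeWt lam n τ u) fun σ => if extend n σ x = true then (f σ - f (clearAt n x σ)) ^ 2 else 0

theorem siteDir_nil (n : ℕ) (τ : List (Fin b) → Bool) (u : Bool) (f : Conf b (n + 1) → ℝ) :
    siteDir lam (n + 1) τ u [] f = rootDir lam (n + 1) τ u f := by
  rw [siteDir, ex_treeWt_succ, ex_rootWt]
  simp [extend, clearAt, rootDir, ex_zero]

theorem siteDir_cons (hlam : 0 ≤ lam) (n : ℕ) (τ : List (Fin b) → Bool) (u : Bool) (i : Fin b)
    (x : List (Fin b)) (f : Conf b (n + 1) → ℝ) :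
    siteDir lam (n + 1) τ u (i :: x) f = ex (rootWt lam n τ u) fun s =>
      ex (childWt lam n τ s) fun c =>
        siteDir lam n (childBoundary τ i) s x fun d => f (s, Function.update c i d) := by
  rw [siteDir, ex_treeWt_succ]
  refine congrArg _ (funext fun s => ?_)
  refine (ex_pw_update (w := fun i => treeWt lam n (childBoundary τ i) s) (i := i)
    (isProb_treeWt hlam n (childBoundary τ i) s) _).symm.trans ?_
  refine congrArg _ (funext fun c => congrArg _ (funext fun d => ?_))
  simp only [extend, clearAt, Function.update_self, Function.update_idem]

theorem sum_siteDir (hlam : 0 ≤ lam) : ∀ (n : ℕ) (τ : List (Fin b) → Bool) (u : Bool)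
    (f : Conf b n → ℝ), ∑ x ∈ belowLevel b n, siteDir lam n τ u x f
      = ∑ j ∈ Finset.range n, levelSum lam (rootDir lam) j n τ u f
  | 0, _, _, _ => by simp [belowLevel]
  | n + 1, τ, u, f => by
    rw [sum_belowLevel_succ, siteDir_nil, Finset.sum_range_succ', add_comm]
    refine congrArg₂ _ ?_ rfl
    simp only [siteDir_cons hlam, levelSum]
    rw [← ex_sum]
    simp only [← ex_sum, sum_siteDir hlam n]
    refine congrArg _ (funext fun s => ?_)
    exact congrArg _ (funext fun c => Finset.sum_comm)

theorem flipRate_nonneg {V : Type*} [DecidableEq V] (G : SimpleGraph V) (hlam : 0 ≤ lam)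
    (A : Finset V) (η : V → Bool) (x : A) (ζ : A → Bool) : 0 ≤ flipRate G lam A η x ζ := by
  have hw : ∀ A σ, 0 ≤ weight G lam A σ := fun A σ => by
    unfold weight
    split_ifs <;> positivity
  exact div_nonneg (hw _ _) (Finset.sum_nonneg fun _ _ => hw _ _)

theorem flipRate_ge {V : Type*} [DecidableEq V] (G : SimpleGraph V) (hlam : 0 ≤ lam)
    (A : Finset V) (η : V → Bool) (x : A) (ζ : A → Bool) (hx : ζ x = true) :
    1 / (1 + lam) ≤ flipRate G lam A η x ζ := by
  classical
  set σ := patch A η ζ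
  have h0 : weight G lam {x.1} (patch {x.1} σ fun _ => false) = 1 := by
    rw [weight, if_pos (by
      intro y hy z _ h
      rw [patch, dif_pos hy] at h
      exact Bool.false_ne_true h.1)]
    have : (({x.1} : Finset V).filter fun y => patch {x.1} σ (fun _ => false) y = true) = ∅ := by
      rw [Finset.filter_eq_empty_iff]
      intro y hy
      rw [patch, dif_pos hy]
      exact Bool.false_ne_true
    rw [this, Finset.card_empty, pow_zero]
  have h1 : weight G lam {x.1} (patch {x.1} σ fun _ => true) ≤ lam := by
    unfold weight
    split_ifs
    · have : (({x.1} : Finset V).filter fun y => patch {x.1} σ (fun _ => true) y = true)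
          = {x.1} := by
        rw [Finset.filter_eq_self]
        intro y hy
        rw [patch, dif_pos hy]
      rw [this, Finset.card_singleton, pow_one]
    · exact hlam
  have h1' : 0 ≤ weight G lam {x.1} (patch {x.1} σ fun _ => true) := by
    unfold weight
    split_ifs <;> positivity
  have hZ : partitionFn G lam {x.1} σ
      = weight G lam {x.1} (patch {x.1} σ fun _ => true) + 1 := by
    rw [partitionFn, ← Equiv.sum_comp (Equiv.funUnique ({x.1} : Finset V) Bool).symm,
      Fintype.sum_bool, ← h0]
    rfl
  unfold flipRate gibbs
  rw [hx, Bool.not_true, h0, hZ]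
  exact one_div_le_one_div_of_le (by linarith) (by linarith)

theorem sum_levelSum_rootDir_le (hlam : 0 ≤ lam) (n : ℕ) (τ : List (Fin b) → Bool)
    (f : (belowLevel b n → Bool) → ℝ) :
    ∑ j ∈ Finset.range n, levelSum lam (rootDir lam) j n τ false
      (fun σ => f ((confEquiv n τ).symm σ))
      ≤ 2 * (1 + lam) * dirichlet (tree b) lam (belowLevel b n) τ f := by
  rw [← sum_siteDir hlam, dirichlet, ← Finset.sum_coe_sort]
  have h : ∀ x : belowLevel b n, siteDir lam n τ false x.1 (fun σ => f ((confEquiv n τ).symm σ))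
      ≤ (1 + lam) * expect (tree b) lam (belowLevel b n) τ fun ζ =>
        flipRate (tree b) lam (belowLevel b n) τ x ζ * (f (flip ζ x) - f ζ) ^ 2 := by
    intro x
    rw [expect_eq_ex hlam, siteDir, ← ex_const_mul]
    refine (isProb_treeWt hlam n τ false).ex_mono fun σ => ?_
    obtain ⟨ζ, rfl⟩ := (confEquiv n τ).surjective σ
    rw [Equiv.symm_apply_apply]
    have hζ : extend n (confEquiv n τ ζ) x.1 = ζ x :=
      congrFun ((confEquiv n τ).symm_apply_apply ζ) x
    rw [hζ]
    have h0 := flipRate_nonneg (tree b) hlam (belowLevel b n) τ x ζ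
    split_ifs with hx
    · have hc : clearAt n x.1 (confEquiv n τ ζ) = confEquiv n τ (flip ζ x) := by
        refine (clearAt_treeConf n x.1 _ (mem_belowLevel.1 x.2)).trans
          (treeConf_congr n fun y hy => ?_)
        rw [patch, dif_pos (mem_belowLevel.2 hy), flip, hx]
        by_cases hyx : y = x.1
        · subst hyx
          simp
        · have : (⟨y, mem_belowLevel.2 hy⟩ : belowLevel b n) ≠ x := fun h =>
            hyx (congrArg Subtype.val h)
          rw [Function.update_of_ne hyx, Function.update_of_ne this, patch,
            dif_pos (mem_belowLevel.2 hy)]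
      rw [hc, Equiv.symm_apply_apply, ← mul_assoc]
      have h1 := flipRate_ge (tree b) hlam (belowLevel b n) τ x ζ hx
      rw [div_le_iff₀ (by positivity)] at h1
      have h2 := mul_le_mul_of_nonneg_right h1 (sq_nonneg (f (flip ζ x) - f ζ))
      linarith
    · positivity
  refine (Finset.sum_le_sum fun x _ => h x).trans_eq ?_
  rw [← Finset.mul_sum]
  ring

end Bridge

section Variational

variable {b : ℕ} {lam : ℝ}

theorem variance_eq (hlam : 0 ≤ lam) (n : ℕ) (τ : List (Fin b) → Bool)
    (f : (belowLevel b n → Bool) → ℝ) (m : ℝ) :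
    variance (tree b) lam (belowLevel b n) τ f
      = ex (treeWt lam n τ false) (fun σ => (f ((confEquiv n τ).symm σ) + m) ^ 2)
        - ex (treeWt lam n τ false) (fun σ => f ((confEquiv n τ).symm σ) + m) ^ 2 := by
  have h := isProb_treeWt hlam n τ false
  rw [variance, expect_eq_ex hlam, expect_eq_ex hlam]
  have e1 : ex (treeWt lam n τ false) (fun σ => (f ((confEquiv n τ).symm σ) + m) ^ 2)
      = ex (treeWt lam n τ false) (fun σ => f ((confEquiv n τ).symm σ) ^ 2)
        + (2 * m * ex (treeWt lam n τ false) (fun σ => f ((confEquiv n τ).symm σ)) + m ^ 2) := by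
    rw [← ex_const_mul, ← h.ex_const (m ^ 2), ← ex_add, ← ex_add]
    exact congrArg _ (funext fun σ => by ring)
  rw [e1, ex_add, h.ex_const]
  ring

theorem variance_le_entropy_sq (hlam : 0 ≤ lam) (n : ℕ) (τ : List (Fin b) → Bool)
    (f : (belowLevel b n → Bool) → ℝ) (hf : ∀ ζ, 0 ≤ f ζ) :
    variance (tree b) lam (belowLevel b n) τ f
      ≤ entropy (tree b) lam (belowLevel b n) τ fun ζ => f ζ ^ 2 := by
  rw [entropy_eq_ent hlam, variance, expect_eq_ex hlam, expect_eq_ex hlam]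
  exact (isProb_treeWt hlam n τ false).var_le_ent_sq fun σ => hf _

theorem variance_pos (hlam : 0 ≤ lam) (n : ℕ) (τ : List (Fin b) → Bool)
    (f : (belowLevel b n → Bool) → ℝ) (hf : NonConst (tree b) lam (belowLevel b n) τ f) :
    0 < variance (tree b) lam (belowLevel b n) τ f := by
  have h := isProb_treeWt hlam n τ false
  set m := ex (treeWt lam n τ false) (fun σ => f ((confEquiv n τ).symm σ)) with hm
  have e : variance (tree b) lam (belowLevel b n) τ f
      = ex (treeWt lam n τ false) (fun σ => (f ((confEquiv n τ).symm σ) + -m) ^ 2) := by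
    rw [variance_eq hlam n τ f (-m), ex_add, h.ex_const, ← hm]
    ring
  rw [e]
  obtain ⟨ζ, ζ', h1, h2, hne⟩ := hf
  rw [gibbs_eq_treeWt hlam] at h1 h2
  have key : ∀ ζ, 0 < treeWt lam n τ false (confEquiv n τ ζ) → f ζ ≠ m →
      0 < ex (treeWt lam n τ false) (fun σ => (f ((confEquiv n τ).symm σ) + -m) ^ 2) := by
    intro ζ hζ hfm
    refine Finset.sum_pos' (fun σ _ => mul_nonneg (h.nonneg σ) (sq_nonneg _))
      ⟨confEquiv n τ ζ, Finset.mem_univ _, mul_pos hζ ?_⟩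
    simp only [Equiv.symm_apply_apply, ← sub_eq_add_neg]
    exact sq_pos_of_ne_zero (sub_ne_zero.2 hfm)
  by_cases hz : f ζ = m
  · exact key ζ' h2 fun hz' => hne (hz.trans hz'.symm)
  · exact key ζ h1 hz

theorem entropy_pos (hlam : 0 ≤ lam) (n : ℕ) (τ : List (Fin b) → Bool)
    (f : (belowLevel b n → Bool) → ℝ) (hf0 : ∀ ζ, 0 ≤ f ζ)
    (hf : NonConst (tree b) lam (belowLevel b n) τ f) :
    0 < entropy (tree b) lam (belowLevel b n) τ f := by
  obtain ⟨ζ, ζ', h1, h2, hne⟩ := hf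
  have hs : NonConst (tree b) lam (belowLevel b n) τ fun ζ => √(f ζ) :=
    ⟨ζ, ζ', h1, h2, fun h => hne ((Real.sqrt_inj (hf0 _) (hf0 _)).1 h)⟩
  refine (variance_pos hlam n τ _ hs).trans_le
    ((variance_le_entropy_sq hlam n τ _ fun ζ => Real.sqrt_nonneg _).trans_eq ?_)
  simp only [Real.sq_sqrt (hf0 _)]

/-- A logarithmic Sobolev inequality for the tree model bounds both constants of the dynamics. -/
theorem exists_le_spectralGap_and_logSobolev (hlam : 0 ≤ lam)
    {P : ℕ → (List (Fin b) → Bool) → Prop}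
    (h : ∃ C : ℝ, 0 < C ∧ ∀ (n : ℕ) (τ : List (Fin b) → Bool) (f : Conf b n → ℝ), P n τ →
      (∀ x, 0 ≤ f x) → ent (treeWt lam n τ false) f
        ≤ C * ∑ j ∈ Finset.range n, levelSum lam (rootDir lam) j n τ false fun x => √(f x)) :
    ∃ c : ℝ, 0 < c ∧ ∀ (n : ℕ) (τ : List (Fin b) → Bool), P n τ →
      (c : EReal) ≤ spectralGap (tree b) lam (belowLevel b n) τ ∧
      (c : EReal) ≤ logSobolev (tree b) lam (belowLevel b n) τ := by
  obtain ⟨C, hC, h⟩ := h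
  have hD : 0 < C * (2 * (1 + lam)) := by positivity
  refine ⟨1 / (C * (2 * (1 + lam))), by positivity, fun n τ hP => ?_⟩
  have hE : ∀ f : (belowLevel b n → Bool) → ℝ, (∀ ζ, 0 ≤ f ζ) →
      entropy (tree b) lam (belowLevel b n) τ f ≤ C * (2 * (1 + lam)) *
        dirichlet (tree b) lam (belowLevel b n) τ fun ζ => √(f ζ) := by
    intro f hf
    rw [entropy_eq_ent hlam, mul_assoc]
    exact (h n τ _ hP fun σ => hf _).trans (mul_le_mul_of_nonneg_left
      (sum_levelSum_rootDir_le hlam n τ fun ζ => √(f ζ)) hC.le)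
  have hV : ∀ f : (belowLevel b n → Bool) → ℝ,
      variance (tree b) lam (belowLevel b n) τ f ≤ C * (2 * (1 + lam)) *
        dirichlet (tree b) lam (belowLevel b n) τ f := by
    intro f
    set K := ∑ ζ, |f ζ|
    have hK : ∀ ζ, 0 ≤ f ζ + K := fun ζ => by
      have h1 : |f ζ| ≤ K := Finset.single_le_sum (f := fun ζ => |f ζ|)
        (fun ζ _ => abs_nonneg (f ζ)) (Finset.mem_univ ζ)
      linarith [neg_abs_le (f ζ)]
    have h1 : variance (tree b) lam (belowLevel b n) τ f
        = variance (tree b) lam (belowLevel b n) τ fun ζ => f ζ + K := by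
      rw [variance_eq hlam n τ f K, variance_eq hlam n τ (fun ζ => f ζ + K) 0]
      simp only [add_zero]
    have h2 : dirichlet (tree b) lam (belowLevel b n) τ f
        = dirichlet (tree b) lam (belowLevel b n) τ fun ζ => √((f ζ + K) ^ 2) := by
      simp only [Real.sqrt_sq (hK _), dirichlet, add_sub_add_right_eq_sub]
    rw [h1, h2]
    exact (variance_le_entropy_sq hlam n τ _ hK).trans (hE _ fun ζ => sq_nonneg _)
  constructor
  · refine le_iInf₂ fun f hf => EReal.coe_le_coe_iff.2 ?_
    rw [le_div_iff₀ (variance_pos hlam n τ f hf), one_div_mul_eq_div, div_le_iff₀ hD, mul_comm]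
    exact hV f
  · refine le_iInf₂ fun f hf0 => le_iInf fun hf => EReal.coe_le_coe_iff.2 ?_
    rw [le_div_iff₀ (entropy_pos hlam n τ f hf0 hf), one_div_mul_eq_div, div_le_iff₀ hD, mul_comm]
    exact hE f hf0

end Variational
end HardCore
end

theorem mainTheorem10 (b : ℕ) (hb : 2 ≤ b) (lam : ℝ) (hlam : 0 ≤ lam) :
    (lam ≤ max (1 / (√(b : ℝ) - 1)) ((b : ℝ) ^ b / ((b : ℝ) - 1) ^ (b + 1)) →
      ∃ c : ℝ, 0 < c ∧ ∀ (m : ℕ) (τ : List (Fin b) → Bool),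
        (c : EReal) ≤ HardCore.spectralGap (HardCore.tree b) lam (HardCore.completeSubtree b m) τ ∧
        (c : EReal) ≤ HardCore.logSobolev (HardCore.tree b) lam (HardCore.completeSubtree b m) τ) ∧
    (∃ c : ℝ, 0 < c ∧ ∀ (m : ℕ) (τ : List (Fin b) → Bool),
        (τ = HardCore.evenBoundary b ∨ τ = HardCore.oddBoundary b) →
        (c : EReal) ≤ HardCore.spectralGap (HardCore.tree b) lam (HardCore.completeSubtree b m) τ ∧
        (c : EReal) ≤ HardCore.logSobolev (HardCore.tree b) lam (HardCore.completeSubtree b m) τ) := by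
  constructor
  · intro h
    obtain ⟨ρ, hρ, hρ1, hc⟩ := HardCore.exists_contraction hb hlam h
    obtain ⟨c, hc0, hc⟩ := HardCore.exists_le_spectralGap_and_logSobolev hlam
      (HardCore.exists_ent_treeWt_le_of_contraction (P := fun _ _ => True) hlam
        (fun _ _ _ _ => trivial) hρ hρ1 0 fun n τ _ _ => hc n τ)
    exact ⟨c, hc0, fun m τ => hc (m + 1) τ trivial⟩
  · obtain ⟨c, hc0, hc⟩ := HardCore.exists_le_spectralGap_and_logSobolev hlam
      (HardCore.exists_ent_treeWt_le_of_const (b := b) (by omega) hlam)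
    refine ⟨c, hc0, fun m τ hτ => hc (m + 1) τ ?_⟩
    rcases hτ with rfl | rfl
    · exact ⟨decide (Even (m + 1)), fun v hv => by rw [HardCore.evenBoundary, hv]⟩
    · exact ⟨decide (Odd (m + 1)), fun v hv => by rw [HardCore.oddBoundary, hv]⟩
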